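/- Let $T>0$, and let $\rho,k,\gamma$ be real functions on $[0,+\infty)$, extended evenly to $\mathbb R$ (same symbols), such that $\rho,k\in C^1[0,+\infty)$ are positive, $\rho k\in C^2[0,+\infty)$ and $(\rho k)'(0)=0$. Put $$\sigma(x)=\int_0^x\sqrt{\rho(|\xi|)/k(|\xi|)}\,d\xi,\quad Q_1=\sqrt{\tfrac k\rho}\,\frac{(k\rho)'}{4k\rho},\quad Q_2=\sqrt{\tfrac k\rho}\,Q_1'+Q_1^2,\quad q=Q_2-\gamma,$$ and assume that $\sigma(x)\to+\infty$ as $x\to+\infty$, $q\in L^\infty(0,+\infty)\cap C^1[0,+\infty)$ and $\sqrt{\rho/k}\,q\,\sigma\in L^1(0,+\infty)$. Let $L^2_\rho(\mathbb R)$ be the real $L^2$-space of the measure $\rho\,dx$. For $\varphi\in L^2_{\rm loc}(\mathbb R)$ put $\mathcal D_{\rho k}\varphi=\sqrt{k/\rho}\,\varphi'+Q_1\varphi$, with $\varphi'$ the distributional derivative. Let $\mathbb H^1=\{\varphi\in L^2_\rho(\mathbb R):\mathcal D_{\rho k}\varphi\in L^2_\rho(\mathbb R)\}$ with the norm $\big(\|\varphi\|^2_{L^2_\rho}+\|\mathcal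 D_{\rho k}\varphi\|^2_{L^2_\rho}\big)^{1/2}$, let $\mathbb H^{-1}=(\mathbb H^1)^*$ be its dual, and let $\widehat{\mathbb H}^{1}$, $\widehat{\mathbb H}^{-1}$ be the subspaces of even elements. Each $f\in L^2_\rho(\mathbb R)$ is identified with the functional $\varphi\mapsto\int_{\mathbb R}f\varphi\rho\,dx$ in $\mathbb H^{-1}$. For $f,\varphi\in\mathbb H^1$ put $\langle\langle\mathcal D_{\rho k}^2f,\varphi\rangle\rangle=-\int_{\mathbb R}(\mathcal D_{\rho k}f)(\mathcal D_{\rho k}\varphi)\rho\,dx$ and $\langle\langle\delta,\varphi\rangle\rangle=\varphi(0)$ (value of the continuous representative). Let $u\in L^\infty(0,T)$ and $W^0\in\widehat{\mathbb H}^1$, and let $W:[0,T]\to\widehat{\mathbb H}^1$ be a solution of $$W_t=\mathcal D_{\rho k}^2W-qW-2\sqrt{(\rho k)(0)}\,u\,\delta\ \text{ on }\mathbb R\times(0,T),\qquad W(\cdot,0)=W^0,$$ that is, $W(0)=W^0$, $W$ is absolutely continuous on $[0,T]$ as a map into $\mathbb H^{-1}$, and for almost every $t\in(0,T)$ its derivative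 $W_t(t)\in\widehat{\mathbb H}^{-1}$ exists in the norm of $\mathbb H^{-1}$ and satisfies the equation in $\mathbb H^{-1}$. Then $$(\mathcal D_{\rho k}W)(0^+,t)=u(t)\quad\text{for a.e. }t\in(0,T).$$ Moreover, for a.e. $t\in(0,T)$ the restriction $w(\cdot,t)$ of $W(\cdot,t)$ to $(0,+\infty)$ satisfies the Neumann condition $\big(\sqrt{k/\rho}\,w_x\big)(0^+,t)=u(t)$, where $w_x$ is the distributional derivative on $(0,+\infty)$. Here $g(0^+)=c$, for a function $g$ defined up to null sets, means that $g$ has essential limit $c$ as $x\to0^+$. -/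

import Mathlib

open Set Filter Topology MeasureTheory
open scoped ENNReal ContDiff

noncomputable section

namespace HalfAxisHeat

/-- `Q₁(ρ,k) = √(k/ρ) (kρ)' / (4kρ)`. For the even coefficients of `Admissible` the product `kρ` is
`C²` on the whole line, so `deriv` is the classical derivative at every point. -/
def Q1 (ρ k : ℝ → ℝ) (x : ℝ) : ℝ :=
  Real.sqrt (k x / ρ x) * deriv (fun y => k y * ρ y) x / (4 * (k x * ρ x))

/-- `Q₂(ρ,k) = √(k/ρ) (Q₁(ρ,k))' + Q₁(ρ,k)²`. -/
def Q2 (ρ k : ℝ → ℝ) (x : ℝ) : ℝ :=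
  Real.sqrt (k x / ρ x) * deriv (Q1 ρ k) x + Q1 ρ k x ^ 2

/-- The potential `q = Q₂(ρ,k) - γ`. -/
def pot (ρ k γ : ℝ → ℝ) (x : ℝ) : ℝ := Q2 ρ k x - γ x

/-- `σ(x) = ∫₀ˣ √(ρ(|ξ|)/k(|ξ|)) dξ`. -/
def sig (ρ k : ℝ → ℝ) (x : ℝ) : ℝ :=
  ∫ ξ in (0 : ℝ)..x, Real.sqrt (ρ |ξ| / k |ξ|)

/-- The standing assumptions on the coefficients, which are functions on the half-axis extended
evenly to `ℝ` (so only their values on `[0,∞)` carry information). -/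
structure Admissible (ρ k γ : ℝ → ℝ) : Prop where
  rho_even : ∀ x, ρ (-x) = ρ x
  k_even : ∀ x, k (-x) = k x
  gamma_even : ∀ x, γ (-x) = γ x
  rho_pos : ∀ x ∈ Ici (0 : ℝ), 0 < ρ x
  k_pos : ∀ x ∈ Ici (0 : ℝ), 0 < k x
  rho_C1 : ContDiffOn ℝ 1 ρ (Ici 0)
  k_C1 : ContDiffOn ℝ 1 k (Ici 0)
  rhok_C2 : ContDiffOn ℝ 2 (fun x => ρ x * k x) (Ici 0)
  rhok_deriv_zero : derivWithin (fun x => ρ x * k x) (Ici 0) 0 = 0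
  sig_tendsto : Tendsto (sig ρ k) atTop atTop
  pot_bdd : MemLp (pot ρ k γ) ∞ (volume.restrict (Ioi 0))
  pot_C1 : ContDiffOn ℝ 1 (pot ρ k γ) (Ici 0)
  pot_weight : IntegrableOn
    (fun x => Real.sqrt (ρ x / k x) * pot ρ k γ x * sig ρ k x) (Ioi 0)

/-- `f'` is the derivative of `f` in the sense of distributions on the open set `Ω`; both functions
are locally integrable there. -/
structure IsWeakDerivOn (Ω : Set ℝ) (f f' : ℝ → ℝ) : Prop where
  loc : LocallyIntegrableOn f Ω
  loc_deriv : LocallyIntegrableOn f' Ω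
  by_parts : ∀ ψ : ℝ → ℝ, ContDiff ℝ ∞ ψ → HasCompactSupport ψ → tsupport ψ ⊆ Ω →
    ∫ x, f x * deriv ψ x = - ∫ x, f' x * ψ x

/-- The measure `ρ dx` on `ℝ`. -/
def rhoMeasure (ρ : ℝ → ℝ) : Measure ℝ := volume.withDensity (fun x => ENNReal.ofReal (ρ x))

/-- The weighted space `L²_ρ(ℝ)`. -/
abbrev L2rho (ρ : ℝ → ℝ) : Type := Lp ℝ 2 (rhoMeasure ρ)

theorem IsWeakDerivOn.zero : IsWeakDerivOn univ (fun _ => 0) (fun _ => 0) :=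
  ⟨(locallyIntegrable_const 0).locallyIntegrableOn _,
    (locallyIntegrable_const 0).locallyIntegrableOn _, by simp⟩

theorem IsWeakDerivOn.smul {f f' : ℝ → ℝ} (c : ℝ) (h : IsWeakDerivOn univ f f') :
    IsWeakDerivOn univ (fun x => c * f x) (fun x => c * f' x) := by
  refine ⟨h.loc.smul c, h.loc_deriv.smul c, fun ψ h1 h2 h3 => ?_⟩
  simp only [mul_assoc, integral_const_mul]
  rw [h.by_parts ψ h1 h2 h3, mul_neg]

theorem IsWeakDerivOn.add {f f' g g' : ℝ → ℝ} (hf : IsWeakDerivOn univ f f')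
    (hg : IsWeakDerivOn univ g g') :
    IsWeakDerivOn univ (fun x => f x + g x) (fun x => f' x + g' x) := by
  have lf := locallyIntegrableOn_univ.1 hf.loc
  have lf' := locallyIntegrableOn_univ.1 hf.loc_deriv
  have lg := locallyIntegrableOn_univ.1 hg.loc
  have lg' := locallyIntegrableOn_univ.1 hg.loc_deriv
  refine ⟨locallyIntegrableOn_univ.2 (lf.add lg), locallyIntegrableOn_univ.2 (lf'.add lg'),
    fun ψ h1 h2 h3 => ?_⟩
  have hd : Continuous (deriv ψ) := h1.continuous_deriv (by simp)
  have i1 : ∀ {u : ℝ → ℝ}, LocallyIntegrable u → Integrable (fun x => u x * deriv ψ x) :=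
    fun hu => hu.integrable_smul_right_of_hasCompactSupport hd h2.deriv
  have i2 : ∀ {u : ℝ → ℝ}, LocallyIntegrable u → Integrable (fun x => u x * ψ x) :=
    fun hu => hu.integrable_smul_right_of_hasCompactSupport h1.continuous h2
  simp only [add_mul]
  rw [integral_add (i1 lf) (i1 lg), integral_add (i2 lf') (i2 lg'),
    hf.by_parts ψ h1 h2 h3, hg.by_parts ψ h1 h2 h3]
  ring

/-- The modified Sobolev space `ℍ¹`: all `φ ∈ L²_ρ(ℝ)` such that
`𝔻φ = √(k/ρ) φ' + Q₁(ρ,k) φ` belongs to `L²_ρ(ℝ)`, where `φ'` is the distributional derivative.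
It is realised as the graph `{(φ, 𝔻φ)}` in the Hilbert sum `L²_ρ ⊕ L²_ρ`, so that the norm it
inherits is `(‖φ‖² + ‖𝔻φ‖²)^{1/2}` with the norms of `L²_ρ(ℝ)`. -/
def H1 (ρ k : ℝ → ℝ) : Submodule ℝ (WithLp 2 (L2rho ρ × L2rho ρ)) where
  carrier := {p | ∃ f f' : ℝ → ℝ, p.fst =ᵐ[rhoMeasure ρ] f ∧ IsWeakDerivOn univ f f' ∧
    p.snd =ᵐ[rhoMeasure ρ] fun x => Real.sqrt (k x / ρ x) * f' x + Q1 ρ k x * f x}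
  zero_mem' := by
    refine ⟨fun _ => 0, fun _ => 0, Lp.coeFn_zero _ _ _, .zero, ?_⟩
    filter_upwards [Lp.coeFn_zero ℝ 2 (rhoMeasure ρ)] with x hx
    simpa using hx
  add_mem' := by
    rintro p r ⟨f, f', hf, hff, hf'⟩ ⟨g, g', hg, hgg, hg'⟩
    refine ⟨_, _, ?_, hff.add hgg, ?_⟩
    · filter_upwards [Lp.coeFn_add p.fst r.fst, hf, hg] with x h1 h2 h3
      rw [WithLp.add_fst, h1, Pi.add_apply, h2, h3]
    · filter_upwards [Lp.coeFn_add p.snd r.snd, hf', hg'] with x h1 h2 h3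
      rw [WithLp.add_snd, h1, Pi.add_apply, h2, h3]
      ring
  smul_mem' := by
    rintro c p ⟨f, f', hf, hff, hf'⟩
    refine ⟨_, _, ?_, hff.smul c, ?_⟩
    · filter_upwards [Lp.coeFn_smul c p.fst, hf] with x h1 h2
      rw [WithLp.smul_fst, h1, Pi.smul_apply, h2, smul_eq_mul]
    · filter_upwards [Lp.coeFn_smul c p.snd, hf'] with x h1 h2
      rw [WithLp.smul_snd, h1, Pi.smul_apply, h2, smul_eq_mul]
      ring

variable {ρ k : ℝ → ℝ}

/-- The function underlying an element of `ℍ¹`. -/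
def fn (φ : H1 ρ k) : L2rho ρ := φ.1.fst

/-- The derivative `𝔻φ ∈ L²_ρ(ℝ)` of an element `φ` of `ℍ¹`. -/
def opD (φ : H1 ρ k) : L2rho ρ := φ.1.snd

/-- `φ` is an even element of `ℍ¹`. -/
def IsEven (φ : H1 ρ k) : Prop := ∀ᵐ x : ℝ, fn φ (-x) = fn φ x

/-- The space `ℍ⁻¹`, the dual of `ℍ¹`, with the dual norm. -/
abbrev Hneg1 (ρ k : ℝ → ℝ) : Type := StrongDual ℝ (H1 ρ k)

/-- The embedding `ℍ¹ ⊂ L²_ρ(ℝ) ⊂ ℍ⁻¹`, `⟨⟨f, φ⟩⟩ = ∫ f φ ρ dx`. -/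
def toHneg1 (f : H1 ρ k) : Hneg1 ρ k :=
  (innerSL ℝ (fn f)).comp
    ((WithLp.fstL 2 ℝ (L2rho ρ) (L2rho ρ)).comp (H1 ρ k).subtypeL)

theorem toHneg1_apply (f φ : H1 ρ k) :
    toHneg1 f φ = ∫ x, fn f x * fn φ x ∂(rhoMeasure ρ) := by
  change inner ℝ (fn f) (fn φ) = _
  rw [L2.inner_def]
  exact integral_congr_ae (ae_of_all _ fun x => by simp [mul_comm])

/-- The function `f`, defined up to null sets, has the one-sided limit `f(0⁺) = c`
(an essential limit: for every `ε > 0` there is `η > 0` with `|f x - c| < ε` for a.e.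
`x ∈ (0, η)`). -/
def HasValueAtZeroPlus (f : ℝ → ℝ) (c : ℝ) : Prop :=
  Tendsto f (𝓝[>] 0 ⊓ ae volume) (𝓝 c)

/-- The value at `0` of a function that is defined up to null sets and has a continuous
representative, as every element of `ℍ¹` does. -/
def valueAtZero (f : ℝ → ℝ) : ℝ := limUnder (𝓝 0 ⊓ ae volume) f

theorem zero_inf_ae_neBot : (𝓝 (0 : ℝ) ⊓ ae (volume : Measure ℝ)).NeBot := by
  rw [inf_neBot_iff]
  intro s hs t ht
  obtain ⟨ε, hε, h⟩ := Metric.mem_nhds_iff.1 hs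
  by_contra hne
  have hsub : Metric.ball (0 : ℝ) ε ⊆ tᶜ := fun x hx hxt => hne ⟨x, h hx, hxt⟩
  have h0 : volume (Metric.ball (0 : ℝ) ε) = 0 := measure_mono_null hsub ht
  exact (Metric.measure_ball_pos volume (0 : ℝ) hε).ne' h0

theorem valueAtZero_eq {f g : ℝ → ℝ} (h : f =ᵐ[volume] g) (hg : ContinuousAt g 0) :
    valueAtZero f = g 0 := by
  have := zero_inf_ae_neBot
  refine Tendsto.limUnder_eq ?_
  have h1 : Tendsto g (𝓝 0 ⊓ ae volume) (𝓝 (g 0)) := hg.tendsto.mono_left inf_le_left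
  exact h1.congr' (inf_le_right (a := 𝓝 (0 : ℝ)) h.symm)

/-- `F ∈ ℍ⁻¹` equals `𝔻²f - q f - 2 √((ρk)(0)) c δ`. Here `⟨⟨𝔻²f, φ⟩⟩ = -⟨⟨𝔻f, 𝔻φ⟩⟩`,
`⟨⟨qf, φ⟩⟩ = ∫ q f φ ρ dx` and `⟨⟨δ, φ⟩⟩ = φ(0)` for all `φ ∈ ℍ¹`. -/
def EqRHS (γ : ℝ → ℝ) (c : ℝ) (f : H1 ρ k) (F : Hneg1 ρ k) : Prop :=
  ∀ φ : H1 ρ k, F φ =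
    - (∫ x, opD f x * opD φ x ∂(rhoMeasure ρ))
    - (∫ x, pot ρ k γ x * fn f x * fn φ x ∂(rhoMeasure ρ))
    - 2 * Real.sqrt (ρ 0 * k 0) * c * valueAtZero (fn φ)

/-- `W : [0,T] → ℍ¹` (even for every `t`) is a solution of
`W_t = 𝔻²W - qW - 2 √((ρk)(0)) u δ` on `ℝ × (0,T)`, `W(·,0) = W⁰`: as a map into `ℍ⁻¹` it is
absolutely continuous on `[0,T]`, and for almost every `t` its derivative in `ℍ⁻¹` exists and
satisfies the equation. Values of `W` outside `[0,T]` play no role. -/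
structure IsSolution (γ : ℝ → ℝ) (T : ℝ) (u : ℝ → ℝ) (W0 : H1 ρ k) (W : ℝ → H1 ρ k) :
    Prop where
  even : ∀ t ∈ Icc 0 T, IsEven (W t)
  abs_cont : AbsolutelyContinuousOnInterval (fun t => toHneg1 (W t)) 0 T
  equation : ∀ᵐ t ∂(volume.restrict (Ioo 0 T)), ∃ F : Hneg1 ρ k,
    HasDerivAt (fun s => toHneg1 (W s)) F t ∧ EqRHS γ (u t) (W t) F
  initial : W 0 = W0

end HalfAxisHeat

end

/-! The Liouville transformation `y = σ(x)`, `g(y) = (ρk)^{1/4}(x) φ(x)` carries `L²_ρ` onto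
`L²(ℝ)`, `ℍ¹` onto the usual `H¹(ℝ)` and `𝔻` onto `d/dy`. With `m = (ρk)^{1/4}(0)` the equation
becomes `g_t = g'' - q g - 2 m u δ`, and the claim becomes `g'(0⁺, t0) = m u(t0)` for a.e. `t0`.
Formally this is the jump `2 m u` of `g'` at `0`, halved by evenness. The difficulty is that `W_t`
lies only in `ℍ⁻¹`, so the equation at a single time does not give `g'` a limit at `0`.

The slope is therefore recovered from the past. Fix `t0`, put `c = m u(t0)` and `E(y) = e^{-|y|}`,
and pair `g + cE` with the backward heat kernel `G (t0 - t + ε) (· - z)`. Since `E'' = E - 2δ`, the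
time derivative of the pairing contains only a term with `q g`, a term with `c E`, and `-2 m (u(t) -
u(t0)) G (t0 - t + ε) z`; the second derivatives of `g` cancel. Subtract the pairings at `z = a` and
`z = b`, where `a ≤ b ≤ 2a`, integrate over `[t1, t0]` and let `ε → 0`. The increment of `g + cE`
over `[a, b]` at time `t0` is then at most `b - a` times a quantity that can be made small:

(1) the `L²` terms cost `(t0 - t)^{-3/4}` (`integral_G_sub_sq_le`), whose integral against an `L¹`
majorant of `‖W(t)‖` is finite for a.e. `t0` and tends to `0` as `t1 → t0`; (2) the `δ` term is
bounded through a kernel `Psi` of mass at most `2`, and is small when `t0` is a left Lebesgue point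
of `u` (`integral_mul_Psi_le`); (3) the contribution of time `t1` is `O(b)`, because the heat flow
makes an even function smooth, with zero slope at `0` (`exists_even_bound`).

Hence `g' - c e^{-y} → 0` essentially as `y → 0⁺`, which is the claim for `𝔻W`. The Neumann
condition follows because `Q₁(0) = 0`. -/

namespace HalfAxisHeat

/-! ### Even functions and the coefficients on the whole line -/

theorem continuous_of_even {f : ℝ → ℝ} (he : ∀ x, f (-x) = f x) (hc : ContinuousOn f (Ici 0)) :
    Continuous f := by
  have h1 : Continuous fun x : ℝ => f |x| :=
    hc.comp_continuous continuous_abs fun x => abs_nonneg x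
  convert h1 using 2 with x
  rcases abs_choice x with h | h <;> rw [h]
  exact (he x).symm

/-- The derivative of an even function is odd, so the one-sided derivatives at `0` are opposite;
they agree exactly when they vanish. -/
theorem contDiff_one_of_even {f : ℝ → ℝ} (he : ∀ x, f (-x) = f x)
    (hc : ContDiffOn ℝ 1 f (Ici 0)) (h0 : derivWithin f (Ici 0) 0 = 0) : ContDiff ℝ 1 f := by
  set d := derivWithin f (Ici 0) with hd
  have hdc : ContinuousOn d (Ici 0) :=
    hc.continuousOn_derivWithin (uniqueDiffOn_Ici 0) le_rfl
  have hdiff : ∀ x ∈ Ici (0 : ℝ), HasDerivWithinAt f (d x) (Ici 0) x := fun x hx =>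
    ((hc.differentiableOn one_ne_zero) x hx).hasDerivWithinAt
  have hneg : ∀ x ∈ Iic (0 : ℝ), HasDerivWithinAt f (-d (-x)) (Iic 0) x := by
    intro x hx
    have h1 := (hdiff (-x) (by simpa using hx)).scomp x
      (hasDerivAt_neg x).hasDerivWithinAt (s := Iic 0)
      (fun y (hy : y ≤ 0) => show (0 : ℝ) ≤ -y by linarith)
    simp only [neg_smul, one_smul] at h1
    exact h1.congr (fun y _ => (he y).symm) (he x).symm
  have hder : ∀ x, HasDerivAt f (if 0 ≤ x then d x else -d (-x)) x := by
    intro x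
    rcases lt_trichotomy x 0 with hx | hx | hx
    · rw [if_neg (not_le.2 hx)]
      exact (hneg x hx.le).hasDerivAt (Iic_mem_nhds hx)
    · subst hx
      rw [if_pos le_rfl, h0]
      have h2 := hneg 0 (by simp)
      have h1 := hdiff 0 (by simp)
      rw [neg_zero, h0, neg_zero] at h2
      rw [h0] at h1
      have := h2.union h1
      rwa [Iic_union_Ici, hasDerivWithinAt_univ] at this
    · rw [if_pos hx.le]
      exact (hdiff x hx.le).hasDerivAt (Ici_mem_nhds hx)
  have hd' : deriv f = fun x => if 0 ≤ x then d x else -d (-x) := funext fun x => (hder x).deriv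
  refine contDiff_one_iff_deriv.2 ⟨fun x => (hder x).differentiableAt, ?_⟩
  rw [hd']
  refine continuous_if ?_ ?_ ?_
  · intro a ha
    have : a = 0 := by
      have := frontier_le_subset_eq continuous_const continuous_id ha
      simpa using this.symm
    subst this
    simp [h0]
  · refine hdc.mono fun x hx => ?_
    exact closure_minimal (fun a ha => ha) isClosed_Ici hx
  · refine (hdc.comp continuousOn_neg fun x hx => ?_).neg
    have h3 := hx
    have : closure {a : ℝ | ¬ (0 ≤ a)} ⊆ Iic 0 :=
      closure_minimal (fun a ha => (not_le.1 ha).le) isClosed_Iic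
    simpa using this h3

namespace Admissible

variable {ρ k γ : ℝ → ℝ} (h : Admissible ρ k γ)
include h

theorem rho_pos' (x : ℝ) : 0 < ρ x := by
  rcases le_total 0 x with hx | hx
  · exact h.rho_pos x hx
  · rw [← h.rho_even]; exact h.rho_pos _ (by simpa using hx)

theorem k_pos' (x : ℝ) : 0 < k x := by
  rcases le_total 0 x with hx | hx
  · exact h.k_pos x hx
  · rw [← h.k_even]; exact h.k_pos _ (by simpa using hx)

theorem continuous_rho : Continuous ρ := continuous_of_even h.rho_even h.rho_C1.continuousOn

theorem continuous_k : Continuous k := continuous_of_even h.k_even h.k_C1.continuousOn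

theorem rho_abs (x : ℝ) : ρ |x| = ρ x := by
  rcases abs_choice x with h1 | h1 <;> rw [h1]
  exact h.rho_even x

theorem k_abs (x : ℝ) : k |x| = k x := by
  rcases abs_choice x with h1 | h1 <;> rw [h1]
  exact h.k_even x

/-- The hypothesis `(ρk)'(0) = 0` enters here. The even extensions of `ρ` and `k` may each have a
corner at `0`, but their product has none, which makes `Q1` continuous. -/
theorem contDiff_mul : ContDiff ℝ 1 fun x => k x * ρ x := by
  have h1 : (fun x => k x * ρ x) = fun x => ρ x * k x := funext fun x => mul_comm _ _
  rw [h1]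
  exact contDiff_one_of_even (fun x => by simp only [h.rho_even, h.k_even])
    (h.rhok_C2.of_le one_le_two) h.rhok_deriv_zero

end Admissible

/-- The derivative `√(ρ/k)` of `σ`. -/
noncomputable def sigD (ρ k : ℝ → ℝ) (x : ℝ) : ℝ := Real.sqrt (ρ x / k x)

/-- The Liouville multiplier `(ρk)^{1/4}`. -/
noncomputable def mul4 (ρ k : ℝ → ℝ) (x : ℝ) : ℝ := Real.sqrt (Real.sqrt (k x * ρ x))

variable {ρ k : ℝ → ℝ}

theorem sqrt_k_div_rho (x : ℝ) : Real.sqrt (k x / ρ x) = (sigD ρ k x)⁻¹ := by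
  rw [sigD, ← Real.sqrt_inv, inv_div]

theorem sig_zero : sig ρ k 0 = 0 := by simp [sig]

theorem mul4_sq (x : ℝ) : mul4 ρ k x ^ 2 = Real.sqrt (k x * ρ x) :=
  Real.sq_sqrt (Real.sqrt_nonneg _)

namespace Admissible

variable {γ : ℝ → ℝ} (h : Admissible ρ k γ)
include h

theorem sigD_pos (x : ℝ) : 0 < sigD ρ k x :=
  Real.sqrt_pos.2 (div_pos (h.rho_pos' x) (h.k_pos' x))

theorem continuous_sigD : Continuous (sigD ρ k) :=
  (h.continuous_rho.div h.continuous_k fun x => (h.k_pos' x).ne').sqrt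

theorem sig_eq (x : ℝ) : sig ρ k x = ∫ ξ in (0 : ℝ)..x, sigD ρ k ξ := by
  simp only [sig, sigD, h.rho_abs, h.k_abs]

theorem hasDerivAt_sig (x : ℝ) : HasDerivAt (sig ρ k) (sigD ρ k x) x := by
  have h1 : sig ρ k = fun x => ∫ ξ in (0 : ℝ)..x, sigD ρ k ξ := funext h.sig_eq
  rw [h1]
  exact h.continuous_sigD.integral_hasStrictDerivAt 0 x |>.hasDerivAt

theorem continuous_sig : Continuous (sig ρ k) :=
  continuous_iff_continuousAt.2 fun x => (h.hasDerivAt_sig x).continuousAt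

theorem strictMono_sig : StrictMono (sig ρ k) :=
  strictMono_of_deriv_pos fun x => by rw [(h.hasDerivAt_sig x).deriv]; exact h.sigD_pos x

theorem sig_neg (x : ℝ) : sig ρ k (-x) = - sig ρ k x := by
  have h1 : ∀ y, sigD ρ k (-y) = sigD ρ k y := fun y => by
    simp only [sigD, h.rho_even, h.k_even]
  rw [h.sig_eq, h.sig_eq, intervalIntegral.integral_symm]
  have := intervalIntegral.integral_comp_neg (a := 0) (b := x) (sigD ρ k)
  simp only [h1, neg_zero] at this
  rw [this]

theorem surjective_sig : Function.Surjective (sig ρ k) := by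
  refine h.continuous_sig.surjective h.sig_tendsto ?_
  have h1 : sig ρ k = fun x => - sig ρ k (-x) := funext fun x => by rw [h.sig_neg, neg_neg]
  rw [h1]
  exact tendsto_neg_atTop_atBot.comp (h.sig_tendsto.comp tendsto_neg_atBot_atTop)

/-- `σ` as an order isomorphism of the line. -/
noncomputable def sigIso : ℝ ≃o ℝ := h.strictMono_sig.orderIsoOfSurjective _ h.surjective_sig

/-- The inverse of `σ`. -/
noncomputable def tau (y : ℝ) : ℝ := h.sigIso.symm y

theorem sig_tau (y : ℝ) : sig ρ k (h.tau y) = y := h.sigIso.apply_symm_apply y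

theorem tau_sig (x : ℝ) : h.tau (sig ρ k x) = x := h.sigIso.symm_apply_apply x

theorem continuous_tau : Continuous h.tau := h.sigIso.symm.continuous

theorem hasDerivAt_tau (y : ℝ) : HasDerivAt h.tau (sigD ρ k (h.tau y))⁻¹ y :=
  HasDerivAt.of_local_left_inverse h.continuous_tau.continuousAt (h.hasDerivAt_sig _)
    (h.sigD_pos _).ne' (Eventually.of_forall h.sig_tau)

theorem mul4_pos (x : ℝ) : 0 < mul4 ρ k x :=
  Real.sqrt_pos.2 (Real.sqrt_pos.2 (mul_pos (h.k_pos' x) (h.rho_pos' x)))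

theorem mul4_neg (x : ℝ) : mul4 ρ k (-x) = mul4 ρ k x := by
  simp only [mul4, h.rho_even, h.k_even]

theorem continuous_mul4 : Continuous (mul4 ρ k) := h.contDiff_mul.continuous.sqrt.sqrt

/-- `ρ = m² σ'`. -/
theorem rho_eq (x : ℝ) : ρ x = mul4 ρ k x ^ 2 * sigD ρ k x := by
  rw [mul4_sq, sigD, ← Real.sqrt_mul (mul_pos (h.k_pos' x) (h.rho_pos' x)).le]
  have : k x * ρ x * (ρ x / k x) = ρ x ^ 2 := by
    have := (h.k_pos' x).ne'
    field_simp
  rw [this, Real.sqrt_sq (h.rho_pos' x).le]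

/-- `Q₁ = (log m)' / σ'`. -/
theorem hasDerivAt_mul4 (x : ℝ) :
    HasDerivAt (mul4 ρ k) (mul4 ρ k x * sigD ρ k x * Q1 ρ k x) x := by
  have hP := mul_pos (h.k_pos' x) (h.rho_pos' x)
  have h1 : HasDerivAt (fun x => k x * ρ x) (deriv (fun x => k x * ρ x) x) x :=
    (h.contDiff_mul.differentiable one_ne_zero x).hasDerivAt
  have h2 := (h1.sqrt hP.ne').sqrt (Real.sqrt_pos.2 hP).ne'
  refine h2.congr_deriv ?_
  rw [Q1, sqrt_k_div_rho]
  have h3 := (h.sigD_pos x).ne'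
  have h4 : Real.sqrt (k x * ρ x) = mul4 ρ k x ^ 2 := (mul4_sq x).symm
  have h5 : Real.sqrt (Real.sqrt (k x * ρ x)) = mul4 ρ k x := rfl
  have h6 : k x * ρ x = mul4 ρ k x ^ 4 := by
    rw [← Real.sq_sqrt hP.le, h4]; ring
  have h7 := (h.mul4_pos x).ne'
  rw [h5, h4]
  rw [h6]
  field_simp
  ring

theorem continuous_Q1 : Continuous (Q1 ρ k) := by
  unfold Q1
  refine Continuous.div ?_ ?_ fun x => by
    have := h.k_pos' x
    have := h.rho_pos' x
    positivity
  · exact (h.continuous_k.div h.continuous_rho fun x => (h.rho_pos' x).ne').sqrt.mul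
      (h.contDiff_mul.continuous_deriv le_rfl)
  · exact continuous_const.mul (h.continuous_k.mul h.continuous_rho)

theorem Q1_neg (x : ℝ) : Q1 ρ k (-x) = - Q1 ρ k x := by
  have h1 : deriv (fun y => k y * ρ y) (-x) = - deriv (fun y => k y * ρ y) x := by
    have := deriv_comp_neg (fun y => k y * ρ y) x
    simp only [h.rho_even, h.k_even] at this
    rw [this, neg_neg]
  rw [Q1, Q1, h1, h.rho_even, h.k_even]
  ring

theorem Q1_zero : Q1 ρ k 0 = 0 := by
  have := h.Q1_neg 0
  rw [neg_zero] at this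
  linarith

theorem pot_neg (x : ℝ) : pot ρ k γ (-x) = pot ρ k γ x := by
  -- `Q1` is odd. The rule for `deriv` under reflection needs no differentiability, so this holds at
  -- every point.
  have h1 : deriv (Q1 ρ k) (-x) = deriv (Q1 ρ k) x := by
    have h2 := deriv_comp_neg (Q1 ρ k) x
    have h3 : (fun y => Q1 ρ k (-y)) = fun y => - Q1 ρ k y := funext h.Q1_neg
    rw [h3, deriv.fun_neg] at h2
    linarith
  simp only [pot, Q2, h1, h.gamma_even, h.rho_even, h.k_even, h.Q1_neg, neg_sq]

theorem exists_pot_bound : ∃ M : ℝ, 0 ≤ M ∧ ∀ᵐ x : ℝ, |pot ρ k γ x| ≤ M := by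
  refine ⟨(eLpNorm (pot ρ k γ) ∞ (volume.restrict (Ioi 0))).toReal, ENNReal.toReal_nonneg, ?_⟩
  set M := (eLpNorm (pot ρ k γ) ∞ (volume.restrict (Ioi 0))).toReal
  have h1 : ∀ᵐ x : ℝ, x ∈ Ioi (0 : ℝ) → |pot ρ k γ x| ≤ M := by
    rw [← ae_restrict_iff' measurableSet_Ioi]
    have h2 := h.pot_bdd.2
    filter_upwards [ae_le_eLpNormEssSup (f := pot ρ k γ) (μ := volume.restrict (Ioi 0))] with x hx
    rw [eLpNorm_exponent_top] at h2
    have := ENNReal.toReal_mono h2.ne hx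
    simpa [M, eLpNorm_exponent_top] using this
  have h2 : ∀ᵐ x : ℝ, -x ∈ Ioi (0 : ℝ) → |pot ρ k γ (-x)| ≤ M :=
    (Measure.measurePreserving_neg (volume : Measure ℝ)).quasiMeasurePreserving.ae h1
  have h3 : ∀ᵐ x : ℝ, x ≠ 0 := by simp [ae_iff, measure_singleton]
  filter_upwards [h1, h2, h3] with x hx1 hx2 hx3
  rcases lt_or_gt_of_ne hx3 with h4 | h4
  · rw [← h.pot_neg]; exact hx2 (by simpa using h4)
  · exact hx1 h4

end Admissible

/-! ### Locally absolutely continuous functions -/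

/-- `g` is locally absolutely continuous with a.e. derivative `g'`. -/
structure IsPrim (g g' : ℝ → ℝ) : Prop where
  int : ∀ a b, IntervalIntegrable g' volume a b
  sub : ∀ a b, g b - g a = ∫ x in a..b, g' x

theorem locallyIntegrable_of_intervalIntegrable {f : ℝ → ℝ}
    (h : ∀ a b, IntervalIntegrable f volume a b) : LocallyIntegrable f := by
  intro x
  refine ⟨Icc (x - 1) (x + 1), Icc_mem_nhds (by linarith) (by linarith), ?_⟩
  rw [integrableOn_Icc_iff_integrableOn_Ioc,
    ← intervalIntegrable_iff_integrableOn_Ioc_of_le (by linarith)]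
  exact h _ _

theorem _root_.MeasureTheory.LocallyIntegrable.intervalIntegrable' {f : ℝ → ℝ}
    (h : LocallyIntegrable f) (a b : ℝ) : IntervalIntegrable f volume a b :=
  intervalIntegrable_iff.2 ((h.integrableOn_isCompact isCompact_uIcc).mono_set uIoc_subset_uIcc)

theorem isPrim_of_hasDerivAt {g g' : ℝ → ℝ} (hd : ∀ x, HasDerivAt g (g' x) x)
    (hc : Continuous g') : IsPrim g g' :=
  ⟨fun a b => hc.intervalIntegrable a b, fun a b =>
    (intervalIntegral.integral_eq_sub_of_hasDerivAt (fun x _ => hd x)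
      (hc.intervalIntegrable a b)).symm⟩

theorem isPrim_integral {f : ℝ → ℝ} (h : LocallyIntegrable f) (c : ℝ) :
    IsPrim (fun x => c + ∫ t in (0 : ℝ)..x, f t) f := by
  refine ⟨h.intervalIntegrable', fun a b => ?_⟩
  rw [add_sub_add_left_eq_sub]
  exact intervalIntegral.integral_interval_sub_left (h.intervalIntegrable' _ _)
    (h.intervalIntegrable' _ _)

namespace IsPrim

variable {g g' : ℝ → ℝ} (h : IsPrim g g')
include h

theorem eq_integral (x : ℝ) : g x = g 0 + ∫ t in (0 : ℝ)..x, g' t := by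
  rw [← h.sub]; ring

theorem locallyIntegrable : LocallyIntegrable g' := locallyIntegrable_of_intervalIntegrable h.int

theorem continuous : Continuous g := by
  rw [funext h.eq_integral]
  exact continuous_const.add (intervalIntegral.continuous_primitive h.int 0)

theorem ae_hasDerivAt : ∀ᵐ x, HasDerivAt g (g' x) x := by
  filter_upwards [_root_.LocallyIntegrable.ae_hasDerivAt_integral h.locallyIntegrable] with x hx
  have h1 := (hx 0).const_add (g 0)
  rwa [← funext h.eq_integral] at h1

theorem absolutelyContinuous (a b : ℝ) : AbsolutelyContinuousOnInterval g a b := by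
  have h1 := (h.int a b).absolutelyContinuousOnInterval_intervalIntegral (c := a) (by simp)
  have h2 : AbsolutelyContinuousOnInterval (fun _ : ℝ => g a) a b :=
    (LipschitzWith.const (g a)).lipschitzOnWith.absolutelyContinuousOnInterval
  have h3 := h2.fun_add h1
  have h4 : g = fun x => g a + ∫ t in a..x, g' t := funext fun x => by rw [← h.sub]; ring
  rwa [← h4] at h3

/-- Integration by parts for absolutely continuous functions, with the a.e. derivatives replaced by
the given representatives. -/
theorem mul {m m' : ℝ → ℝ} (hm : IsPrim m m') :
    IsPrim (fun x => g x * m x) (fun x => g' x * m x + g x * m' x) := by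
  refine ⟨fun a b => ((h.int a b).mul_continuousOn hm.continuous.continuousOn).add
    ((hm.int a b).continuousOn_mul h.continuous.continuousOn), fun a b => ?_⟩
  rw [← (h.absolutelyContinuous a b).integral_deriv_mul_eq_sub (hm.absolutelyContinuous a b)]
  refine intervalIntegral.integral_congr_ae ?_
  filter_upwards [h.ae_hasDerivAt, hm.ae_hasDerivAt] with x h1 h2 _
  rw [h1.deriv, h2.deriv]

theorem integral_mul_eq {ψ ψ' : ℝ → ℝ} (hψ : IsPrim ψ ψ') (a b : ℝ) :
    ∫ x in a..b, g x * ψ' x = g b * ψ b - g a * ψ a - ∫ x in a..b, g' x * ψ x := by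
  rw [(h.mul hψ).sub a b, intervalIntegral.integral_add, add_sub_cancel_left]
  · exact (h.int a b).mul_continuousOn hψ.continuous.continuousOn
  · exact (hψ.int a b).continuousOn_mul h.continuous.continuousOn

/-- The change of variables for monotone differentiable maps holds for merely integrable `g'`; this
is what lets the lift of an `ℍ¹` function be absolutely continuous. -/
theorem comp {τ τ' : ℝ → ℝ} (hτ : ∀ x, HasDerivAt τ (τ' x) x) (hpos : ∀ x, 0 ≤ τ' x) :
    IsPrim (fun y => g (τ y)) (fun y => τ' y * g' (τ y)) := by
  have hc : Continuous τ := continuous_iff_continuousAt.2 fun x => (hτ x).continuousAt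
  have hmono : Monotone τ := monotone_of_deriv_nonneg (fun x => (hτ x).differentiableAt)
    fun x => by rw [(hτ x).deriv]; exact hpos x
  have h1 : ∀ a b, a ≤ b → IntervalIntegrable (fun y => τ' y * g' (τ y)) volume a b := by
    intro a b hab
    rw [intervalIntegrable_iff_integrableOn_Icc_of_le hab]
    have := integrableOn_Icc_deriv_smul_iff_of_deriv_nonneg (g := g') hc.continuousOn
      (fun x _ => hτ x) (fun x _ => hpos x) hab
    simp only [smul_eq_mul] at this
    rw [this, ← intervalIntegrable_iff_integrableOn_Icc_of_le (hmono hab)]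
    exact h.int _ _
  have h2 : ∀ a b, a ≤ b → g (τ b) - g (τ a) = ∫ y in a..b, τ' y * g' (τ y) := by
    intro a b hab
    rw [h.sub, intervalIntegral.integral_of_le hab, intervalIntegral.integral_of_le (hmono hab),
      ← integral_Icc_eq_integral_Ioc, ← integral_Icc_eq_integral_Ioc]
    exact (integral_Icc_deriv_smul_of_deriv_nonneg (g := g') hc.continuousOn
      (fun x _ => hτ x) (fun x _ => hpos x) hab).symm
  refine ⟨fun a b => ?_, fun a b => ?_⟩
  · rcases le_total a b with hab | hab
    · exact h1 a b hab
    · exact (h1 b a hab).symm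
  · rcases le_total a b with hab | hab
    · exact h2 a b hab
    · rw [intervalIntegral.integral_symm, ← h2 b a hab]; ring

end IsPrim

theorem isPrim_of_contDiff {ψ : ℝ → ℝ} (h : ContDiff ℝ 1 ψ) : IsPrim ψ (deriv ψ) :=
  isPrim_of_hasDerivAt (fun x => (h.differentiable one_ne_zero x).hasDerivAt)
    (h.continuous_deriv le_rfl)

theorem exists_support_subset_Ioo {ψ : ℝ → ℝ} (h : HasCompactSupport ψ) :
    ∃ R : ℝ, 0 < R ∧ ∀ x, x ∉ Ioo (-R) R → ψ x = 0 := by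
  obtain ⟨R, hR, h1⟩ := h.isCompact.isBounded.subset_ball_lt 0 0
  refine ⟨R, hR, fun x hx => image_eq_zero_of_notMem_tsupport fun h2 => hx ?_⟩
  have := h1 h2
  rw [Real.ball_eq_Ioo] at this
  simpa using this

theorem integral_eq_intervalIntegral_of_support {f : ℝ → ℝ} {R : ℝ} (hR : 0 < R)
    (hf : ∀ x, x ∉ Ioo (-R) R → f x = 0) : ∫ x, f x = ∫ x in (-R)..R, f x := by
  rw [intervalIntegral.integral_of_le (by linarith)]
  refine (setIntegral_eq_integral_of_forall_compl_eq_zero fun x hx => hf x fun h => hx ?_).symm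
  exact Ioo_subset_Ioc_self h

theorem deriv_eq_zero_of_notMem_Ioo {ψ : ℝ → ℝ} {R : ℝ}
    (hψ : ∀ x, x ∉ Ioo (-R) R → ψ x = 0) (x : ℝ) (hx : x ∉ Ioo (-R - 1) (R + 1)) :
    deriv ψ x = 0 := by
  have h1 : ψ =ᶠ[𝓝 x] fun _ => 0 := by
    have : (Icc (-R) R)ᶜ ∈ 𝓝 x := by
      refine isClosed_Icc.isOpen_compl.mem_nhds fun h => hx ⟨?_, ?_⟩
      · linarith [h.1]
      · linarith [h.2]
    filter_upwards [this] with y hy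
    exact hψ y fun h => hy (Ioo_subset_Icc_self h)
  rw [h1.deriv_eq]; simp

/-- A locally absolutely continuous function is weakly differentiable. -/
theorem IsPrim.isWeakDerivOn {g g' : ℝ → ℝ} (h : IsPrim g g') : IsWeakDerivOn univ g g' := by
  refine ⟨locallyIntegrableOn_univ.2 h.continuous.locallyIntegrable,
    locallyIntegrableOn_univ.2 h.locallyIntegrable, fun ψ h1 h2 _ => ?_⟩
  obtain ⟨R, hR, h3⟩ := exists_support_subset_Ioo h2
  have hc : ContDiff ℝ 1 ψ := h1.of_le (by simp)
  have h3' : ∀ x, x ∉ Ioo (-(R + 1)) (R + 1) → ψ x = 0 := fun x hx => h3 x fun hx' => hx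
    ⟨by linarith [hx'.1], by linarith [hx'.2]⟩
  rw [integral_eq_intervalIntegral_of_support (f := fun x => g x * deriv ψ x)
      (R := R + 1) (by linarith), integral_eq_intervalIntegral_of_support
      (f := fun x => g' x * ψ x) (R := R + 1) (by linarith),
    h.integral_mul_eq (isPrim_of_contDiff hc), h3' (R + 1) (by simp), h3' (-(R + 1)) (by simp)]
  · ring
  · intro x hx; rw [h3' x hx, mul_zero]
  · intro x hx
    rw [deriv_eq_zero_of_notMem_Ioo h3 x (by rwa [neg_add'] at hx), mul_zero]

/-- The du Bois-Reymond lemma: a function with vanishing weak derivative is constant. -/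
theorem ae_eq_const_of_weakDeriv_zero {w : ℝ → ℝ} (hw : LocallyIntegrable w)
    (h : ∀ ψ : ℝ → ℝ, ContDiff ℝ ∞ ψ → HasCompactSupport ψ → ∫ x, w x * deriv ψ x = 0) :
    ∃ c, ∀ᵐ x, w x = c := by
  let b : ContDiffBump (0 : ℝ) := ⟨1, 2, one_pos, one_lt_two⟩
  set χ : ℝ → ℝ := b.normed volume with hχ
  have hχs : ContDiff ℝ ∞ χ := b.contDiff_normed
  have hχc : HasCompactSupport χ := b.hasCompactSupport_normed
  have hχi : ∫ x, χ x = 1 := b.integral_normed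
  have hint : ∀ {u η : ℝ → ℝ}, LocallyIntegrable u → ContDiff ℝ ∞ η → HasCompactSupport η →
      Integrable fun x => u x * η x := fun hu h1 h2 =>
    hu.integrable_smul_right_of_hasCompactSupport h1.continuous h2
  refine ⟨∫ x, w x * χ x, ?_⟩
  set c := ∫ x, w x * χ x with hc
  have h0 : ∀ᵐ x, w x - c = 0 := by
    refine ae_eq_zero_of_integral_contDiff_smul_eq_zero
      (hw.sub (locallyIntegrable_const c)) fun η hη hηc => ?_
    set I := ∫ x, η x with hI
    -- Removing the mean of `η` by means of `χ` makes the primitive `Θ` compactly supported, so `θ =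
    -- Θ'` is the derivative of a test function.
    set θ : ℝ → ℝ := fun x => η x - I * χ x with hθ
    have hθs : ContDiff ℝ ∞ θ := hη.sub (contDiff_const.mul hχs)
    have hθc : HasCompactSupport θ := hηc.sub (hχc.mul_left (f := fun _ => I))
    obtain ⟨R, hR, hsupp⟩ := exists_support_subset_Ioo hθc
    have hθ0 : ∫ x, θ x = 0 := by
      rw [hθ, integral_sub (hη.continuous.integrable_of_hasCompactSupport hηc)
        ((hχs.continuous.integrable_of_hasCompactSupport hχc).const_mul I),
        integral_const_mul, hχi, mul_one, sub_self]
    set Θ : ℝ → ℝ := fun x => ∫ t in (-R)..x, θ t with hΘ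
    have hΘd : ∀ x, HasDerivAt Θ (θ x) x := fun x =>
      (hθs.continuous.integral_hasStrictDerivAt (-R) x).hasDerivAt
    have hΘs : ContDiff ℝ ∞ Θ := by
      rw [contDiff_infty_iff_deriv]
      refine ⟨fun x => (hΘd x).differentiableAt, ?_⟩
      rw [funext fun x => (hΘd x).deriv]
      exact hθs
    have hii : ∀ a b, IntervalIntegrable θ volume a b := fun a b =>
      hθs.continuous.intervalIntegrable a b
    have hΘc : HasCompactSupport Θ := by
      refine HasCompactSupport.intro (isCompact_Icc (a := -R) (b := R)) fun x hx => ?_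
      rcases lt_or_ge x (-R) with h1 | h1
      · refine intervalIntegral.integral_zero_ae (ae_of_all _ fun t ht => hsupp t fun h2 => ?_)
        rw [uIoc_of_ge h1.le] at ht
        linarith [ht.2, h2.1]
      · have h2 : R < x := lt_of_not_ge fun h3 => hx ⟨h1, h3⟩
        have h3 : ∫ t in R..x, θ t = 0 := by
          refine intervalIntegral.integral_zero_ae (ae_of_all _ fun t ht => hsupp t fun h4 => ?_)
          rw [uIoc_of_le h2.le] at ht
          linarith [ht.1, h4.2]
        have h4 := intervalIntegral.integral_add_adjacent_intervals (hii (-R) R) (hii R x)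
        rw [h3, ← integral_eq_intervalIntegral_of_support hR hsupp, hθ0] at h4
        simpa using h4.symm
    have key := h Θ hΘs hΘc
    rw [funext fun x => (hΘd x).deriv] at key
    have h5 : (fun x => w x * θ x) = fun x => w x * η x - I * (w x * χ x) := by
      funext x; simp only [hθ]; ring
    rw [h5, integral_sub (hint hw hη hηc) ((hint hw hχs hχc).const_mul I),
      integral_const_mul, ← hc] at key
    have h6 : (fun x => η x • (w x - c)) = fun x => w x * η x - c * η x := by
      funext x; simp only [smul_eq_mul]; ring
    rw [h6, integral_sub (hint hw hη hηc)
      ((hη.continuous.integrable_of_hasCompactSupport hηc).const_mul c), integral_const_mul, ← hI]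
    linarith
  filter_upwards [h0] with x hx
  linarith

/-- A weakly differentiable function has a locally absolutely continuous representative. -/
theorem IsWeakDerivOn.exists_isPrim {f f' : ℝ → ℝ} (h : IsWeakDerivOn univ f f') :
    ∃ F, f =ᵐ[volume] F ∧ IsPrim F f' := by
  have lf := locallyIntegrableOn_univ.1 h.loc
  have lf' := locallyIntegrableOn_univ.1 h.loc_deriv
  have hF := isPrim_integral lf' 0
  set F : ℝ → ℝ := fun x => 0 + ∫ t in (0 : ℝ)..x, f' t with hFdef
  obtain ⟨c, hc⟩ := ae_eq_const_of_weakDeriv_zero (w := fun x => f x - F x)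
    (lf.sub hF.continuous.locallyIntegrable) fun ψ h1 h2 => by
      have hd : Continuous (deriv ψ) := h1.continuous_deriv (by simp)
      have i1 : ∀ {u : ℝ → ℝ}, LocallyIntegrable u → Integrable (fun x => u x * deriv ψ x) :=
        fun hu => hu.integrable_smul_right_of_hasCompactSupport hd h2.deriv
      simp only [sub_mul]
      rw [integral_sub (i1 lf) (i1 hF.continuous.locallyIntegrable),
        h.by_parts ψ h1 h2 (subset_univ _), hF.isWeakDerivOn.by_parts ψ h1 h2 (subset_univ _),
        sub_self]
  refine ⟨fun x => c + ∫ t in (0 : ℝ)..x, f' t, ?_, isPrim_integral lf' c⟩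
  filter_upwards [hc] with x hx
  simp only [hFdef, zero_add] at hx
  linarith

/-! ### The Liouville transformation -/

namespace Admissible

variable {ρ k γ : ℝ → ℝ} (h : Admissible ρ k γ)
include h

theorem ae_rhoMeasure : ae (rhoMeasure ρ) = ae (volume : Measure ℝ) := by
  have hm : Measurable fun x => ENNReal.ofReal (ρ x) := h.continuous_rho.measurable.ennreal_ofReal
  refine le_antisymm (withDensity_absolutelyContinuous _ _).ae_le ?_
  refine (withDensity_absolutelyContinuous' hm.aemeasurable (ae_of_all _ fun x => ?_)).ae_le
  simpa using h.rho_pos' x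

theorem integral_rhoMeasure (f : ℝ → ℝ) : ∫ x, f x ∂(rhoMeasure ρ) = ∫ x, ρ x * f x := by
  have hm : Measurable fun x => ENNReal.ofReal (ρ x) := h.continuous_rho.measurable.ennreal_ofReal
  rw [rhoMeasure, integral_withDensity_eq_integral_toReal_smul hm (by simp)]
  simp [ENNReal.toReal_ofReal (h.rho_pos' _).le]

theorem integrable_rhoMeasure_iff {f : ℝ → ℝ} :
    Integrable f (rhoMeasure ρ) ↔ Integrable fun x => ρ x * f x := by
  have hm : Measurable fun x => ENNReal.ofReal (ρ x) := h.continuous_rho.measurable.ennreal_ofReal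
  rw [rhoMeasure, integrable_withDensity_iff_integrable_smul' hm (by simp)]
  simp [ENNReal.toReal_ofReal (h.rho_pos' _).le]

theorem integral_comp_sig (f : ℝ → ℝ) : ∫ x, sigD ρ k x * f (sig ρ k x) = ∫ y, f y := by
  have := integral_image_eq_integral_abs_deriv_smul MeasurableSet.univ
    (fun x _ => (h.hasDerivAt_sig x).hasDerivWithinAt) h.strictMono_sig.injective.injOn f
  rw [image_univ, h.surjective_sig.range_eq, setIntegral_univ, setIntegral_univ] at this
  rw [this]
  simp [abs_of_pos (h.sigD_pos _)]

theorem integrable_comp_sig_iff {f : ℝ → ℝ} :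
    Integrable (fun x => sigD ρ k x * f (sig ρ k x)) ↔ Integrable f := by
  have := integrableOn_image_iff_integrableOn_abs_deriv_smul MeasurableSet.univ
    (fun x _ => (h.hasDerivAt_sig x).hasDerivWithinAt) h.strictMono_sig.injective.injOn f
  rw [image_univ, h.surjective_sig.range_eq, integrableOn_univ, integrableOn_univ] at this
  rw [this]
  simp [abs_of_pos (h.sigD_pos _)]

/-- A preimage under `σ` is an image under its inverse, and differentiable maps of the line send
null sets to null sets. -/
theorem quasiMeasurePreserving_sig : Measure.QuasiMeasurePreserving (sig ρ k) := by
  refine ⟨h.continuous_sig.measurable, Measure.AbsolutelyContinuous.mk fun s hs h0 => ?_⟩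
  rw [Measure.map_apply h.continuous_sig.measurable hs]
  have h1 : sig ρ k ⁻¹' s = h.tau '' s := by
    ext x
    constructor
    · exact fun hx => ⟨_, hx, h.tau_sig x⟩
    · rintro ⟨y, hy, rfl⟩
      rwa [mem_preimage, h.sig_tau]
  rw [h1]
  exact addHaar_image_eq_zero_of_differentiableOn_of_addHaar_eq_zero volume
    (fun y _ => (h.hasDerivAt_tau y).differentiableAt.differentiableWithinAt) h0

theorem quasiMeasurePreserving_tau : Measure.QuasiMeasurePreserving h.tau := by
  refine ⟨h.continuous_tau.measurable, Measure.AbsolutelyContinuous.mk fun s hs h0 => ?_⟩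
  rw [Measure.map_apply h.continuous_tau.measurable hs]
  have h1 : h.tau ⁻¹' s = sig ρ k '' s := by
    ext x
    constructor
    · exact fun hx => ⟨_, hx, h.sig_tau x⟩
    · rintro ⟨y, hy, rfl⟩
      rwa [mem_preimage, h.tau_sig]
  rw [h1]
  exact addHaar_image_eq_zero_of_differentiableOn_of_addHaar_eq_zero volume
    (fun y _ => (h.hasDerivAt_sig y).differentiableAt.differentiableWithinAt) h0

end Admissible

/-- `ψ`, as a function of `y = σ(x)`, represents the Liouville transform of `a`. -/
def IsTransf (ρ k : ℝ → ℝ) (a : ℝ → ℝ) (ψ : ℝ → ℝ) : Prop :=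
  a =ᵐ[volume] fun x => ψ (sig ρ k x) / mul4 ρ k x

namespace IsTransf

variable {ρ k γ : ℝ → ℝ} {a b ψ θ : ℝ → ℝ}

theorem sub (ha : IsTransf ρ k a ψ) (hb : IsTransf ρ k b θ) :
    IsTransf ρ k (fun x => a x - b x) (fun y => ψ y - θ y) := by
  filter_upwards [ha, hb] with x h1 h2
  rw [h1, h2, sub_div]

/-- The factorisation `ρ = m² σ'` cancels the two multipliers `1/m` and leaves exactly the Jacobian
of `σ`. -/
theorem weight_mul (h : Admissible ρ k γ) (ha : IsTransf ρ k a ψ) (hb : IsTransf ρ k b θ) :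
    (fun x => ρ x * (a x * b x)) =ᵐ[volume]
      fun x => sigD ρ k x * (fun y => ψ y * θ y) (sig ρ k x) := by
  filter_upwards [ha, hb] with x h1 h2
  have := (h.mul4_pos x).ne'
  rw [h1, h2, h.rho_eq]
  field_simp

theorem integral_mul (h : Admissible ρ k γ) (ha : IsTransf ρ k a ψ) (hb : IsTransf ρ k b θ) :
    ∫ x, a x * b x ∂(rhoMeasure ρ) = ∫ y, ψ y * θ y := by
  rw [h.integral_rhoMeasure, integral_congr_ae (weight_mul h ha hb)]
  exact h.integral_comp_sig fun y => ψ y * θ y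

theorem integrable_mul_iff (h : Admissible ρ k γ) (ha : IsTransf ρ k a ψ)
    (hb : IsTransf ρ k b θ) :
    Integrable (fun x => a x * b x) (rhoMeasure ρ) ↔ Integrable fun y => ψ y * θ y := by
  rw [h.integrable_rhoMeasure_iff, integrable_congr (weight_mul h ha hb)]
  exact h.integrable_comp_sig_iff (f := fun y => ψ y * θ y)

theorem ae_eq_tau (h : Admissible ρ k γ) (ha : IsTransf ρ k a ψ) :
    ψ =ᵐ[volume] fun y => a (h.tau y) * mul4 ρ k (h.tau y) := by
  filter_upwards [h.quasiMeasurePreserving_tau.ae ha] with y hy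
  rw [hy, h.sig_tau, div_mul_cancel₀ _ (h.mul4_pos _).ne']

theorem memLp_iff (h : Admissible ρ k γ) (ha : IsTransf ρ k a ψ) :
    MemLp a 2 (rhoMeasure ρ) ↔ MemLp ψ 2 := by
  have h1 : AEStronglyMeasurable a (rhoMeasure ρ) ↔ AEStronglyMeasurable a volume :=
    ⟨fun h1 => ⟨h1.mk a, h1.stronglyMeasurable_mk, by
        have := h1.ae_eq_mk; rwa [EventuallyEq, h.ae_rhoMeasure] at this⟩,
      fun h1 => ⟨h1.mk a, h1.stronglyMeasurable_mk, by
        have := h1.ae_eq_mk; rwa [EventuallyEq, ← h.ae_rhoMeasure] at this⟩⟩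
  have h2 : AEStronglyMeasurable a volume ↔ AEStronglyMeasurable ψ volume := by
    constructor
    · intro h2
      refine AEStronglyMeasurable.congr ?_ (ae_eq_tau h ha).symm
      exact (h2.comp_quasiMeasurePreserving h.quasiMeasurePreserving_tau).mul
        (h.continuous_mul4.comp h.continuous_tau).aestronglyMeasurable
    · intro h2
      refine AEStronglyMeasurable.congr ?_ (EventuallyEq.symm ha)
      have h3 := h2.comp_quasiMeasurePreserving h.quasiMeasurePreserving_sig
      have h4 := h3.mul (h.continuous_mul4.inv₀
        fun x => (h.mul4_pos x).ne').aestronglyMeasurable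
      exact h4.congr (ae_of_all _ fun x => by simp [div_eq_mul_inv])
  constructor
  · intro h3
    rw [memLp_two_iff_integrable_sq (h2.1 (h1.1 h3.1))]
    have h4 := (memLp_two_iff_integrable_sq h3.1).1 h3
    simp only [sq] at h4 ⊢
    exact (integrable_mul_iff h ha ha).1 h4
  · intro h3
    rw [memLp_two_iff_integrable_sq (h1.2 (h2.2 h3.1))]
    have h4 := (memLp_two_iff_integrable_sq h3.1).1 h3
    simp only [sq] at h4 ⊢
    exact (integrable_mul_iff h ha ha).2 h4

theorem norm_sq (h : Admissible ρ k γ) {a : L2rho ρ} (ha : IsTransf ρ k a ψ) :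
    ‖a‖ ^ 2 = ∫ y, ψ y ^ 2 := by
  rw [← real_inner_self_eq_norm_sq, L2.inner_def]
  simp only [sq]
  rw [← integral_mul h ha ha]
  exact integral_congr_ae (ae_of_all _ fun x => by simp [sq])

theorem exists_of_memLp (h : Admissible ρ k γ) (hψ : MemLp ψ 2) :
    ∃ a : L2rho ρ, IsTransf ρ k a ψ := by
  have h1 : IsTransf ρ k (fun x => ψ (sig ρ k x) / mul4 ρ k x) ψ := EventuallyEq.rfl
  have h2 := (memLp_iff h h1).2 hψ
  refine ⟨h2.toLp _, ?_⟩
  have := h2.coeFn_toLp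
  rwa [EventuallyEq, h.ae_rhoMeasure] at this

end IsTransf

/-- `ψ` and `ψ'`, as functions of `y = σ(x)`, represent the Liouville transform of `φ ∈ ℍ¹`. -/
structure IsLift {ρ k : ℝ → ℝ} (φ : H1 ρ k) (ψ ψ' : ℝ → ℝ) : Prop where
  fst : IsTransf ρ k (fn φ) ψ
  snd : IsTransf ρ k (opD φ) ψ'

variable {ρ k γ : ℝ → ℝ}

theorem H1.norm_sq (φ : H1 ρ k) : ‖φ‖ ^ 2 = ‖fn φ‖ ^ 2 + ‖opD φ‖ ^ 2 :=
  WithLp.prod_norm_sq_eq_of_L2 φ.1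

namespace IsLift

variable {φ θ : H1 ρ k} {ψ ψ' ξ ξ' : ℝ → ℝ}

theorem norm_sq (h : Admissible ρ k γ) (hφ : IsLift φ ψ ψ') :
    ‖φ‖ ^ 2 = (∫ y, ψ y ^ 2) + ∫ y, ψ' y ^ 2 := by
  rw [H1.norm_sq, hφ.fst.norm_sq h, hφ.snd.norm_sq h]

theorem sub (h : Admissible ρ k γ) (hφ : IsLift φ ψ ψ') (hθ : IsLift θ ξ ξ') :
    IsLift (φ - θ) (fun y => ψ y - ξ y) (fun y => ψ' y - ξ' y) := by
  constructor
  · have h1 : (fn (φ - θ) : ℝ → ℝ) =ᵐ[volume] fun x => fn φ x - fn θ x := by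
      have := Lp.coeFn_sub (fn φ) (fn θ)
      rwa [EventuallyEq, h.ae_rhoMeasure] at this
    exact h1.trans (hφ.fst.sub hθ.fst)
  · have h1 : (opD (φ - θ) : ℝ → ℝ) =ᵐ[volume] fun x => opD φ x - opD θ x := by
      have := Lp.coeFn_sub (opD φ) (opD θ)
      rwa [EventuallyEq, h.ae_rhoMeasure] at this
    exact h1.trans (hφ.snd.sub hθ.snd)

theorem memLp_fst (h : Admissible ρ k γ) (hφ : IsLift φ ψ ψ') : MemLp ψ 2 :=
  (hφ.fst.memLp_iff h).1 (Lp.memLp _)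

theorem memLp_snd (h : Admissible ρ k γ) (hφ : IsLift φ ψ ψ') : MemLp ψ' 2 :=
  (hφ.snd.memLp_iff h).1 (Lp.memLp _)

theorem valueAtZero (h : Admissible ρ k γ) (hφ : IsLift φ ψ ψ') (hc : Continuous ψ) :
    valueAtZero (fn φ) = ψ 0 / mul4 ρ k 0 := by
  rw [valueAtZero_eq hφ.fst, sig_zero]
  exact ((hc.comp h.continuous_sig).div h.continuous_mul4 fun x =>
    (h.mul4_pos x).ne').continuousAt

end IsLift

/-- The structure of an element of `ℍ¹`. -/
theorem H1.exists_rep (h : Admissible ρ k γ) (φ : H1 ρ k) :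
    ∃ F f' : ℝ → ℝ, (fn φ : ℝ → ℝ) =ᵐ[volume] F ∧ IsPrim F f' ∧
      (opD φ : ℝ → ℝ) =ᵐ[volume] fun x => Real.sqrt (k x / ρ x) * f' x + Q1 ρ k x * F x := by
  obtain ⟨f, f', h1, h2, h3⟩ := φ.2
  rw [EventuallyEq, h.ae_rhoMeasure] at h1 h3
  obtain ⟨F, hF, hp⟩ := h2.exists_isPrim
  refine ⟨F, f', EventuallyEq.trans h1 hF, hp, ?_⟩
  filter_upwards [h3, hF] with x h4 h5
  rw [← h5]
  exact h4

/-- The lift is `g = (F m) ∘ σ⁻¹`. Since `m' = m σ' Q₁` and `√(k/ρ) = 1/σ'`, one has `(F m)' = m σ'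
𝔻F`, and the factor `σ'` disappears in the variable `y`. -/
theorem exists_isLift (h : Admissible ρ k γ) (φ : H1 ρ k) :
    ∃ g g' : ℝ → ℝ, IsLift φ g g' ∧ IsPrim g g' := by
  obtain ⟨F, f', h1, hp, h3⟩ := H1.exists_rep h φ
  have hm : IsPrim (mul4 ρ k) fun x => mul4 ρ k x * sigD ρ k x * Q1 ρ k x :=
    isPrim_of_hasDerivAt h.hasDerivAt_mul4
      ((h.continuous_mul4.mul h.continuous_sigD).mul h.continuous_Q1)
  have hg := (hp.mul hm).comp h.hasDerivAt_tau fun y => (inv_pos.2 (h.sigD_pos _)).le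
  refine ⟨_, _, ⟨?_, ?_⟩, hg⟩
  · filter_upwards [h1] with x hx
    have := (h.mul4_pos x).ne'
    simp only [h.tau_sig, hx]
    field_simp
  · filter_upwards [h3] with x hx
    have := (h.mul4_pos x).ne'
    have := (h.sigD_pos x).ne'
    simp only [h.tau_sig, hx, sqrt_k_div_rho]
    field_simp

/-- The converse, for `C¹` functions only: it supplies the translated heat kernels as test elements
of `ℍ¹`. -/
theorem exists_of_isPrim (h : Admissible ρ k γ) {ψ ψ' : ℝ → ℝ}
    (hd : ∀ y, HasDerivAt ψ (ψ' y) y) (hc : Continuous ψ') (h1 : MemLp ψ 2) (h2 : MemLp ψ' 2) :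
    ∃ φ : H1 ρ k, IsLift φ ψ ψ' := by
  obtain ⟨a, ha⟩ := IsTransf.exists_of_memLp h h1
  obtain ⟨b, hb⟩ := IsTransf.exists_of_memLp h h2
  have hcψ : Continuous ψ := continuous_iff_continuousAt.2 fun x => (hd x).continuousAt
  have hprim : IsPrim (fun x => ψ (sig ρ k x) / mul4 ρ k x)
      (fun x => sigD ρ k x * (ψ' (sig ρ k x) / mul4 ρ k x
        - Q1 ρ k x * (ψ (sig ρ k x) / mul4 ρ k x))) := by
    refine isPrim_of_hasDerivAt (fun x => ?_) ?_
    · have hm := (h.mul4_pos x).ne'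
      refine (((hd _).comp x (h.hasDerivAt_sig x)).div (h.hasDerivAt_mul4 x) hm).congr_deriv ?_
      simp only [Function.comp_apply]
      field_simp
    · have hm := fun x => (h.mul4_pos x).ne'
      exact h.continuous_sigD.mul (((hc.comp h.continuous_sig).div h.continuous_mul4 hm).sub
        (h.continuous_Q1.mul ((hcψ.comp h.continuous_sig).div h.continuous_mul4 hm)))
  refine ⟨⟨WithLp.toLp 2 (a, b), _, _, ?_, hprim.isWeakDerivOn, ?_⟩, ha, hb⟩
  · rw [EventuallyEq, h.ae_rhoMeasure]; exact ha
  · rw [EventuallyEq, h.ae_rhoMeasure]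
    filter_upwards [hb] with x hx
    have := (h.sigD_pos x).ne'
    change b x = _
    rw [hx, sqrt_k_div_rho]
    field_simp
    ring

/-- Evenness passes to the lift almost everywhere, as `σ` is odd and `m` is even; continuity then
gives it at every point. -/
theorem isLift_even (h : Admissible ρ k γ) {φ : H1 ρ k} (he : IsEven φ) {g g' : ℝ → ℝ}
    (hl : IsLift φ g g') (hg : Continuous g) (y : ℝ) : g (-y) = g y := by
  have h1 : ∀ᵐ x, g (sig ρ k (-x)) / mul4 ρ k (-x) = g (sig ρ k x) / mul4 ρ k x := by
    filter_upwards [he, hl.fst, (Measure.measurePreserving_neg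
      (volume : Measure ℝ)).quasiMeasurePreserving.ae hl.fst] with x h2 h3 h4
    rw [← h3, ← h4, h2]
  have h2 : (fun y => g (-y)) =ᵐ[volume] g := by
    filter_upwards [h.quasiMeasurePreserving_tau.ae h1] with y hy
    rw [h.mul4_neg, h.sig_neg, h.sig_tau] at hy
    have := (h.mul4_pos (h.tau y)).ne'
    field_simp at hy
    exact hy
  exact congrFun ((hg.comp continuous_neg).ae_eq_iff_eq volume hg |>.1 h2) y

/-! ### The heat kernel -/

/-- The heat kernel. -/
noncomputable def G (s y : ℝ) : ℝ := (Real.sqrt (4 * Real.pi * s))⁻¹ * Real.exp (-(y ^ 2) / (4 * s))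

/-- The first space derivative of the heat kernel. -/
noncomputable def G1 (s y : ℝ) : ℝ := -(y / (2 * s)) * G s y

/-- The second space derivative of the heat kernel, equal to its time derivative. -/
noncomputable def G2 (s y : ℝ) : ℝ := (y ^ 2 / (4 * s ^ 2) - 1 / (2 * s)) * G s y

/-- The third space derivative of the heat kernel. -/
noncomputable def G3 (s y : ℝ) : ℝ := (-(y ^ 3 / (8 * s ^ 3)) + 3 * y / (4 * s ^ 2)) * G s y

theorem G_nonneg (s y : ℝ) : 0 ≤ G s y := by unfold G; positivity

theorem G_neg (s y : ℝ) : G s (-y) = G s y := by simp [G]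

theorem hasDerivAt_G {s : ℝ} (hs : s ≠ 0) (y : ℝ) : HasDerivAt (G s) (G1 s y) y := by
  have h1 : HasDerivAt (fun y : ℝ => -(y ^ 2) / (4 * s)) (-(2 * y) / (4 * s)) y := by
    simpa using ((hasDerivAt_pow 2 y).neg).div_const (4 * s)
  refine (h1.exp.const_mul _).congr_deriv ?_
  unfold G1 G
  field_simp
  ring

theorem hasDerivAt_G1 {s : ℝ} (hs : s ≠ 0) (y : ℝ) : HasDerivAt (G1 s) (G2 s y) y := by
  have h1 : HasDerivAt (fun y : ℝ => -(y / (2 * s))) (-(1 / (2 * s))) y :=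
    ((hasDerivAt_id y).div_const _).neg
  refine (h1.mul (hasDerivAt_G hs y)).congr_deriv ?_
  unfold G2 G1
  field_simp
  ring

theorem hasDerivAt_G2 {s : ℝ} (hs : s ≠ 0) (y : ℝ) : HasDerivAt (G2 s) (G3 s y) y := by
  have h1 : HasDerivAt (fun y : ℝ => y ^ 2 / (4 * s ^ 2) - 1 / (2 * s)) (2 * y / (4 * s ^ 2)) y := by
    simpa using ((hasDerivAt_pow 2 y).div_const (4 * s ^ 2)).sub_const (1 / (2 * s))
  refine (h1.mul (hasDerivAt_G hs y)).congr_deriv ?_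
  unfold G3 G1
  field_simp
  ring

theorem hasDerivAt_G_time {s : ℝ} (hs : 0 < s) (y : ℝ) :
    HasDerivAt (fun s => G s y) (G2 s y) s := by
  have hpi : 0 < 4 * Real.pi := by positivity
  have h1 : HasDerivAt (fun s : ℝ => -(y ^ 2) / (4 * s)) (y ^ 2 / (4 * s ^ 2)) s := by
    have := (hasDerivAt_const s (-(y ^ 2))).div ((hasDerivAt_id s).const_mul 4)
      (by simp only [id]; positivity)
    refine this.congr_deriv ?_
    simp only [id]
    field_simp
    ring
  have hsq : 0 < Real.sqrt (4 * Real.pi * s) := Real.sqrt_pos.2 (by positivity)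
  have h2 : HasDerivAt (fun s : ℝ => (Real.sqrt (4 * Real.pi * s))⁻¹)
      (-(1 / (2 * s)) * (Real.sqrt (4 * Real.pi * s))⁻¹) s := by
    have h3 := (((hasDerivAt_id s).const_mul (4 * Real.pi)).sqrt
      (by simp only [id]; positivity)).inv (by simp only [id]; positivity)
    refine h3.congr_deriv ?_
    simp only [id]
    have h4 : Real.sqrt (4 * Real.pi * s) ^ 2 = 4 * Real.pi * s := Real.sq_sqrt (by positivity)
    rw [h4]
    field_simp
  refine (h2.mul h1.exp).congr_deriv ?_
  unfold G2 G
  ring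

theorem hasDerivAt_G1_time {s : ℝ} (hs : 0 < s) (y : ℝ) :
    HasDerivAt (fun s => G1 s y) (G3 s y) s := by
  have h1 : HasDerivAt (fun s : ℝ => -(y / (2 * s))) (y / (2 * s ^ 2)) s := by
    have := ((hasDerivAt_const s y).div ((hasDerivAt_id s).const_mul 2)
      (by simp only [id]; positivity)).neg
    refine this.congr_deriv ?_
    simp only [id]
    field_simp
    ring
  refine (h1.mul (hasDerivAt_G_time hs y)).congr_deriv ?_
  unfold G3 G2
  field_simp
  ring

theorem continuous_G {s : ℝ} (hs : s ≠ 0) : Continuous (G s) :=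
  continuous_iff_continuousAt.2 fun y => (hasDerivAt_G hs y).continuousAt

theorem continuous_G1 {s : ℝ} (hs : s ≠ 0) : Continuous (G1 s) :=
  continuous_iff_continuousAt.2 fun y => (hasDerivAt_G1 hs y).continuousAt

theorem continuous_G2 {s : ℝ} (hs : s ≠ 0) : Continuous (G2 s) :=
  continuous_iff_continuousAt.2 fun y => (hasDerivAt_G2 hs y).continuousAt

/-- Uniform decay of the heat kernel and its derivatives for times in a compact interval. -/
theorem exists_G_bound {ε S : ℝ} (hε : 0 < ε) (hS : ε ≤ S) : ∃ C : ℝ, 0 ≤ C ∧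
    ∀ s ∈ Icc ε S, ∀ y, |G s y| ≤ C * (1 + y ^ 2)⁻¹ ∧ |G1 s y| ≤ C * (1 + y ^ 2)⁻¹ ∧
      |G2 s y| ≤ C * (1 + y ^ 2)⁻¹ ∧ |G3 s y| ≤ C * (1 + y ^ 2)⁻¹ := by
  set c : ℝ := (Real.sqrt (4 * Real.pi * ε))⁻¹ with hc
  set M : ℝ := c * ((4 * S) ^ 3 * 6 * Real.exp (1 / (4 * S))) with hM
  have hS0 : 0 < S := hε.trans_le hS
  have hc0 : 0 ≤ c := by positivity
  have hM0 : 0 ≤ M := by positivity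
  -- The factor `(1 + y²)²` dominates every power of `y` up to the third, hence all polynomial
  -- prefactors in `G`, `G1`, `G2`, `G3`. One further power of `1 + y²` is kept as the decay.
  have hG : ∀ s ∈ Icc ε S, ∀ y, (1 + y ^ 2) ^ 2 * G s y ≤ M * (1 + y ^ 2)⁻¹ := by
    intro s hs y
    have hs0 : 0 < s := hε.trans_le hs.1
    have hy : 0 < 1 + y ^ 2 := by positivity
    have h1 : G s y ≤ c * Real.exp (-(y ^ 2) / (4 * S)) := by
      unfold G
      gcongr ?_ * Real.exp ?_
      · rw [hc]
        gcongr
        exact hs.1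
      · rw [neg_div, neg_div, neg_le_neg_iff]
        gcongr
        exact hs.2
    have h2 : (1 + y ^ 2) ^ 3 * Real.exp (-(y ^ 2) / (4 * S)) ≤
        (4 * S) ^ 3 * 6 * Real.exp (1 / (4 * S)) := by
      -- The cubic bound `x³ ≤ 6 eˣ` at this point absorbs `(1 + y²)³` into the Gaussian of the
      -- largest time `S`.
      set x := (1 + y ^ 2) / (4 * S) with hx
      have hx0 : 0 ≤ x := by positivity
      have h3 := Real.pow_div_factorial_le_exp x hx0 3
      have h4 : x ^ 3 ≤ 6 * Real.exp x := by
        have : ((Nat.factorial 3 : ℕ) : ℝ) = 6 := by norm_num [Nat.factorial]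
        rw [this] at h3
        linarith
      have h5 : (1 + y ^ 2) ^ 3 = (4 * S) ^ 3 * x ^ 3 := by
        rw [hx]; field_simp
      have h6 : Real.exp x * Real.exp (-(y ^ 2) / (4 * S)) = Real.exp (1 / (4 * S)) := by
        rw [← Real.exp_add, hx]; congr 1; field_simp; ring
      calc (1 + y ^ 2) ^ 3 * Real.exp (-(y ^ 2) / (4 * S))
          ≤ (4 * S) ^ 3 * (6 * Real.exp x) * Real.exp (-(y ^ 2) / (4 * S)) := by
            rw [h5]; gcongr
        _ = (4 * S) ^ 3 * 6 * (Real.exp x * Real.exp (-(y ^ 2) / (4 * S))) := by ring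
        _ = _ := by rw [h6]
    rw [← div_eq_mul_inv, le_div_iff₀ hy]
    calc (1 + y ^ 2) ^ 2 * G s y * (1 + y ^ 2) = (1 + y ^ 2) ^ 3 * G s y := by ring
      _ ≤ (1 + y ^ 2) ^ 3 * (c * Real.exp (-(y ^ 2) / (4 * S))) := by gcongr
      _ = c * ((1 + y ^ 2) ^ 3 * Real.exp (-(y ^ 2) / (4 * S))) := by ring
      _ ≤ M := by rw [hM]; gcongr
  set K : ℝ := 1 + 1 / ε + 1 / ε ^ 2 + 1 / ε ^ 3 with hK
  have hK0 : 0 ≤ K := by positivity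
  have key : ∀ s ∈ Icc ε S, ∀ y p, |p| ≤ K * (1 + y ^ 2) ^ 2 →
      |p * G s y| ≤ K * M * (1 + y ^ 2)⁻¹ := by
    intro s hs y p hp
    rw [abs_mul, abs_of_nonneg (G_nonneg s y)]
    calc |p| * G s y ≤ K * (1 + y ^ 2) ^ 2 * G s y := by gcongr; exact G_nonneg s y
      _ = K * ((1 + y ^ 2) ^ 2 * G s y) := by ring
      _ ≤ K * (M * (1 + y ^ 2)⁻¹) := mul_le_mul_of_nonneg_left (hG s hs y) hK0
      _ = _ := by ring
  refine ⟨K * M, by positivity, fun s hs y => ?_⟩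
  have hs0 : 0 < s := hε.trans_le hs.1
  have i1 : 1 / s ≤ 1 / ε := by gcongr; exact hs.1
  have i2 : 1 / s ^ 2 ≤ 1 / ε ^ 2 := by gcongr; exact hs.1
  have i3 : 1 / s ^ 3 ≤ 1 / ε ^ 3 := by gcongr; exact hs.1
  have j0 : 0 < 1 / s := by positivity
  have j1 : 0 < 1 / s ^ 2 := by positivity
  have j2 : 0 < 1 / s ^ 3 := by positivity
  have hq : 1 ≤ (1 + y ^ 2) ^ 2 := by nlinarith [sq_nonneg y]
  have hy1 : |y| ≤ (1 + y ^ 2) ^ 2 := by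
    nlinarith [sq_nonneg (|y| - 1), sq_abs y, sq_nonneg (y ^ 2), abs_nonneg y]
  have hy2 : y ^ 2 ≤ (1 + y ^ 2) ^ 2 := by nlinarith [sq_nonneg (y ^ 2)]
  have hy3 : |y| ^ 3 ≤ (1 + y ^ 2) ^ 2 := by
    have : |y| ^ 3 = |y| * y ^ 2 := by rw [← sq_abs y]; ring
    rw [this]
    have : |y| ≤ 1 + y ^ 2 := by nlinarith [sq_nonneg (|y| - 1), sq_abs y]
    nlinarith [sq_nonneg y]
  set Q : ℝ := (1 + y ^ 2) ^ 2 with hQ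
  have hQ0 : 0 ≤ Q := by positivity
  refine ⟨?_, ?_, ?_, ?_⟩
  · have := key s hs y 1 (by
      rw [abs_one, hK]
      have : (0 : ℝ) ≤ 1 / ε + 1 / ε ^ 2 + 1 / ε ^ 3 := by positivity
      nlinarith)
    rwa [one_mul] at this
  · refine key s hs y _ ?_
    have e1 : |-(y / (2 * s))| = 1 / 2 * (1 / s) * |y| := by
      rw [abs_neg, abs_div, abs_of_pos (by positivity : 0 < 2 * s)]; field_simp
    rw [e1]
    have : 1 / 2 * (1 / s) ≤ K := by
      have : (0 : ℝ) ≤ 1 / ε ^ 2 + 1 / ε ^ 3 := by positivity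
      rw [hK]; linarith
    gcongr
  · refine key s hs y _ ?_
    have e1 : |y ^ 2 / (4 * s ^ 2) - 1 / (2 * s)| ≤
        1 / 4 * (1 / s ^ 2) * y ^ 2 + 1 / 2 * (1 / s) * 1 := by
      refine (abs_sub _ _).trans (le_of_eq ?_)
      rw [abs_of_nonneg (by positivity), abs_of_nonneg (by positivity)]
      field_simp
    refine e1.trans ?_
    have e2 : 1 / 4 * (1 / s ^ 2) * y ^ 2 + 1 / 2 * (1 / s) * 1 ≤
        1 / 4 * (1 / s ^ 2) * Q + 1 / 2 * (1 / s) * Q := by gcongr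
    refine e2.trans ?_
    rw [← add_mul]
    have : 1 / 4 * (1 / s ^ 2) + 1 / 2 * (1 / s) ≤ K := by
      have : (0 : ℝ) ≤ 1 / ε ^ 3 := by positivity
      rw [hK]; linarith
    gcongr
  · refine key s hs y _ ?_
    have e1 : |-(y ^ 3 / (8 * s ^ 3)) + 3 * y / (4 * s ^ 2)| ≤
        1 / 8 * (1 / s ^ 3) * |y| ^ 3 + 3 / 4 * (1 / s ^ 2) * |y| := by
      refine (abs_add_le _ _).trans (le_of_eq ?_)
      rw [abs_neg, abs_div, abs_div, abs_of_pos (by positivity : 0 < 8 * s ^ 3),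
        abs_of_pos (by positivity : 0 < 4 * s ^ 2), abs_pow, abs_mul,
        abs_of_pos (by norm_num : (0 : ℝ) < 3)]
      field_simp
    refine e1.trans ?_
    have e2 : 1 / 8 * (1 / s ^ 3) * |y| ^ 3 + 3 / 4 * (1 / s ^ 2) * |y| ≤
        1 / 8 * (1 / s ^ 3) * Q + 3 / 4 * (1 / s ^ 2) * Q := by gcongr
    refine e2.trans ?_
    rw [← add_mul]
    have : 1 / 8 * (1 / s ^ 3) + 3 / 4 * (1 / s ^ 2) ≤ K := by
      have : (0 : ℝ) ≤ 1 / ε := by positivity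
      rw [hK]; linarith
    gcongr

theorem memLp_inv_one_add_sq : MemLp (fun y : ℝ => (1 + y ^ 2)⁻¹) 2 := by
  have hc : Continuous fun y : ℝ => (1 + y ^ 2)⁻¹ :=
    (continuous_const.add (continuous_id.pow 2)).inv₀ fun y =>
      (add_pos_of_pos_of_nonneg one_pos (sq_nonneg y)).ne'
  rw [memLp_two_iff_integrable_sq hc.aestronglyMeasurable]
  refine integrable_inv_one_add_sq.mono' (hc.pow 2).aestronglyMeasurable (ae_of_all _ fun y => ?_)
  rw [Real.norm_of_nonneg (by positivity), sq]
  refine mul_le_of_le_one_left (by positivity) (inv_le_one_of_one_le₀ ?_)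
  nlinarith [sq_nonneg y]

theorem memLp_inv_one_add_sq_shift (z : ℝ) : MemLp (fun y : ℝ => (1 + (y - z) ^ 2)⁻¹) 2 :=
  memLp_inv_one_add_sq.comp_measurePreserving (measurePreserving_sub_right volume z)

theorem memLp_of_bound {f : ℝ → ℝ} (hf : Continuous f) {C z : ℝ}
    (hb : ∀ y, |f y| ≤ C * (1 + (y - z) ^ 2)⁻¹) : MemLp f 2 :=
  ((memLp_inv_one_add_sq_shift z).const_mul C).mono' hf.aestronglyMeasurable
    (ae_of_all _ fun y => hb y)

theorem continuous_shift {f : ℝ → ℝ} (hf : Continuous f) (z : ℝ) :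
    Continuous fun y => f (y - z) := hf.comp (continuous_id.sub continuous_const)

theorem memLp_G {s : ℝ} (hs : 0 < s) (z : ℝ) : MemLp (fun y => G s (y - z)) 2 := by
  obtain ⟨C, -, hC⟩ := exists_G_bound hs le_rfl
  exact memLp_of_bound (z := z) (continuous_shift (continuous_G hs.ne') z)
    fun y => (hC s ⟨le_rfl, le_rfl⟩ _).1

theorem memLp_G1 {s : ℝ} (hs : 0 < s) (z : ℝ) : MemLp (fun y => G1 s (y - z)) 2 := by
  obtain ⟨C, -, hC⟩ := exists_G_bound hs le_rfl
  exact memLp_of_bound (z := z) (continuous_shift (continuous_G1 hs.ne') z)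
    fun y => (hC s ⟨le_rfl, le_rfl⟩ _).2.1

theorem memLp_G2 {s : ℝ} (hs : 0 < s) (z : ℝ) : MemLp (fun y => G2 s (y - z)) 2 := by
  obtain ⟨C, -, hC⟩ := exists_G_bound hs le_rfl
  exact memLp_of_bound (z := z) (continuous_shift (continuous_G2 hs.ne') z)
    fun y => (hC s ⟨le_rfl, le_rfl⟩ _).2.2.1

theorem MemLp.integrable_mul_real {f g : ℝ → ℝ} (hf : MemLp f 2) (hg : MemLp g 2) :
    Integrable fun y => f y * g y := MemLp.integrable_mul hf hg

/-- Completing the square around the midpoint of `a` and `b`; the value is `G (2 * s) (a - b)`, the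
semigroup property. -/
theorem integral_G_mul_G {s : ℝ} (hs : 0 < s) (a b : ℝ) :
    ∫ y, G s (y - a) * G s (y - b) =
      (Real.sqrt (8 * Real.pi * s))⁻¹ * Real.exp (-((a - b) ^ 2) / (8 * s)) := by
  have h1 : ∀ y, G s (y - a) * G s (y - b) = (4 * Real.pi * s)⁻¹ *
      Real.exp (-((a - b) ^ 2) / (8 * s)) *
        Real.exp (-(1 / (2 * s)) * (y - (a + b) / 2) ^ 2) := by
    intro y
    have h2 : (Real.sqrt (4 * Real.pi * s))⁻¹ * (Real.sqrt (4 * Real.pi * s))⁻¹ =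
        (4 * Real.pi * s)⁻¹ := by
      rw [← mul_inv, Real.mul_self_sqrt (by positivity)]
    unfold G
    rw [mul_mul_mul_comm, h2, mul_assoc (4 * Real.pi * s)⁻¹, ← Real.exp_add, ← Real.exp_add]
    congr 2
    field_simp
    ring
  simp_rw [h1]
  rw [integral_const_mul, integral_sub_right_eq_self
    (fun y => Real.exp (-(1 / (2 * s)) * y ^ 2)), integral_gaussian]
  have h3 : Real.sqrt (Real.pi / (1 / (2 * s))) = (4 * Real.pi * s) / Real.sqrt (8 * Real.pi * s) := by
    rw [eq_div_iff (by positivity), ← Real.sqrt_mul (by positivity)]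
    rw [show Real.pi / (1 / (2 * s)) * (8 * Real.pi * s) = (4 * Real.pi * s) ^ 2 by
      field_simp; ring]
    exact Real.sqrt_sq (by positivity)
  rw [h3]
  have : 0 < Real.sqrt (8 * Real.pi * s) := Real.sqrt_pos.2 (by positivity)
  field_simp

/-- Expanding the square gives `2 (G (2s) 0 - G (2s) (a - b))`, and `1 - e^{-r} ≤ r` bounds it by a
multiple of `(b - a)² s^{-3/2}`. What matters is that the resulting rate `s^{-3/4}` for the norm is
integrable at `s = 0`. -/
theorem integral_G_sub_sq_le {s : ℝ} (hs : 0 < s) (a b : ℝ) :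
    ∫ y, (G s (y - b) - G s (y - a)) ^ 2 ≤ (|b - a| * s ^ (-(3 / 4) : ℝ)) ^ 2 := by
  have hi : ∀ p q, Integrable fun y => G s (y - p) * G s (y - q) := fun p q =>
    MemLp.integrable_mul_real (memLp_G hs p) (memLp_G hs q)
  have h1 : ∀ y, (G s (y - b) - G s (y - a)) ^ 2 = G s (y - b) * G s (y - b)
      - 2 * (G s (y - a) * G s (y - b)) + G s (y - a) * G s (y - a) := fun y => by ring
  simp_rw [h1]
  have h0 : Integrable fun y => G s (y - b) * G s (y - b)
      - 2 * (G s (y - a) * G s (y - b)) := (hi b b).sub ((hi a b).const_mul 2)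
  rw [integral_add h0 (hi a a), integral_sub (hi b b) ((hi a b).const_mul 2), integral_const_mul, integral_G_mul_G hs,
    integral_G_mul_G hs, integral_G_mul_G hs]
  simp only [sub_self, ne_eq, OfNat.ofNat_ne_zero, not_false_eq_true, zero_pow, neg_zero, zero_div,
    Real.exp_zero, mul_one]
  set c := (Real.sqrt (8 * Real.pi * s))⁻¹ with hc
  have hc0 : 0 ≤ c := by positivity
  have hc1 : c ≤ s ^ (-(1 / 2) : ℝ) := by
    rw [hc, Real.rpow_neg hs.le, ← Real.sqrt_eq_rpow]
    gcongr
    have := Real.pi_gt_three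
    nlinarith
  have h2 : 1 - Real.exp (-((a - b) ^ 2) / (8 * s)) ≤ (b - a) ^ 2 / (8 * s) := by
    have := Real.add_one_le_exp (-((a - b) ^ 2) / (8 * s))
    have h3 : -((a - b) ^ 2) / (8 * s) = -((b - a) ^ 2 / (8 * s)) := by ring
    rw [h3] at this ⊢
    linarith
  have h3 : (|b - a| * s ^ (-(3 / 4) : ℝ)) ^ 2 = s ^ (-(1 / 2) : ℝ) * ((b - a) ^ 2 / s) := by
    have h4 : (s ^ (-(3 / 4) : ℝ)) ^ 2 = s ^ (-(1 / 2) : ℝ) * s⁻¹ := by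
      rw [← Real.rpow_natCast, ← Real.rpow_mul hs.le, ← Real.rpow_neg_one s, ← Real.rpow_add hs]
      norm_num
    rw [mul_pow, sq_abs, h4]
    ring
  rw [h3]
  calc c - 2 * (c * Real.exp (-((a - b) ^ 2) / (8 * s))) + c
      = 2 * c * (1 - Real.exp (-((a - b) ^ 2) / (8 * s))) := by ring
    _ ≤ 2 * c * ((b - a) ^ 2 / (8 * s)) := by gcongr
    _ = c * ((b - a) ^ 2 / s) * (1 / 4) := by ring
    _ ≤ s ^ (-(1 / 2) : ℝ) * ((b - a) ^ 2 / s) * 1 := by gcongr; norm_num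
    _ = _ := by ring

/-- The majorant of the Poisson-type kernel `-∂G/∂y` near `y = a`. -/
noncomputable def Psi (a s : ℝ) : ℝ := a / ((a ^ 2 + s) * Real.sqrt (a ^ 2 + s))

/-- The mean value inequality on `[a, b] ⊆ [a, 2a]`. There `|G1 s x| = x/(2s) · G s x`; the
condition `b ≤ 2a` bounds the prefactor by `a/s`, and the Gaussian is largest at `x = a`. -/
theorem abs_G_sub_le {s a b : ℝ} (hs : 0 < s) (ha : 0 < a) (hab : a ≤ b) (hb : b ≤ 2 * a) :
    |G s b - G s a| ≤ 32 * Psi a s * (b - a) := by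
  have h1 : ∀ x ∈ Icc a b, ‖G1 s x‖ ≤ 32 * Psi a s := by
    intro x hx
    have hx0 : 0 < x := ha.trans_le hx.1
    have hsq : 0 < Real.sqrt s := Real.sqrt_pos.2 hs
    have e1 : ‖G1 s x‖ = x / (2 * s) * G s x := by
      rw [G1, Real.norm_eq_abs, abs_mul, abs_neg, abs_of_nonneg (G_nonneg _ _),
        abs_of_pos (by positivity)]
    have e2 : G s x ≤ (Real.sqrt s)⁻¹ * Real.exp (-(a ^ 2) / (4 * s)) := by
      unfold G
      gcongr ?_⁻¹ * Real.exp ?_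
      · apply Real.sqrt_le_sqrt
        have := Real.pi_gt_three
        nlinarith
      · gcongr
        exact hx.1
    have e3 : x / (2 * s) ≤ a / s := by
      rw [div_le_div_iff₀ (by positivity) hs]
      nlinarith [hx.2]
    set r := a ^ 2 / s with hr
    have hr0 : 0 ≤ r := by positivity
    -- From `eˣ ≥ 1 + x + x²/2` at `x = r/4`: `32 (1 + r/4 + r²/32) = 32 + 8r + r²` exceeds `(1 +
    -- r)²`.
    have e4 : (1 + r) ^ 2 ≤ 32 * Real.exp (r / 4) := by
      have := Real.quadratic_le_exp_of_nonneg (x := r / 4) (by positivity)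
      nlinarith
    have e5 : a ^ 2 + s = s * (1 + r) := by rw [hr]; field_simp; ring
    have e6 : Real.sqrt (a ^ 2 + s) ≤ Real.sqrt s * (1 + r) := by
      rw [e5, Real.sqrt_mul hs.le]
      gcongr
      rw [Real.sqrt_le_left (by positivity)]
      nlinarith
    have e7 : Real.exp (-(a ^ 2) / (4 * s)) = (Real.exp (r / 4))⁻¹ := by
      rw [← Real.exp_neg, hr]; congr 1; field_simp
    have hA : 0 < a ^ 2 + s := by positivity
    rw [e1, Psi]
    calc x / (2 * s) * G s x ≤ a / s * ((Real.sqrt s)⁻¹ * Real.exp (-(a ^ 2) / (4 * s))) := by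
          gcongr
          exact G_nonneg _ _
      _ = a / (s * Real.sqrt s * Real.exp (r / 4)) := by rw [e7]; field_simp
      _ ≤ a / (s * Real.sqrt s * ((1 + r) ^ 2 / 32)) := by
          gcongr
          linarith
      _ = 32 * (a / ((s * (1 + r)) * (Real.sqrt s * (1 + r)))) := by field_simp
      _ ≤ 32 * (a / ((a ^ 2 + s) * Real.sqrt (a ^ 2 + s))) := by
          rw [← e5]
          gcongr
  have h2 := (convex_Icc a b).norm_image_sub_le_of_norm_hasDerivWithin_le
    (fun x _ => (hasDerivAt_G hs.ne' x).hasDerivWithinAt) h1 (left_mem_Icc.2 hab)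
    (right_mem_Icc.2 hab)
  rwa [Real.norm_eq_abs, Real.norm_eq_abs, abs_of_nonneg (sub_nonneg.2 hab)] at h2

theorem inv_one_add_sq_shift_le {y r : ℝ} (hr : |r| ≤ 1) :
    (1 + (y + r) ^ 2)⁻¹ ≤ 3 * (1 + y ^ 2)⁻¹ := by
  have hr2 : r ^ 2 ≤ 1 := by rw [← sq_abs]; nlinarith [abs_nonneg r]
  rw [← div_eq_mul_inv, inv_le_iff_one_le_mul₀ (by positivity), div_mul_eq_mul_div,
    le_div_iff₀ (by positivity)]
  nlinarith [sq_nonneg (y + 2 * r), sq_nonneg (2 * y + 3 * r)]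

/-- The symmetrised heat kernel varies little in its centre near `0`. -/
theorem exists_G_symm_bound {ε S : ℝ} (hε : 0 < ε) (hS : ε ≤ S) : ∃ C : ℝ, 0 ≤ C ∧
    ∀ s ∈ Icc ε S, ∀ a b, 0 ≤ a → a ≤ b → b ≤ 1 → ∀ y,
      |(G s (y - b) - G s (y - a)) + (G s (y + b) - G s (y + a))| ≤
        C * b * (b - a) * (1 + y ^ 2)⁻¹ := by
  obtain ⟨C, hC0, hC⟩ := exists_G_bound hε hS
  refine ⟨6 * C, by positivity, fun s hs a b ha hab hb y => ?_⟩
  have hs0 : 0 < s := hε.trans_le hs.1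
  set B := 3 * C * (1 + y ^ 2)⁻¹ with hB
  have hB0 : 0 ≤ B := by positivity
  have h2 : ∀ r ∈ Icc (-b) b, ‖G2 s (y + r)‖ ≤ B := by
    intro r hr
    refine (hC s hs (y + r)).2.2.1.trans ?_
    have hr1 : |r| ≤ 1 := abs_le.2 ⟨by linarith [hr.1], by linarith [hr.2]⟩
    calc C * (1 + (y + r) ^ 2)⁻¹ ≤ C * (3 * (1 + y ^ 2)⁻¹) := by
          gcongr; exact inv_one_add_sq_shift_le hr1
      _ = B := by rw [hB]; ring
  -- The `z`-derivative of the symmetrised kernel vanishes at `z = 0`, so a second mean value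
  -- estimate, now with `G2`, gains the factor `b`.
  have h1 : ∀ z ∈ Icc a b, ‖G1 s (y + z) - G1 s (y - z)‖ ≤ 2 * b * B := by
    intro z hz
    have h3 := (convex_Icc (-b) b).norm_image_sub_le_of_norm_hasDerivWithin_le
      (f := fun r => G1 s (y + r)) (fun r _ => by
        have := (hasDerivAt_G1 hs0.ne' (y + r)).comp_const_add y r
        exact this.hasDerivWithinAt) h2 (x := -z) (y := z)
        ⟨by linarith [hz.2], by linarith [hz.1, hz.2]⟩ ⟨by linarith [hz.1, hz.2], hz.2⟩
    refine h3.trans ?_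
    have : ‖z - -z‖ ≤ 2 * b := by
      rw [Real.norm_eq_abs, sub_neg_eq_add, abs_of_nonneg (by linarith [hz.1])]
      linarith [hz.2]
    rw [mul_comm]
    gcongr
  have h4 := (convex_Icc a b).norm_image_sub_le_of_norm_hasDerivWithin_le
    (f := fun z => G s (y - z) + G s (y + z)) (f' := fun z => G1 s (y + z) - G1 s (y - z))
    (fun z _ => by
      have e1 := (hasDerivAt_G hs0.ne' (y + z)).comp_const_add y z
      have e2 := (hasDerivAt_G hs0.ne' (y - z)).comp_const_sub y z
      exact ((e2.add e1).congr_deriv (by ring)).hasDerivWithinAt) h1 (left_mem_Icc.2 hab)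
    (right_mem_Icc.2 hab)
  rw [Real.norm_eq_abs, Real.norm_eq_abs, abs_of_nonneg (sub_nonneg.2 hab)] at h4
  calc _ = |G s (y - b) + G s (y + b) - (G s (y - a) + G s (y + a))| := by congr 1; ring
    _ ≤ _ := h4
    _ = _ := by rw [hB]; ring

theorem integral_G_one : ∫ y, G 1 y = 1 := by
  have h1 : ∀ y, G 1 y = (Real.sqrt (4 * Real.pi))⁻¹ * Real.exp (-(1 / 4) * y ^ 2) := by
    intro y; unfold G; rw [mul_one]; congr 2; ring
  simp_rw [h1]
  rw [integral_const_mul, integral_gaussian]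
  rw [show Real.pi / (1 / 4) = 4 * Real.pi by ring]
  exact inv_mul_cancel₀ (Real.sqrt_pos.2 (by positivity)).ne'

theorem integrable_G_one : Integrable (G 1) := by
  -- The integral of a non-integrable function is `0` by convention, which would contradict the
  -- value `1`.
  by_contra h
  have := integral_G_one
  rw [integral_undef h] at this
  exact zero_ne_one this

/-- The substitution `y = z + √s w` moves the dependence on `s` from the kernel into `g`, so that
the limit `s → 0⁺` is a matter of dominated convergence. -/
theorem integral_mul_G_eq (g : ℝ → ℝ) {s : ℝ} (hs : 0 < s) (z : ℝ) :
    ∫ y, g y * G s (y - z) = ∫ w, g (z + Real.sqrt s * w) * G 1 w := by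
  have hq : 0 < Real.sqrt s := Real.sqrt_pos.2 hs
  have h1 := integral_add_right_eq_self (fun y => g y * G s (y - z)) z (μ := volume)
  have h2 := Measure.integral_comp_mul_left (fun y => g (y + z) * G s (y + z - z)) (Real.sqrt s)
  rw [h1] at h2
  have h3 : ∀ w, g (Real.sqrt s * w + z) * G s (Real.sqrt s * w + z - z) =
      (Real.sqrt s)⁻¹ * (g (z + Real.sqrt s * w) * G 1 w) := by
    intro w
    have h4 : G s (Real.sqrt s * w) = (Real.sqrt s)⁻¹ * G 1 w := by
      unfold G
      rw [Real.sqrt_mul (by positivity), mul_one, mul_pow, Real.sq_sqrt hs.le]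
      have : -(s * w ^ 2) / (4 * s) = -(w ^ 2) / (4 * 1) := by field_simp
      rw [this]
      field_simp
    rw [add_sub_cancel_right, h4, add_comm z]
    ring
  simp_rw [h3] at h2
  rw [integral_const_mul, abs_of_pos (inv_pos.2 hq), smul_eq_mul] at h2
  exact (mul_left_cancel₀ (inv_pos.2 hq).ne' h2).symm

theorem tendsto_integral_mul_G {g : ℝ → ℝ} (hc : Continuous g) {B : ℝ} (hB : ∀ y, |g y| ≤ B)
    (z : ℝ) : Tendsto (fun s => ∫ y, g y * G s (y - z)) (𝓝[>] 0) (𝓝 (g z)) := by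
  have h1 : Tendsto (fun s => ∫ w, g (z + Real.sqrt s * w) * G 1 w) (𝓝[>] 0)
      (𝓝 (∫ w, g z * G 1 w)) := by
    refine tendsto_integral_filter_of_dominated_convergence (fun w => B * G 1 w) ?_ ?_ ?_ ?_
    · exact Eventually.of_forall fun s => ((hc.comp (by fun_prop)).mul
        (continuous_G one_ne_zero)).aestronglyMeasurable
    · refine Eventually.of_forall fun s => ae_of_all _ fun w => ?_
      rw [norm_mul, Real.norm_of_nonneg (G_nonneg _ _)]
      exact mul_le_mul_of_nonneg_right (hB _) (G_nonneg _ _)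
    · exact integrable_G_one.const_mul B
    · refine ae_of_all _ fun w => ?_
      refine Tendsto.mul_const _ ?_
      have : Continuous fun s : ℝ => g (z + Real.sqrt s * w) := hc.comp (by fun_prop)
      have h2 := this.tendsto 0
      simp only [Real.sqrt_zero, zero_mul, add_zero] at h2
      exact h2.mono_left nhdsWithin_le_nhds
  rw [integral_const_mul, integral_G_one, mul_one] at h1
  refine h1.congr' ?_
  filter_upwards [self_mem_nhdsWithin] with s hs
  exact (integral_mul_G_eq g hs z).symm

theorem hasDerivAt_integral_G {g : ℝ → ℝ} (hg : MemLp g 2) (z : ℝ) {s : ℝ} (hs : 0 < s) :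
    HasDerivAt (fun s => ∫ y, g y * G s (y - z)) (∫ y, g y * G2 s (y - z)) s := by
  obtain ⟨C, hC0, hC⟩ := exists_G_bound (ε := s / 2) (S := 2 * s) (by positivity) (by linarith)
  have hball : Metric.ball s (s / 2) ⊆ Icc (s / 2) (2 * s) := by
    rw [Real.ball_eq_Ioo]
    exact fun x hx => ⟨by linarith [hx.1], by linarith [hx.2]⟩
  refine (hasDerivAt_integral_of_dominated_loc_of_deriv_le (s := Metric.ball s (s / 2))
    (bound := fun y => |g y| * (C * (1 + (y - z) ^ 2)⁻¹)) (F := fun s y => g y * G s (y - z))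
    (F' := fun s y => g y * G2 s (y - z))
    (Metric.ball_mem_nhds s (by positivity)) ?_ ?_ ?_ ?_ ?_ ?_).2
  · filter_upwards [lt_mem_nhds hs] with x hx
    exact (MemLp.integrable_mul_real hg (memLp_G hx z)).aestronglyMeasurable
  · exact MemLp.integrable_mul_real hg (memLp_G hs z)
  · exact (MemLp.integrable_mul_real hg (memLp_G2 hs z)).aestronglyMeasurable
  · refine ae_of_all _ fun y x hx => ?_
    rw [norm_mul, Real.norm_eq_abs]
    gcongr
    exact (hC x (hball hx) _).2.2.1
  · exact MemLp.integrable_mul_real hg.norm ((memLp_inv_one_add_sq_shift z).const_mul C)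
  · refine ae_of_all _ fun y x hx => ?_
    exact (hasDerivAt_G_time (lt_of_lt_of_le (by positivity) (hball hx).1) _).const_mul _

/-- The heat kernel is Lipschitz in time, for the norm of `H¹(ℝ)`. -/
theorem exists_G_lipschitz {ε S : ℝ} (hε : 0 < ε) (hS : ε ≤ S) : ∃ L : ℝ, 0 ≤ L ∧
    ∀ s ∈ Icc ε S, ∀ r ∈ Icc ε S, ∀ z, (∫ y, (G s (y - z) - G r (y - z)) ^ 2) +
      (∫ y, (G1 s (y - z) - G1 r (y - z)) ^ 2) ≤ (L * |s - r|) ^ 2 := by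
  obtain ⟨C, hC0, hC⟩ := exists_G_bound hε hS
  set J := ∫ y : ℝ, ((1 + y ^ 2)⁻¹) ^ 2 with hJ
  have hJ0 : 0 ≤ J := integral_nonneg fun y => by positivity
  have hJz : ∀ z, ∫ y : ℝ, ((1 + (y - z) ^ 2)⁻¹) ^ 2 = J := fun z =>
    integral_sub_right_eq_self (fun y : ℝ => ((1 + y ^ 2)⁻¹) ^ 2) z
  refine ⟨C * Real.sqrt (2 * J), by positivity, fun s hs r hr z => ?_⟩
  have hpos : ∀ x ∈ Icc ε S, 0 < x := fun x hx => hε.trans_le hx.1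
  -- Used twice: the time derivative of `G` is `G2` and that of `G1` is `G3`, both uniformly bounded
  -- on the time interval by the same square-integrable function.
  have key : ∀ (K K' : ℝ → ℝ → ℝ), (∀ x ∈ Icc ε S, ∀ y, HasDerivAt (fun s => K s y) (K' x y) x) →
      (∀ x ∈ Icc ε S, ∀ y, |K' x y| ≤ C * (1 + y ^ 2)⁻¹) →
      ∫ y, (K s (y - z) - K r (y - z)) ^ 2 ≤ C ^ 2 * |s - r| ^ 2 * J := by
    intro K K' hd hb
    rw [← hJz z, ← integral_const_mul]
    refine integral_mono_of_nonneg (ae_of_all _ fun y => sq_nonneg _)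
      ((memLp_two_iff_integrable_sq (memLp_inv_one_add_sq_shift z).1).1
        (memLp_inv_one_add_sq_shift z) |>.const_mul _) (ae_of_all _ fun y => ?_)
    have h1 := (convex_Icc ε S).norm_image_sub_le_of_norm_hasDerivWithin_le
      (f := fun s => K s (y - z)) (fun x hx => (hd x hx (y - z)).hasDerivWithinAt)
      (fun x hx => hb x hx (y - z)) hr hs
    simp only [Real.norm_eq_abs] at h1
    have h2 := pow_le_pow_left₀ (abs_nonneg _) h1 2
    rw [sq_abs] at h2
    refine h2.trans (le_of_eq ?_)
    ring
  have k1 := key G G2 (fun x hx y => hasDerivAt_G_time (hpos x hx) y)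
    (fun x hx y => (hC x hx y).2.2.1)
  have k2 := key G1 G3 (fun x hx y => hasDerivAt_G1_time (hpos x hx) y)
    (fun x hx y => (hC x hx y).2.2.2)
  have h3 : (C * Real.sqrt (2 * J) * |s - r|) ^ 2 = C ^ 2 * |s - r| ^ 2 * J +
      C ^ 2 * |s - r| ^ 2 * J := by
    rw [mul_pow, mul_pow, Real.sq_sqrt (by positivity)]; ring
  rw [h3]
  exact add_le_add k1 k2

theorem tendsto_inv_one_add_sq_shift (z : ℝ) {l : Filter ℝ} (hl : Tendsto (fun y => |y|) l atTop) :
    Tendsto (fun y : ℝ => (1 + (y - z) ^ 2)⁻¹) l (𝓝 0) := by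
  refine tendsto_inv_atTop_zero.comp (tendsto_atTop_mono (f := fun y => |y| - |z|) (fun y => ?_)
    (tendsto_atTop_add_const_right _ _ hl))
  have h1 := abs_sub_abs_le_abs_sub y z
  nlinarith [sq_abs (y - z), sq_nonneg (|y - z| - 1), abs_nonneg (y - z)]

/-- Integration by parts on the line. -/
theorem IsPrim.integral_mul_eq_neg {g g' ψ ψ' : ℝ → ℝ} (hg : IsPrim g g') (hψ : IsPrim ψ ψ')
    (h1 : Integrable fun y => g y * ψ' y) (h2 : Integrable fun y => g' y * ψ y)
    (hbot : Tendsto (fun y => g y * ψ y) atBot (𝓝 0))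
    (htop : Tendsto (fun y => g y * ψ y) atTop (𝓝 0)) :
    ∫ y, g y * ψ' y = - ∫ y, g' y * ψ y := by
  have e1 := intervalIntegral_tendsto_integral h1 tendsto_neg_atTop_atBot tendsto_id
  have e2 := intervalIntegral_tendsto_integral h2 tendsto_neg_atTop_atBot tendsto_id
  have e3 := ((htop.comp tendsto_id).sub (hbot.comp tendsto_neg_atTop_atBot)).sub e2
  rw [sub_zero, zero_sub] at e3
  refine tendsto_nhds_unique e1 (e3.congr fun x => ?_)
  exact (hg.integral_mul_eq hψ _ _).symm

theorem tendsto_mul_of_bound {g ψ : ℝ → ℝ} {B C z : ℝ} (hB : ∀ y, |g y| ≤ B)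
    (hC : ∀ y, |ψ y| ≤ C * (1 + (y - z) ^ 2)⁻¹) {l : Filter ℝ}
    (hl : Tendsto (fun y => |y|) l atTop) : Tendsto (fun y => g y * ψ y) l (𝓝 0) := by
  have h1 := ((tendsto_inv_one_add_sq_shift z hl).const_mul (B * C))
  rw [mul_zero] at h1
  refine squeeze_zero_norm (fun y => ?_) h1
  rw [norm_mul, Real.norm_eq_abs, Real.norm_eq_abs, mul_assoc]
  exact mul_le_mul (hB y) (hC y) (abs_nonneg _) ((abs_nonneg _).trans (hB y))

theorem IsPrim.integral_mul_G2 {g g' : ℝ → ℝ} (hg : IsPrim g g') (h1 : MemLp g 2)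
    (h2 : MemLp g' 2) {B : ℝ} (hB : ∀ y, |g y| ≤ B) {s : ℝ} (hs : 0 < s) (z : ℝ) :
    ∫ y, g y * G2 s (y - z) = - ∫ y, g' y * G1 s (y - z) := by
  obtain ⟨C, -, hC⟩ := exists_G_bound hs le_rfl
  have hb : ∀ y, |G1 s (y - z)| ≤ C * (1 + (y - z) ^ 2)⁻¹ := fun y =>
    (hC s ⟨le_rfl, le_rfl⟩ _).2.1
  refine hg.integral_mul_eq_neg (isPrim_of_hasDerivAt (fun y => ?_)
      (continuous_shift (continuous_G2 hs.ne') z))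
    (MemLp.integrable_mul_real h1 (memLp_G2 hs z)) (MemLp.integrable_mul_real h2 (memLp_G1 hs z))
    (tendsto_mul_of_bound hB hb tendsto_abs_atBot_atTop)
    (tendsto_mul_of_bound hB hb tendsto_abs_atTop_atTop)
  exact (hasDerivAt_G1 hs.ne' (y - z)).comp_sub_const y z

/-- The Sobolev inequality `sup |g|² ≤ 2 (‖g‖² + ‖g'‖²)`. -/
theorem IsPrim.sq_le {g g' : ℝ → ℝ} (hg : IsPrim g g') (h1 : MemLp g 2) (h2 : MemLp g' 2)
    (x : ℝ) : g x ^ 2 ≤ 2 * ((∫ y, g y ^ 2) + ∫ y, g' y ^ 2) := by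
  have i1 := (memLp_two_iff_integrable_sq h1.1).1 h1
  have i2 := (memLp_two_iff_integrable_sq h2.1).1 h2
  set I := ∫ y, g y ^ 2 with hI
  set I' := ∫ y, g' y ^ 2 with hI'
  have hI0 : 0 ≤ I := integral_nonneg fun y => sq_nonneg _
  have hI0' : 0 ≤ I' := integral_nonneg fun y => sq_nonneg _
  -- The increment of `g²` is the integral of `2 g g'`, and `2|g g'| ≤ g² + g'²`. Averaging over `y`
  -- in the unit interval then bounds `g x ^ 2`.
  have h3 : ∀ y ∈ Icc x (x + 1), g x ^ 2 - (I + I') ≤ g y ^ 2 := by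
    intro y hy
    have h4 := (hg.mul hg).sub x y
    have h5 : |∫ t in x..y, (g' t * g t + g t * g' t)| ≤ I + I' := by
      rw [hI, hI', ← integral_add i1 i2, ← Real.norm_eq_abs]
      refine (intervalIntegral.norm_integral_le_integral_norm hy.1).trans ?_
      rw [intervalIntegral.integral_of_le hy.1]
      refine (setIntegral_mono_on_ae ?_ (i1.add i2).integrableOn measurableSet_Ioc
        (ae_of_all _ fun t _ => ?_)).trans (setIntegral_le_integral (i1.add i2)
          (ae_of_all _ fun t => add_nonneg (sq_nonneg _) (sq_nonneg _)))
      · exact ((MemLp.integrable_mul_real h2 h1).add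
          (MemLp.integrable_mul_real h1 h2)).norm.integrableOn
      · rw [Real.norm_eq_abs, Pi.add_apply, abs_le]
        constructor <;> nlinarith [sq_nonneg (g t + g' t), sq_nonneg (g t - g' t)]
    rw [← h4] at h5
    have := (abs_le.1 h5).1
    nlinarith
  have h6 : ∫ y in Ioc x (x + 1), (g x ^ 2 - (I + I')) ≤ ∫ y in Ioc x (x + 1), g y ^ 2 :=
    setIntegral_mono_on_ae (integrableOn_const (by simp)) i1.integrableOn measurableSet_Ioc
      (ae_of_all _ fun y hy => h3 y (Ioc_subset_Icc_self hy))
  have h7 : ∫ y in Ioc x (x + 1), g y ^ 2 ≤ I :=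
    setIntegral_le_integral i1 (ae_of_all _ fun t => sq_nonneg _)
  rw [setIntegral_const] at h6
  simp at h6
  linarith

/-! ### The function `e^{-|y|}`, whose second derivative is `e^{-|y|} - 2δ` -/

/-- The function `e^{-|y|}`. -/
noncomputable def E (y : ℝ) : ℝ := Real.exp (-|y|)

theorem continuous_E : Continuous E := by unfold E; fun_prop

theorem E_neg (y : ℝ) : E (-y) = E y := by simp [E]

theorem E_pos (y : ℝ) : 0 < E y := Real.exp_pos _

theorem E_le_one (y : ℝ) : |E y| ≤ 1 := by
  rw [abs_of_pos (E_pos y), E]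
  exact Real.exp_le_one_iff.2 (by simp)

theorem memLp_E : MemLp E 2 := by
  refine memLp_of_bound (C := 2) (z := 0) continuous_E fun y => ?_
  rw [abs_of_pos (E_pos y), E, sub_zero, Real.exp_neg, ← div_eq_mul_inv,
    inv_le_comm₀ (Real.exp_pos _) (by positivity), inv_div]
  have := Real.quadratic_le_exp_of_nonneg (abs_nonneg y)
  nlinarith [sq_abs y, abs_nonneg y]

/-- The identity `E'' = E - 2δ` tested on the kernel. On each half-line the integrand `E (G2 - G)`
has an explicit antiderivative, `e^{-y}(G1 + G)` or `e^{y}(G1 - G)`; the `G1` terms at `0` cancel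
and the `G` terms add up. -/
theorem integral_E_mul_G2 {s : ℝ} (hs : 0 < s) (z : ℝ) :
    ∫ y, E y * G2 s (y - z) = (∫ y, E y * G s (y - z)) - 2 * G s z := by
  obtain ⟨C, -, hC⟩ := exists_G_bound hs le_rfl
  have hC0 := fun y => (hC s ⟨le_rfl, le_rfl⟩ (y - z)).1
  have hC1 := fun y => (hC s ⟨le_rfl, le_rfl⟩ (y - z)).2.1
  have dG : ∀ y, HasDerivAt (fun y => G s (y - z)) (G1 s (y - z)) y := fun y =>
    (hasDerivAt_G hs.ne' (y - z)).comp_sub_const y z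
  have dG1 : ∀ y, HasDerivAt (fun y => G1 s (y - z)) (G2 s (y - z)) y := fun y =>
    (hasDerivAt_G1 hs.ne' (y - z)).comp_sub_const y z
  have i0 : Integrable fun y => E y * G s (y - z) := MemLp.integrable_mul_real memLp_E (memLp_G hs z)
  have i2 : Integrable fun y => E y * G2 s (y - z) :=
    MemLp.integrable_mul_real memLp_E (memLp_G2 hs z)
  have i : Integrable fun y => E y * (G2 s (y - z) - G s (y - z)) := by
    simp only [mul_sub]
    exact i2.sub i0
  have key : ∫ y, E y * (G2 s (y - z) - G s (y - z)) = -2 * G s z := by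
    rw [← intervalIntegral.integral_Iic_add_Ioi (b := 0) i.integrableOn i.integrableOn]
    have hp : ∫ y in Ioi (0 : ℝ), E y * (G2 s (y - z) - G s (y - z)) =
        0 - Real.exp (-0) * (G1 s (0 - z) + G s (0 - z)) := by
      have hE : ∀ y ∈ Ioi (0 : ℝ), E y * (G2 s (y - z) - G s (y - z)) =
          Real.exp (-y) * (G2 s (y - z) - G s (y - z)) := fun y hy => by
        rw [E, abs_of_pos hy]
      rw [setIntegral_congr_fun measurableSet_Ioi hE]
      refine integral_Ioi_of_hasDerivAt_of_tendsto'
        (f := fun y => Real.exp (-y) * (G1 s (y - z) + G s (y - z))) (fun y _ => ?_)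
        (i.integrableOn.congr_fun hE measurableSet_Ioi) ?_
      · refine ((hasDerivAt_neg y).exp.mul ((dG1 y).add (dG y))).congr_deriv ?_
        simp only [Pi.add_apply]
        ring
      · have h1 := (tendsto_mul_of_bound E_le_one hC1 tendsto_abs_atTop_atTop).add
          (tendsto_mul_of_bound E_le_one hC0 tendsto_abs_atTop_atTop)
        rw [add_zero] at h1
        refine h1.congr' ?_
        filter_upwards [eventually_ge_atTop 0] with y hy
        rw [E, abs_of_nonneg hy]; ring
    have hn : ∫ y in Iic (0 : ℝ), E y * (G2 s (y - z) - G s (y - z)) =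
        Real.exp 0 * (G1 s (0 - z) - G s (0 - z)) - 0 := by
      have hE : ∀ y ∈ Iic (0 : ℝ), E y * (G2 s (y - z) - G s (y - z)) =
          Real.exp y * (G2 s (y - z) - G s (y - z)) := fun y hy => by
        rw [E, abs_of_nonpos hy, neg_neg]
      rw [setIntegral_congr_fun measurableSet_Iic hE]
      refine integral_Iic_of_hasDerivAt_of_tendsto'
        (f := fun y => Real.exp y * (G1 s (y - z) - G s (y - z))) (fun y _ => ?_)
        (i.integrableOn.congr_fun hE measurableSet_Iic) ?_
      · refine ((Real.hasDerivAt_exp y).mul ((dG1 y).sub (dG y))).congr_deriv ?_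
        simp only [Pi.sub_apply]
        ring
      · have h1 := (tendsto_mul_of_bound E_le_one hC1 tendsto_abs_atBot_atTop).sub
          (tendsto_mul_of_bound E_le_one hC0 tendsto_abs_atBot_atTop)
        rw [sub_zero] at h1
        refine h1.congr' ?_
        filter_upwards [eventually_le_atBot 0] with y hy
        rw [E, abs_of_nonpos hy, neg_neg]; ring
    rw [hp, hn, zero_sub z, G_neg]
    simp
    ring
  have h5 : ∫ y, E y * (G2 s (y - z) - G s (y - z)) =
      (∫ y, E y * G2 s (y - z)) - ∫ y, E y * G s (y - z) := by
    rw [← integral_sub i2 i0]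
    simp only [mul_sub]
  linarith

/-! ### Absolutely continuous functions with values in a dual space -/

theorem absolutelyContinuous_apply {X : Type*} [NormedAddCommGroup X] [NormedSpace ℝ X]
    {A : ℝ → StrongDual ℝ X} {φ : ℝ → X} {a b : ℝ} (hA : AbsolutelyContinuousOnInterval A a b)
    (hφ : AbsolutelyContinuousOnInterval φ a b) :
    AbsolutelyContinuousOnInterval (fun t => A t (φ t)) a b := by
  obtain ⟨C, hC⟩ := hA.exists_bound
  obtain ⟨D, hD⟩ := hφ.exists_bound
  have h0 : Tendsto (fun E : ℕ × (ℕ → ℝ × ℝ) =>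
      C * ∑ i ∈ Finset.range E.1, dist (φ (E.2 i).1) (φ (E.2 i).2) +
        D * ∑ i ∈ Finset.range E.1, dist (A (E.2 i).1) (A (E.2 i).2))
      (AbsolutelyContinuousOnInterval.totalLengthFilter ⊓
        𝓟 (AbsolutelyContinuousOnInterval.disjWithin a b)) (𝓝 0) := by
    unfold AbsolutelyContinuousOnInterval at hA hφ
    simpa using (hφ.const_mul C).add (hA.const_mul D)
  refine squeeze_zero' (Eventually.of_forall fun _ => Finset.sum_nonneg fun i _ => dist_nonneg)
    ?_ h0
  rw [eventually_inf_principal]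
  filter_upwards with E hE
  simp only [Finset.mul_sum, ← Finset.sum_add_distrib]
  refine Finset.sum_le_sum fun i hi => ?_
  set s := (E.2 i).1
  set t := (E.2 i).2
  have hs := hE.1 i hi
  -- The product rule for increments: each part is a bounded factor times the increment of the
  -- other.
  have e1 : A s (φ s) - A t (φ t) = A s (φ s - φ t) + (A s - A t) (φ t) := by
    simp only [map_sub, sub_apply]; ring
  rw [dist_eq_norm, dist_eq_norm, dist_eq_norm, e1]
  refine (norm_add_le _ _).trans (add_le_add ?_ ?_)
  · exact ((A s).le_opNorm _).trans (by gcongr; exact hC _ hs.1)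
  · rw [mul_comm]
    exact ((A s - A t).le_opNorm _).trans (by gcongr; exact hD _ hs.2)

/-- Subtracting `A t` before applying makes continuity of `φ` at `t` sufficient: the difference
quotient of `A` converges in norm and is evaluated at `φ s → φ t`. -/
theorem hasDerivAt_sub_apply {X : Type*} [NormedAddCommGroup X] [NormedSpace ℝ X]
    {A : ℝ → StrongDual ℝ X} {F : StrongDual ℝ X} {φ : ℝ → X} {t : ℝ} (hA : HasDerivAt A F t)
    (hφ : ContinuousAt φ t) : HasDerivAt (fun s => (A s - A t) (φ s)) (F (φ t)) t := by
  rw [hasDerivAt_iff_tendsto_slope]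
  have hA := hasDerivAt_iff_tendsto_slope.1 hA
  have h1 := isBoundedBilinearMap_apply (𝕜 := ℝ) (E := X) (F := ℝ)
  have h2 := (h1.continuous.tendsto (F, φ t)).comp
    (hA.prodMk_nhds (hφ.tendsto.mono_left nhdsWithin_le_nhds))
  refine h2.congr fun s => ?_
  simp [slope_def_module]

theorem exists_bound_of_absolutelyContinuous {X : Type*} [NormedAddCommGroup X]
    [NormedSpace ℝ X] {A : ℝ → StrongDual ℝ X} {a b : ℝ}
    (hA : AbsolutelyContinuousOnInterval A a b) : ∃ C, ∀ x ∈ uIcc a b, ‖A x‖ ≤ C :=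
  hA.exists_bound

/-- The derivative of an absolutely continuous map is dominated by an integrable function. -/
theorem exists_integrable_bound_deriv {X : Type*} [NormedAddCommGroup X] [NormedSpace ℝ X]
    {A : ℝ → StrongDual ℝ X} {T : ℝ} (hT : 0 < T) (hA : AbsolutelyContinuousOnInterval A 0 T) :
    ∃ v : ℝ → ℝ, IntegrableOn v (Ioo 0 T) ∧
      ∀ᵐ t ∂(volume.restrict (Ioo 0 T)), ∀ F, HasDerivAt A F t → ‖F‖ ≤ v t := by
  have hbv := hA.boundedVariationOn
  rw [uIcc_of_le hT.le] at hbv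
  have hl := hbv.locallyBoundedVariationOn
  have h0 : (0 : ℝ) ∈ Icc 0 T := ⟨le_rfl, hT.le⟩
  -- The variation of `A` from `0` is monotone, so it has an a.e. derivative that is integrable, and
  -- its increments dominate those of `A`.
  set V := variationOnFromTo A (Icc 0 T) 0 with hV
  have hmono : MonotoneOn V (Icc 0 T) := variationOnFromTo.monotoneOn hl h0
  refine ⟨deriv V, ?_, ?_⟩
  · have := MonotoneOn.intervalIntegrable_deriv (f := V) (a := 0) (b := T)
      (by rwa [uIcc_of_le hT.le])
    exact ((intervalIntegrable_iff_integrableOn_Ioc_of_le hT.le).1 this).mono_set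
      Ioo_subset_Ioc_self
  · rw [ae_restrict_iff' measurableSet_Ioo]
    filter_upwards [hmono.ae_differentiableWithinAt_of_mem] with t ht htT F hF
    have hd : HasDerivAt V (deriv V t) t :=
      ((ht (Ioo_subset_Icc_self htT)).differentiableAt (Icc_mem_nhds htT.1 htT.2)).hasDerivAt
    rw [hasDerivAt_iff_tendsto_slope] at hd
    have hF := hasDerivAt_iff_tendsto_slope.1 hF
    have hgt : 𝓝[>] t ≤ 𝓝[≠] t := nhdsWithin_mono _ fun x (hx : t < x) => hx.ne'
    refine le_of_tendsto_of_tendsto (hF.mono_left hgt).norm (hd.mono_left hgt) ?_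
    filter_upwards [Ioo_mem_nhdsGT htT.2] with s hs
    have hts : t ∈ Icc 0 T := Ioo_subset_Icc_self htT
    have hss : s ∈ Icc 0 T := ⟨htT.1.le.trans hs.1.le, hs.2.le⟩
    have h1 : ‖A s - A t‖ ≤ V s - V t := by
      have h2 := variationOnFromTo.add hl h0 hts hss
      have h3 : V s - V t = variationOnFromTo A (Icc 0 T) t s := by rw [hV]; linarith
      rw [h3, variationOnFromTo.eq_of_le _ _ hs.1.le, ← dist_eq_norm, dist_edist]
      refine ENNReal.toReal_mono (hl t s hts hss) (eVariationOn.edist_le A ?_ ?_)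
      · exact ⟨hss, hs.1.le, le_rfl⟩
      · exact ⟨hts, le_rfl, hs.1.le⟩
    rw [slope_def_module, slope_def_field, norm_smul, norm_inv, Real.norm_eq_abs,
      abs_of_pos (sub_pos.2 hs.1), div_eq_inv_mul]
    exact mul_le_mul_of_nonneg_left h1 (inv_nonneg.2 (sub_pos.2 hs.1).le)

/-! ### Estimates for solutions -/

theorem abs_integral_pot_le (h : Admissible ρ k γ) {M : ℝ}
    (hM : ∀ᵐ x : ℝ, |pot ρ k γ x| ≤ M) (a b : L2rho ρ) :
    |∫ x, pot ρ k γ x * a x * b x ∂(rhoMeasure ρ)| ≤ M * (‖a‖ * ‖b‖) := by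
  have hM0 : 0 ≤ M := by
    obtain ⟨x, hx⟩ := hM.exists
    exact (abs_nonneg _).trans hx
  have hM' : ∀ᵐ x ∂(rhoMeasure ρ), |pot ρ k γ x| ≤ M := by rwa [h.ae_rhoMeasure]
  have hin : Integrable (fun x => |a x| * |b x|) (rhoMeasure ρ) :=
    MemLp.integrable_mul (Lp.memLp a).norm (Lp.memLp b).norm
  have h1 : ∫ x, |a x| * |b x| ∂(rhoMeasure ρ) ≤ ‖a‖ * ‖b‖ := by
    have h2 := real_inner_le_norm (|a| : L2rho ρ) |b|
    rw [norm_abs_eq_norm, norm_abs_eq_norm, L2.inner_def] at h2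
    refine le_trans (le_of_eq ?_) h2
    refine integral_congr_ae ?_
    filter_upwards [Lp.coeFn_abs a, Lp.coeFn_abs b] with x hx1 hx2
    rw [hx1, hx2]
    simp [mul_comm]
  rw [← Real.norm_eq_abs]
  refine (norm_integral_le_of_norm_le (hin.const_mul M) ?_).trans ?_
  · filter_upwards [hM'] with x hx
    rw [norm_mul, norm_mul, mul_assoc, Real.norm_eq_abs, Real.norm_eq_abs, Real.norm_eq_abs]
    gcongr
  · rw [integral_const_mul]
    gcongr

/-- The Sobolev inequality for the lift at `0`, that is, `δ ∈ ℍ⁻¹`. -/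
theorem abs_valueAtZero_le (h : Admissible ρ k γ) (φ : H1 ρ k) :
    |valueAtZero (fn φ)| ≤ Real.sqrt 2 / mul4 ρ k 0 * ‖φ‖ := by
  obtain ⟨g, g', hl, hp⟩ := exists_isLift h φ
  have h1 := hp.sq_le (hl.memLp_fst h) (hl.memLp_snd h) 0
  rw [← hl.norm_sq h] at h1
  have hm := h.mul4_pos 0
  rw [hl.valueAtZero h hp.continuous, abs_div, abs_of_pos hm, div_mul_eq_mul_div]
  gcongr
  refine abs_le_of_sq_le_sq ?_ (by positivity)
  rw [mul_pow, Real.sq_sqrt zero_le_two]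
  exact h1

/-- Elliptic regularity by testing the equation with `f` itself: `‖𝔻f‖²` is expressed by `F f`, the
potential and the value at `0`. The mass term satisfies `‖f‖²_{L²} = ⟨⟨f, f⟩⟩ ≤ ‖f‖_{ℍ⁻¹} ‖f‖`, so
every term is linear in `‖f‖`, which is divided out. -/
theorem norm_le_of_eqRHS (h : Admissible ρ k γ) {M : ℝ}
    (hM : ∀ᵐ x : ℝ, |pot ρ k γ x| ≤ M) {c : ℝ} {f : H1 ρ k} {F : Hneg1 ρ k}
    (hF : EqRHS γ c f F) : ‖f‖ ≤ (1 + M) * ‖toHneg1 f‖ + ‖F‖ +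
      2 * Real.sqrt (ρ 0 * k 0) * (Real.sqrt 2 / mul4 ρ k 0) * |c| := by
  have hM0 : 0 ≤ M := by
    obtain ⟨x, hx⟩ := hM.exists
    exact (abs_nonneg _).trans hx
  rcases eq_or_lt_of_le (norm_nonneg f) with hf | hf
  · rw [← hf]
    have := h.mul4_pos 0
    positivity
  have h1 : ‖opD f‖ ^ 2 = ∫ x, opD f x * opD f x ∂(rhoMeasure ρ) := by
    rw [← real_inner_self_eq_norm_sq, L2.inner_def]
    exact integral_congr_ae (ae_of_all _ fun x => by simp [sq])
  have h2 : ‖fn f‖ ^ 2 = toHneg1 f f := by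
    rw [toHneg1_apply, ← real_inner_self_eq_norm_sq, L2.inner_def]
    exact integral_congr_ae (ae_of_all _ fun x => by simp [sq])
  have h3 : toHneg1 f f ≤ ‖toHneg1 f‖ * ‖f‖ :=
    (le_abs_self _).trans ((toHneg1 f).le_opNorm f)
  have h4 : |F f| ≤ ‖F‖ * ‖f‖ := F.le_opNorm f
  have h5 := abs_integral_pot_le h hM (fn f) (fn f)
  have h6 := abs_valueAtZero_le h f
  have h7 := hF f
  rw [← h1] at h7
  set N := ∫ x, pot ρ k γ x * fn f x * fn f x ∂(rhoMeasure ρ)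
  set v := valueAtZero (fn f)
  set P := 2 * Real.sqrt (ρ 0 * k 0) with hP
  have hP0 : 0 ≤ P := by positivity
  have h8 : |P * c * v| ≤ P * |c| * (Real.sqrt 2 / mul4 ρ k 0 * ‖f‖) := by
    rw [abs_mul, abs_mul, abs_of_nonneg hP0]
    gcongr
  have h9 : M * (‖fn f‖ * ‖fn f‖) ≤ M * (‖toHneg1 f‖ * ‖f‖) := by
    rw [← sq, h2]; gcongr
  have h10 : ‖f‖ * ‖f‖ = ‖fn f‖ ^ 2 + ‖opD f‖ ^ 2 := by rw [← sq, H1.norm_sq]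
  have h11 := (abs_le.1 h4).1
  have h12 := (abs_le.1 h5).1
  have h13 := (abs_le.1 h8).1
  refine le_of_mul_le_mul_right ?_ hf
  rw [h10]
  have : ((1 + M) * ‖toHneg1 f‖ + ‖F‖ + P * (Real.sqrt 2 / mul4 ρ k 0) * |c|) * ‖f‖ =
    ‖toHneg1 f‖ * ‖f‖ + M * (‖toHneg1 f‖ * ‖f‖) + ‖F‖ * ‖f‖ +
      P * |c| * (Real.sqrt 2 / mul4 ρ k 0 * ‖f‖) := by ring
  rw [this]
  linarith

theorem norm_fn_le (φ : H1 ρ k) : ‖fn φ‖ ≤ ‖φ‖ := by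
  refine abs_le_of_sq_le_sq' ?_ (norm_nonneg _) |>.2
  rw [H1.norm_sq]
  linarith [sq_nonneg ‖opD φ‖]

/-- A solution is integrable in time with values in `ℍ¹`. -/
theorem IsSolution.exists_bound (h : Admissible ρ k γ) {T : ℝ} (hT : 0 < T) {u : ℝ → ℝ}
    (hu : MemLp u ∞ (volume.restrict (Ioo 0 T))) {W0 : H1 ρ k} {W : ℝ → H1 ρ k}
    (hW : IsSolution γ T u W0 W) : ∃ H : ℝ → ℝ, IntegrableOn H (Ioo 0 T) ∧
      ∀ᵐ t ∂(volume.restrict (Ioo 0 T)), ‖fn (W t)‖ ≤ H t := by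
  obtain ⟨M, hM0, hM⟩ := h.exists_pot_bound
  obtain ⟨v, hv, hvb⟩ := exists_integrable_bound_deriv hT hW.abs_cont
  obtain ⟨C, hC⟩ := exists_bound_of_absolutelyContinuous hW.abs_cont
  have hui : IntegrableOn u (Ioo 0 T) := hu.integrable le_top
  have hui' : IntegrableOn (fun t => |u t|) (Ioo 0 T) := hui.norm
  set K := 2 * Real.sqrt (ρ 0 * k 0) * (Real.sqrt 2 / mul4 ρ k 0)
  have hconst : IntegrableOn (fun _ : ℝ => (1 + M) * C) (Ioo 0 T) := integrableOn_const (by simp)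
  -- An explicit integrable majorant is used so that measurability of `t ↦ ‖fn (W t)‖` is never
  -- needed.
  refine ⟨fun t => (1 + M) * C + v t + K * |u t|, (hconst.add hv).add (hui'.const_mul K), ?_⟩
  filter_upwards [hvb, hW.equation, ae_restrict_mem measurableSet_Ioo] with t h1 h2 h3
  obtain ⟨F, hF, hE⟩ := h2
  have h4 : ‖toHneg1 (W t)‖ ≤ C :=
    hC t (by rw [uIcc_of_le hT.le]; exact Ioo_subset_Icc_self h3)
  have h5 := (norm_fn_le _).trans (norm_le_of_eqRHS h hM hE)
  have h6 := h1 F hF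
  have h7 : (1 + M) * ‖toHneg1 (W t)‖ ≤ (1 + M) * C :=
    mul_le_mul_of_nonneg_left h4 (by linarith)
  linarith

/-! ### Pairing a solution with backward heat kernels -/

theorem absolutelyContinuous_add_apply {X : Type*} [NormedAddCommGroup X] [NormedSpace ℝ X]
    {A : ℝ → StrongDual ℝ X} {φ : ℝ → X} {a b : ℝ} (e : StrongDual ℝ X)
    (hA : AbsolutelyContinuousOnInterval A a b) {L : ℝ} (hL : 0 ≤ L)
    (hφ : ∀ s ∈ uIcc a b, ∀ t ∈ uIcc a b, ‖φ s - φ t‖ ≤ L * |s - t|) :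
    AbsolutelyContinuousOnInterval (fun t => (A t + e) (φ t)) a b := by
  have h1 : AbsolutelyContinuousOnInterval (fun _ : ℝ => e) a b :=
    (LipschitzWith.const e).lipschitzOnWith.absolutelyContinuousOnInterval
  have h2 : AbsolutelyContinuousOnInterval φ a b := by
    have : LipschitzOnWith ⟨L, hL⟩ φ (uIcc a b) := by
      refine LipschitzOnWith.of_dist_le_mul fun s hs t ht => ?_
      rw [dist_eq_norm, Real.dist_eq]
      exact hφ s hs t ht
    exact this.absolutelyContinuousOnInterval
  exact absolutelyContinuous_apply (hA.fun_add h1) h2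

theorem continuousAt_of_lipschitz {X : Type*} [NormedAddCommGroup X] {φ : ℝ → X} {a b L : ℝ}
    (hφ : ∀ s ∈ Icc a b, ∀ t ∈ Icc a b, ‖φ s - φ t‖ ≤ L * |s - t|) {t : ℝ} (ht : t ∈ Ioo a b) :
    ContinuousAt φ t := by
  rw [ContinuousAt, tendsto_iff_norm_sub_tendsto_zero]
  have h1 : Tendsto (fun s : ℝ => L * |s - t|) (𝓝 t) (𝓝 0) := by
    have : Continuous fun s : ℝ => L * |s - t| := by fun_prop
    simpa using this.tendsto t
  refine squeeze_zero' (Eventually.of_forall fun _ => norm_nonneg _) ?_ h1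
  filter_upwards [Icc_mem_nhds ht.1 ht.2] with s hs
  exact hφ s hs t (Ioo_subset_Icc_self ht)

/-- An `L²` function `θ` of `y = σ(x)` as an element of `ℍ⁻¹`. -/
theorem exists_functional (h : Admissible ρ k γ) {θ : ℝ → ℝ} (hθ : MemLp θ 2) :
    ∃ e : Hneg1 ρ k, ∀ (φ : H1 ρ k) (ψ ψ' : ℝ → ℝ), IsLift φ ψ ψ' → e φ = ∫ y, θ y * ψ y := by
  obtain ⟨a, ha⟩ := IsTransf.exists_of_memLp h hθ
  refine ⟨(innerSL ℝ a).comp ((WithLp.fstL 2 ℝ (L2rho ρ) (L2rho ρ)).comp (H1 ρ k).subtypeL),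
    fun φ ψ ψ' hφ => ?_⟩
  change inner ℝ a (fn φ) = _
  rw [L2.inner_def, ← IsTransf.integral_mul h ha hφ.fst]
  exact integral_congr_ae (ae_of_all _ fun x => by simp [mul_comm])

theorem IsLift.toHneg1_apply (h : Admissible ρ k γ) {f φ : H1 ρ k} {g g' ψ ψ' : ℝ → ℝ}
    (hf : IsLift f g g') (hφ : IsLift φ ψ ψ') : toHneg1 f φ = ∫ y, g y * ψ y := by
  rw [HalfAxisHeat.toHneg1_apply, IsTransf.integral_mul h hf.fst hφ.fst]

/-- The lift of the translated heat kernel, and its regularity in time. -/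
theorem exists_kernel_lift (h : Admissible ρ k γ) {t0 ε : ℝ} (ht0 : 0 ≤ t0) (hε : 0 < ε) (z : ℝ) :
    ∃ (Φ : ℝ → H1 ρ k) (L : ℝ), 0 ≤ L ∧
      (∀ t ∈ Icc 0 t0, IsLift (Φ t) (fun y => G (t0 - t + ε) (y - z))
        (fun y => G1 (t0 - t + ε) (y - z))) ∧
      ∀ s ∈ Icc 0 t0, ∀ t ∈ Icc 0 t0, ‖Φ s - Φ t‖ ≤ L * |s - t| := by
  have hex : ∀ t : ℝ, ∃ φ : H1 ρ k, t ∈ Icc 0 t0 → IsLift φ (fun y => G (t0 - t + ε) (y - z))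
      (fun y => G1 (t0 - t + ε) (y - z)) := by
    intro t
    by_cases ht : t ∈ Icc 0 t0
    · have hs : 0 < t0 - t + ε := by linarith [ht.2]
      obtain ⟨φ, hφ⟩ := exists_of_isPrim h
        (fun y => (hasDerivAt_G hs.ne' (y - z)).comp_sub_const y z)
        (continuous_shift (continuous_G1 hs.ne') z) (memLp_G hs z) (memLp_G1 hs z)
      exact ⟨φ, fun _ => hφ⟩
    -- Outside `[0, t0]` a default value; the kernel time `t0 - t + ε` need not be positive there.
    · exact ⟨0, fun h1 => absurd h1 ht⟩
  choose Φ hΦ using hex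
  obtain ⟨L, hL0, hL⟩ := exists_G_lipschitz (ε := ε) (S := t0 + ε) hε (by linarith)
  refine ⟨Φ, L, hL0, hΦ, fun s hs t ht => ?_⟩
  have h1 := ((hΦ s hs).sub h (hΦ t ht)).norm_sq h
  have h2 := hL (t0 - s + ε) ⟨by linarith [hs.2], by linarith [hs.1]⟩ (t0 - t + ε)
    ⟨by linarith [ht.2], by linarith [ht.1]⟩ z
  rw [← h1] at h2
  have h3 : |t0 - s + ε - (t0 - t + ε)| = |s - t| := by
    rw [abs_sub_comm s t]; congr 1; ring
  rw [h3] at h2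
  exact (abs_le_of_sq_le_sq' h2 (by positivity)).2

/-- Integration by parts moves both derivatives onto the kernel. In the `δ` term, `√(ρk)(0) = m(0)²`
meets the value `G s z / m(0)` of the test function, which leaves the coefficient `2 m(0)`. -/
theorem EqRHS.apply_kernel (h : Admissible ρ k γ) {c : ℝ} {f : H1 ρ k} {F : Hneg1 ρ k}
    (hF : EqRHS γ c f F) {g g' : ℝ → ℝ} (hl : IsLift f g g') (hp : IsPrim g g')
    {s z : ℝ} (hs : 0 < s) {φ : H1 ρ k}
    (hφ : IsLift φ (fun y => G s (y - z)) (fun y => G1 s (y - z))) :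
    F φ = (∫ y, g y * G2 s (y - z)) - (∫ x, pot ρ k γ x * fn f x * fn φ x ∂(rhoMeasure ρ))
      - 2 * mul4 ρ k 0 * c * G s z := by
  have hB : ∀ y, |g y| ≤ Real.sqrt (2 * ((∫ y, g y ^ 2) + ∫ y, g' y ^ 2)) := fun y => by
    rw [← Real.sqrt_sq_eq_abs]
    exact Real.sqrt_le_sqrt (hp.sq_le (hl.memLp_fst h) (hl.memLp_snd h) y)
  have h1 := hF φ
  rw [IsTransf.integral_mul h hl.snd hφ.snd,
    hφ.valueAtZero h (continuous_shift (continuous_G hs.ne') z)] at h1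
  rw [h1, hp.integral_mul_G2 (hl.memLp_fst h) (hl.memLp_snd h) hB hs z, zero_sub, G_neg,
    mul_comm (ρ 0), ← mul4_sq]
  have := (h.mul4_pos 0).ne'
  field_simp

/-- The pairing of a solution with the backward heat kernel. -/
theorem IsSolution.exists_pairing (h : Admissible ρ k γ) {T : ℝ} {u : ℝ → ℝ} {W0 : H1 ρ k}
    {W : ℝ → H1 ρ k} (hW : IsSolution γ T u W0 W) {t0 ε : ℝ} (ht0 : 0 ≤ t0) (htT : t0 ≤ T)
    (hε : 0 < ε) (c z : ℝ) : ∃ (Φ : ℝ → H1 ρ k) (Λ : ℝ → ℝ),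
      AbsolutelyContinuousOnInterval Λ 0 t0 ∧
      (∀ t ∈ Icc 0 t0, IsLift (Φ t) (fun y => G (t0 - t + ε) (y - z))
        (fun y => G1 (t0 - t + ε) (y - z))) ∧
      (∀ t ∈ Icc 0 t0, ∀ g g' : ℝ → ℝ, IsLift (W t) g g' →
        Λ t = ∫ y, (g y + c * E y) * G (t0 - t + ε) (y - z)) ∧
      ∀ᵐ t ∂(volume.restrict (Ioo 0 T)), t < t0 → HasDerivAt Λ
        (-(∫ x, pot ρ k γ x * fn (W t) x * fn (Φ t) x ∂(rhoMeasure ρ))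
          - 2 * mul4 ρ k 0 * u t * G (t0 - t + ε) z
          - c * ((∫ y, E y * G (t0 - t + ε) (y - z)) - 2 * G (t0 - t + ε) z)) t := by
  obtain ⟨Φ, L, hL0, hΦ, hL⟩ := exists_kernel_lift h ht0 hε z
  have hcE : MemLp (fun y => c * E y) 2 := memLp_E.const_mul c
  obtain ⟨e, he⟩ := exists_functional h hcE
  have hval : ∀ τ, ∀ t ∈ Icc 0 t0, ∀ g g' : ℝ → ℝ, IsLift (W τ) g g' →
      (toHneg1 (W τ) + e) (Φ t) = ∫ y, (g y + c * E y) * G (t0 - t + ε) (y - z) := by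
    intro τ t ht g g' hl
    have hs : 0 < t0 - t + ε := by linarith [ht.2]
    rw [add_apply, hl.toHneg1_apply h (hΦ t ht), he _ _ _ (hΦ t ht),
      ← integral_add (MemLp.integrable_mul_real (hl.memLp_fst h) (memLp_G hs z))
        (MemLp.integrable_mul_real hcE (memLp_G hs z))]
    simp only [add_mul]
  refine ⟨Φ, fun t => (toHneg1 (W t) + e) (Φ t), ?_, hΦ, fun t ht g g' hl => hval t t ht g g' hl,
    ?_⟩
  · refine absolutelyContinuous_add_apply e (hW.abs_cont.mono ?_) hL0 ?_
    · rw [uIcc_of_le ht0, uIcc_of_le (ht0.trans htT)]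
      exact Icc_subset_Icc_right htT
    · rw [uIcc_of_le ht0]; exact hL
  · filter_upwards [hW.equation, ae_restrict_mem measurableSet_Ioo] with t hFt htI htt0
    obtain ⟨F, hF, hE⟩ := hFt
    have htI' : t ∈ Ioo 0 t0 := ⟨htI.1, htt0⟩
    have htc : t ∈ Icc 0 t0 := Ioo_subset_Icc_self htI'
    have hs : 0 < t0 - t + ε := by linarith
    obtain ⟨g, g', hl, hp⟩ := exists_isLift h (W t)
    have hg2 : MemLp (fun y => g y + c * E y) 2 := (hl.memLp_fst h).add hcE
    -- The pairing at `s` is split into `(A s - A t)(Φ s)`, differentiated by the equation, and the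
    -- pairing of the frozen `W t` with the moving kernel. The second part carries a minus sign
    -- because the kernel time decreases.
    have d1 := hasDerivAt_sub_apply hF (continuousAt_of_lipschitz hL htI')
    have d2 : HasDerivAt (fun s => (toHneg1 (W t) + e) (Φ s))
        (-(∫ y, (g y + c * E y) * G2 (t0 - t + ε) (y - z))) t := by
      have d3 : HasDerivAt (fun s : ℝ => t0 - s + ε) (-1) t :=
        ((hasDerivAt_id t).const_sub t0).add_const ε
      have d4 := (hasDerivAt_integral_G hg2 z hs).comp t d3
      rw [mul_neg_one] at d4
      refine d4.congr_of_eventuallyEq ?_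
      filter_upwards [Icc_mem_nhds htI'.1 htI'.2] with s hs'
      exact hval t s hs' g g' hl
    have d5 := d1.add d2
    refine (d5.congr_of_eventuallyEq (Eventually.of_forall fun s => ?_)).congr_deriv ?_
    · simp only [Pi.add_apply, add_apply, sub_apply]
      ring
    · rw [hE.apply_kernel h hl hp hs (hΦ t htc)]
      have e1 : ∫ y, (g y + c * E y) * G2 (t0 - t + ε) (y - z) =
          (∫ y, g y * G2 (t0 - t + ε) (y - z)) + c * ∫ y, E y * G2 (t0 - t + ε) (y - z) := by
        rw [← integral_const_mul, ← integral_add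
          (MemLp.integrable_mul_real (hl.memLp_fst h) (memLp_G2 hs z))
          ((MemLp.integrable_mul_real memLp_E (memLp_G2 hs z)).const_mul c)]
        congr 1
        funext y
        ring
      -- The integrals of `g` against `G2` from the equation and from the kernel cancel; those of
      -- `E` leave `E - 2δ`.
      rw [e1, integral_E_mul_G2 hs]
      ring

/-- The hypothesis gives measurability on the half-axis only; reflection and evenness give the other
half. -/
theorem Admissible.aestronglyMeasurable_pot (h : Admissible ρ k γ) :
    AEStronglyMeasurable (pot ρ k γ) volume := by
  have h1 : AEStronglyMeasurable (pot ρ k γ) (volume.restrict (Ioi 0)) := h.pot_bdd.1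
  have h2 : AEStronglyMeasurable (pot ρ k γ) (volume.restrict (Iio 0)) := by
    have h3 := (Measure.measurePreserving_neg (volume : Measure ℝ)).restrict_preimage
      (measurableSet_Ioi (a := (0 : ℝ)))
    have h4 : (Neg.neg : ℝ → ℝ) ⁻¹' Ioi 0 = Iio 0 := by ext x; simp
    rw [h4] at h3
    have h5 := h1.comp_quasiMeasurePreserving h3.quasiMeasurePreserving
    have h6 : pot ρ k γ ∘ (Neg.neg : ℝ → ℝ) = pot ρ k γ := funext h.pot_neg
    rwa [h6] at h5
  have h3 := aestronglyMeasurable_union_iff.2 ⟨h2, h1⟩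
  rwa [Iio_union_Ioi, Measure.restrict_eq_self_of_ae_mem] at h3
  simp [ae_iff, measure_singleton]

theorem Admissible.integrable_pot (h : Admissible ρ k γ) (a b : L2rho ρ) :
    Integrable (fun x => pot ρ k γ x * a x * b x) (rhoMeasure ρ) := by
  obtain ⟨M, -, hM⟩ := h.exists_pot_bound
  have hM' : ∀ᵐ x ∂(rhoMeasure ρ), ‖pot ρ k γ x‖ ≤ M := by rwa [h.ae_rhoMeasure]
  have hm : AEStronglyMeasurable (pot ρ k γ) (rhoMeasure ρ) :=
    h.aestronglyMeasurable_pot.mono_ac (withDensity_absolutelyContinuous _ _)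
  have h1 : Integrable (fun x => a x * b x) (rhoMeasure ρ) :=
    MemLp.integrable_mul (Lp.memLp a) (Lp.memLp b)
  simp only [mul_assoc]
  exact h1.bdd_mul hm hM'

theorem Admissible.integral_pot_sub (h : Admissible ρ k γ) (a : L2rho ρ) (φ θ : H1 ρ k) :
    (∫ x, pot ρ k γ x * a x * fn φ x ∂(rhoMeasure ρ))
      - (∫ x, pot ρ k γ x * a x * fn θ x ∂(rhoMeasure ρ)) =
    ∫ x, pot ρ k γ x * a x * fn (φ - θ) x ∂(rhoMeasure ρ) := by
  rw [← integral_sub (h.integrable_pot _ _) (h.integrable_pot _ _)]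
  refine integral_congr_ae ?_
  filter_upwards [Lp.coeFn_sub (fn φ) (fn θ)] with x hx
  have : fn (φ - θ) x = fn φ x - fn θ x := hx
  rw [this]
  ring

theorem Psi_anti {a s r : ℝ} (ha : 0 < a) (hs : 0 ≤ s) (hsr : s ≤ r) : Psi a r ≤ Psi a s := by
  unfold Psi
  have : 0 < Real.sqrt (a ^ 2 + s) := Real.sqrt_pos.2 (by positivity)
  have : 0 ≤ r := hs.trans hsr
  gcongr

/-- The weight that bounds the time derivative of the pairing. -/
noncomputable def weight (M e m u0 t0 a : ℝ) (H u : ℝ → ℝ) (t : ℝ) : ℝ :=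
  (M * H t + e) * (t0 - t) ^ (-(3 / 4) : ℝ) + 64 * m * (|u t - u0| * Psi a (t0 - t))

/-- The change of the pairing of a solution with a difference of heat kernels. -/
theorem IsSolution.difference_bound (h : Admissible ρ k γ) {T : ℝ} {u : ℝ → ℝ} {W0 : H1 ρ k}
    {W : ℝ → H1 ρ k} (hW : IsSolution γ T u W0 W) {M : ℝ} (hM : ∀ᵐ x : ℝ, |pot ρ k γ x| ≤ M)
    {H : ℝ → ℝ} (hH : ∀ᵐ t ∂(volume.restrict (Ioo 0 T)), ‖fn (W t)‖ ≤ H t)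
    {t0 t1 ε u0 : ℝ} (ht1 : 0 ≤ t1) (ht10 : t1 < t0) (htT : t0 ≤ T) (hε : 0 < ε)
    {aE : L2rho ρ} (haE : IsTransf ρ k aE E) {a b : ℝ} (ha : 0 < a) (hab : a ≤ b)
    (hb : b ≤ 2 * a) (hK : IntervalIntegrable
      (weight M (|u0 * mul4 ρ k 0| * ‖aE‖) (mul4 ρ k 0) u0 t0 a H u) volume t1 t0)
    {g0 g0' g1 g1' : ℝ → ℝ} (hl0 : IsLift (W t0) g0 g0') (hl1 : IsLift (W t1) g1 g1') :
    |(∫ y, (g0 y + u0 * mul4 ρ k 0 * E y) * G ε (y - b))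
        - ∫ y, (g0 y + u0 * mul4 ρ k 0 * E y) * G ε (y - a)| ≤
      |(∫ y, (g1 y + u0 * mul4 ρ k 0 * E y) * G (t0 - t1 + ε) (y - b))
        - ∫ y, (g1 y + u0 * mul4 ρ k 0 * E y) * G (t0 - t1 + ε) (y - a)| +
      (b - a) * ∫ t in t1..t0,
        weight M (|u0 * mul4 ρ k 0| * ‖aE‖) (mul4 ρ k 0) u0 t0 a H u t := by
  have hM0 : 0 ≤ M := by
    obtain ⟨x, hx⟩ := hM.exists
    exact (abs_nonneg _).trans hx
  set m := mul4 ρ k 0 with hm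
  have hm0 : 0 < m := h.mul4_pos 0
  set c := u0 * m with hc
  have ht00 : 0 ≤ t0 := ht1.trans ht10.le
  obtain ⟨Φa, Λa, hACa, hΦa, hva, hda⟩ := hW.exists_pairing h ht00 htT hε c a
  obtain ⟨Φb, Λb, hACb, hΦb, hvb, hdb⟩ := hW.exists_pairing h ht00 htT hε c b
  have m0 : t0 ∈ Icc 0 t0 := ⟨ht00, le_rfl⟩
  have m1 : t1 ∈ Icc 0 t0 := ⟨ht1, ht10.le⟩
  have e0 : Λb t0 - Λa t0 = (∫ y, (g0 y + c * E y) * G ε (y - b))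
      - ∫ y, (g0 y + c * E y) * G ε (y - a) := by
    rw [hva t0 m0 _ _ hl0, hvb t0 m0 _ _ hl0, sub_self, zero_add]
  have e1 : Λb t1 - Λa t1 = (∫ y, (g1 y + c * E y) * G (t0 - t1 + ε) (y - b))
      - ∫ y, (g1 y + c * E y) * G (t0 - t1 + ε) (y - a) := by
    rw [hva t1 m1 _ _ hl1, hvb t1 m1 _ _ hl1]
  have hAC : AbsolutelyContinuousOnInterval (fun t => Λb t - Λa t) t1 t0 := by
    refine (hACb.fun_sub hACa).mono ?_
    rw [uIcc_of_le ht00, uIcc_of_le ht10.le]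
    exact Icc_subset_Icc_left ht1
  have hFTC := hAC.integral_deriv_eq_sub
  have hbound : ∀ᵐ t : ℝ, t ∈ Ioc t1 t0 → ‖deriv (fun t => Λb t - Λa t) t‖ ≤
      (b - a) * weight M (|c| * ‖aE‖) m u0 t0 a H u t := by
    have hne : ∀ᵐ t : ℝ, t ≠ t0 := by simp [ae_iff, measure_singleton]
    filter_upwards [(ae_restrict_iff' measurableSet_Ioo).1 hda,
      (ae_restrict_iff' measurableSet_Ioo).1 hdb, (ae_restrict_iff' measurableSet_Ioo).1 hH, hne]
      with t h1 h2 h3 h4 ht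
    have htlt : t < t0 := lt_of_le_of_ne ht.2 h4
    have htpos : 0 < t := ht1.trans_lt ht.1
    have htI : t ∈ Ioo 0 T := ⟨htpos, htlt.trans_le htT⟩
    have htc : t ∈ Icc 0 t0 := ⟨htpos.le, ht.2⟩
    have hd := (h2 htI htlt).fun_sub (h1 htI htlt)
    have hHt := h3 htI
    have hr : 0 < t0 - t := sub_pos.2 htlt
    -- All majorants decrease in the kernel time, so they are evaluated at `t0 - t ≤ s`; the
    -- resulting `weight` does not depend on `ε`.
    set s := t0 - t + ε with hs
    have hs0 : 0 < s := by positivity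
    have hrs : t0 - t ≤ s := by linarith
    have hba : 0 ≤ b - a := sub_nonneg.2 hab
    have hlift := (hΦb t htc).sub h (hΦa t htc)
    have hpow : s ^ (-(3 / 4) : ℝ) ≤ (t0 - t) ^ (-(3 / 4) : ℝ) :=
      Real.rpow_le_rpow_of_nonpos hr hrs (by norm_num)
    have hpow0 : 0 ≤ (t0 - t) ^ (-(3 / 4) : ℝ) := Real.rpow_nonneg hr.le _
    have hnorm : ‖fn (Φb t - Φa t)‖ ≤ (b - a) * (t0 - t) ^ (-(3 / 4) : ℝ) := by
      have n1 := hlift.fst.norm_sq h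
      have n2 := integral_G_sub_sq_le hs0 a b
      rw [← n1, abs_of_nonneg hba] at n2
      refine (abs_le_of_sq_le_sq' n2 (mul_nonneg hba (Real.rpow_nonneg hs0.le _))).2.trans ?_
      exact mul_le_mul_of_nonneg_left hpow hba
    have hN := abs_integral_pot_le h hM (fn (W t)) (fn (Φb t - Φa t))
    rw [← h.integral_pot_sub] at hN
    have hE : |(∫ y, E y * G s (y - b)) - ∫ y, E y * G s (y - a)| ≤
        ‖aE‖ * ‖fn (Φb t - Φa t)‖ := by
      have n1 := IsTransf.integral_mul h haE hlift.fst
      have n2 := real_inner_le_norm aE (fn (Φb t - Φa t))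
      have n3 := abs_real_inner_le_norm aE (fn (Φb t - Φa t))
      have n4 : inner ℝ aE (fn (Φb t - Φa t)) =
          (∫ y, E y * G s (y - b)) - ∫ y, E y * G s (y - a) := by
        rw [← integral_sub (MemLp.integrable_mul_real memLp_E (memLp_G hs0 b))
          (MemLp.integrable_mul_real memLp_E (memLp_G hs0 a)), L2.inner_def]
        simp only [← mul_sub]
        rw [← n1]
        exact integral_congr_ae (ae_of_all _ fun x => by simp [mul_comm])
      rwa [n4] at n3
    have hG : |G s b - G s a| ≤ 32 * Psi a (t0 - t) * (b - a) := by
      refine (abs_G_sub_le hs0 ha hab hb).trans ?_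
      gcongr
      exact Psi_anti ha hr.le hrs
    rw [hd.deriv, Real.norm_eq_abs]
    set Nb := ∫ x, pot ρ k γ x * fn (W t) x * fn (Φb t) x ∂(rhoMeasure ρ)
    set Na := ∫ x, pot ρ k γ x * fn (W t) x * fn (Φa t) x ∂(rhoMeasure ρ)
    set Eb := ∫ y, E y * G s (y - b)
    set Ea := ∫ y, E y * G s (y - a)
    set X := fn (Φb t - Φa t)
    -- The choice `c = u0 m` makes the `δ` part of `E''` turn `u t` into `u t - u0`.
    have hsplit : -Nb - 2 * m * u t * G s b - c * (Eb - 2 * G s b)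
        - (-Na - 2 * m * u t * G s a - c * (Ea - 2 * G s a)) =
        -(Nb - Na) + (-(c * (Eb - Ea)) + -(2 * m * ((u t - u0) * (G s b - G s a)))) := by
      rw [hc]; ring
    rw [hsplit]
    have hX0 : 0 ≤ ‖X‖ := norm_nonneg _
    have hH0 : 0 ≤ H t := (norm_nonneg _).trans hHt
    calc _ ≤ |Nb - Na| + (|c * (Eb - Ea)| + |2 * m * ((u t - u0) * (G s b - G s a))|) := by
          refine (abs_add_le _ _).trans ?_
          rw [abs_neg]
          gcongr
          refine (abs_add_le _ _).trans ?_
          rw [abs_neg, abs_neg]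
      _ ≤ M * (H t * ((b - a) * (t0 - t) ^ (-(3 / 4) : ℝ))) +
          (|c| * (‖aE‖ * ((b - a) * (t0 - t) ^ (-(3 / 4) : ℝ))) +
            2 * m * (|u t - u0| * (32 * Psi a (t0 - t) * (b - a)))) := by
          refine add_le_add (hN.trans ?_) (add_le_add ?_ ?_)
          · gcongr
          · rw [abs_mul]
            gcongr
            exact hE.trans (by gcongr)
          · rw [abs_mul (2 * m), abs_mul (u t - u0), abs_of_pos (by positivity : 0 < 2 * m)]
            gcongr
      _ = _ := by unfold weight; ring
  have hint := intervalIntegral.norm_integral_le_of_norm_le ht10.le hbound (hK.const_mul (b - a))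
  rw [hFTC, intervalIntegral.integral_const_mul, Real.norm_eq_abs] at hint
  rw [e0, e1] at hint
  have := abs_sub_abs_le_abs_sub ((∫ y, (g0 y + c * E y) * G ε (y - b))
      - ∫ y, (g0 y + c * E y) * G ε (y - a))
      ((∫ y, (g1 y + c * E y) * G (t0 - t1 + ε) (y - b))
      - ∫ y, (g1 y + c * E y) * G (t0 - t1 + ε) (y - a))
  linarith

/-- Smoothing: the heat evolution of an even function has small slope near `0`. -/
theorem exists_even_bound {θ : ℝ → ℝ} (hθ : MemLp θ 2) (he : ∀ y, θ (-y) = θ y) {τ : ℝ}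
    (hτ : 0 < τ) : ∃ C : ℝ, 0 ≤ C ∧ ∀ s ∈ Icc τ (τ + 1), ∀ a b, 0 ≤ a → a ≤ b → b ≤ 1 →
      |(∫ y, θ y * G s (y - b)) - ∫ y, θ y * G s (y - a)| ≤ C * b * (b - a) := by
  obtain ⟨C, hC0, hC⟩ := exists_G_symm_bound hτ (by linarith : τ ≤ τ + 1)
  have hi : Integrable fun y => |θ y| * (1 + y ^ 2)⁻¹ :=
    MemLp.integrable_mul_real hθ.norm memLp_inv_one_add_sq
  set J := ∫ y, |θ y| * (1 + y ^ 2)⁻¹ with hJ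
  have hJ0 : 0 ≤ J := integral_nonneg fun y => by positivity
  refine ⟨C * J, by positivity, fun s hs a b ha hab hb => ?_⟩
  have hs0 : 0 < s := hτ.trans_le hs.1
  have hii : ∀ z, Integrable fun y => θ y * G s (y - z) := fun z =>
    MemLp.integrable_mul_real hθ (memLp_G hs0 z)
  have hii' : ∀ z, Integrable fun y => θ y * G s (y + z) := fun z => by
    simpa using hii (-z)
  -- Evenness of `θ` lets the kernel be replaced by its symmetrisation, whose dependence on the
  -- centre is quadratic near `0`.
  have hrefl : ∀ z, ∫ y, θ y * G s (y - z) = ∫ y, θ y * G s (y + z) := by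
    intro z
    rw [← integral_neg_eq_self (fun y => θ y * G s (y - z))]
    refine integral_congr_ae (ae_of_all _ fun y => ?_)
    simp only
    rw [he, ← G_neg s (y + z)]
    congr 2
    ring
  have h1 : ∫ y, θ y * ((G s (y - b) - G s (y - a)) + (G s (y + b) - G s (y + a))) =
      2 * ((∫ y, θ y * G s (y - b)) - ∫ y, θ y * G s (y - a)) := by
    have h2 : ∀ y, θ y * ((G s (y - b) - G s (y - a)) + (G s (y + b) - G s (y + a))) =
        (θ y * G s (y - b) - θ y * G s (y - a)) + (θ y * G s (y + b) - θ y * G s (y + a)) :=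
      fun y => by ring
    simp_rw [h2]
    have hA : Integrable fun y => θ y * G s (y - b) - θ y * G s (y - a) := (hii b).sub (hii a)
    have hB : Integrable fun y => θ y * G s (y + b) - θ y * G s (y + a) := (hii' b).sub (hii' a)
    rw [integral_add hA hB, integral_sub (hii b) (hii a), integral_sub (hii' b) (hii' a), ← hrefl, ← hrefl]
    ring
  have h3 : |∫ y, θ y * ((G s (y - b) - G s (y - a)) + (G s (y + b) - G s (y + a)))| ≤
      C * b * (b - a) * J := by
    rw [← Real.norm_eq_abs, hJ, ← integral_const_mul]
    refine norm_integral_le_of_norm_le (hi.const_mul _) (ae_of_all _ fun y => ?_)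
    rw [norm_mul, Real.norm_eq_abs, Real.norm_eq_abs]
    calc _ ≤ |θ y| * (C * b * (b - a) * (1 + y ^ 2)⁻¹) := by
          gcongr; exact hC s hs a b ha hab hb y
      _ = _ := by ring
  rw [h1, abs_mul, abs_two] at h3
  have h4 : 0 ≤ C * J * b * (b - a) := by
    have := sub_nonneg.2 hab
    have := ha.trans hab
    positivity
  nlinarith

/-! ### Lebesgue points and weighted time integrals -/

theorem integral_mul_nonpos_of_monotoneOn {w P : ℝ → ℝ} {t1 t0 : ℝ} (ht : t1 ≤ t0)
    (hw : IntervalIntegrable w volume t1 t0) (hP : AbsolutelyContinuousOnInterval P t1 t0)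
    (hmono : MonotoneOn P (Icc t1 t0)) (hP1 : 0 ≤ P t1)
    (hneg : ∀ t ∈ Icc t1 t0, ∫ x in t..t0, w x ≤ 0) : ∫ t in t1..t0, P t * w t ≤ 0 := by
  set B : ℝ → ℝ := fun t => ∫ x in t0..t, w x with hB
  have hBpos : ∀ t ∈ Icc t1 t0, 0 ≤ B t := fun t h => by
    rw [hB]
    simp only
    rw [intervalIntegral.integral_symm]
    linarith [hneg t h]
  have hBAC : AbsolutelyContinuousOnInterval B t1 t0 :=
    hw.absolutelyContinuousOnInterval_intervalIntegral right_mem_uIcc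
  -- With `B t = -∫ x in t..t0, w x ≥ 0` and `B t0 = 0`, integration by parts gives `∫ P w = -P t1 ·
  -- B t1 - ∫ P' B`, and both terms are nonpositive.
  have h1 := hP.integral_mul_deriv_eq_deriv_mul hBAC
  have h2 : ∫ t in t1..t0, P t * deriv B t = ∫ t in t1..t0, P t * w t := by
    refine intervalIntegral.integral_congr_ae ?_
    filter_upwards [hw.ae_hasDerivAt_integral] with t h3 h4
    rw [(h3 (uIoc_subset_uIcc h4) t0 right_mem_uIcc).deriv]
  have h3 : 0 ≤ ∫ t in t1..t0, deriv P t * B t := by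
    refine intervalIntegral.integral_nonneg_of_ae_restrict ht ?_
    rw [Filter.EventuallyLE, ae_restrict_iff' measurableSet_Icc]
    have hne : ∀ᵐ t : ℝ, t ≠ t0 ∧ t ≠ t1 := by
      refine Filter.Eventually.and ?_ ?_ <;> simp [ae_iff, measure_singleton]
    filter_upwards [hne] with t h4 h5
    have h6 : t ∈ Ioo t1 t0 := ⟨lt_of_le_of_ne h5.1 h4.2.symm, lt_of_le_of_ne h5.2 h4.1⟩
    have h7 := hmono.derivWithin_nonneg (x := t)
    rw [derivWithin_of_mem_nhds (Icc_mem_nhds h6.1 h6.2)] at h7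
    exact mul_nonneg h7 (hBpos t h5)
  have h4 : B t0 = 0 := by simp [hB]
  rw [h2, h4, mul_zero, zero_sub] at h1
  have h5 := mul_nonneg hP1 (hBpos t1 ⟨le_rfl, ht⟩)
  linarith

theorem contDiffOn_Psi {a t1 t0 : ℝ} (ha : 0 < a) :
    ContDiffOn ℝ 1 (fun t => Psi a (t0 - t)) (Icc t1 t0) := by
  unfold Psi
  have h0 : ∀ t ∈ Icc t1 t0, a ^ 2 + (t0 - t) ≠ 0 := fun t ht => by
    have := sub_nonneg.2 ht.2
    positivity
  have h1 : ContDiffOn ℝ 1 (fun t => a ^ 2 + (t0 - t)) (Icc t1 t0) := by fun_prop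
  refine contDiffOn_const.div (h1.mul (h1.sqrt h0)) fun t ht => ?_
  have := sub_nonneg.2 ht.2
  positivity

theorem Psi_nonneg {a s : ℝ} (ha : 0 < a) (hs : 0 ≤ s) : 0 ≤ Psi a s := by
  unfold Psi; positivity

/-- The antiderivative `2a (a² + t0 - t)^{-1/2}` equals `2` at `t0` whatever `a` is: the mass stays
bounded as the kernel concentrates. -/
theorem integral_Psi_le {a t1 t0 : ℝ} (ha : 0 < a) (ht : t1 ≤ t0) :
    ∫ t in t1..t0, Psi a (t0 - t) ≤ 2 := by
  have hd : ∀ t ∈ uIcc t1 t0,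
      HasDerivAt (fun t => 2 * a * (Real.sqrt (a ^ 2 + (t0 - t)))⁻¹) (Psi a (t0 - t)) t := by
    intro t h
    rw [uIcc_of_le ht] at h
    have h1 := sub_nonneg.2 h.2
    have h2 : 0 < a ^ 2 + (t0 - t) := by positivity
    have h3 : HasDerivAt (fun t => a ^ 2 + (t0 - t)) (-1) t := by
      simpa using ((hasDerivAt_id t).const_sub t0).const_add (a ^ 2)
    have h4 := ((h3.sqrt h2.ne').fun_inv (Real.sqrt_pos.2 h2).ne').const_mul (2 * a)
    refine h4.congr_deriv ?_
    rw [Real.sq_sqrt h2.le, Psi]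
    have := (Real.sqrt_pos.2 h2).ne'
    field_simp
  rw [intervalIntegral.integral_eq_sub_of_hasDerivAt hd]
  · simp only [sub_self, add_zero]
    rw [Real.sqrt_sq ha.le, mul_assoc, mul_inv_cancel₀ ha.ne', mul_one]
    have : 0 ≤ 2 * a * (Real.sqrt (a ^ 2 + (t0 - t1)))⁻¹ := by positivity
    linarith
  · exact ContinuousOn.intervalIntegrable_of_Icc ht (contDiffOn_Psi ha).continuousOn

/-- The maximal function estimate for the Poisson-like kernel `Psi`. -/
theorem integral_mul_Psi_le {v : ℝ → ℝ} {a η t1 t0 : ℝ} (ha : 0 < a) (hη : 0 ≤ η) (ht : t1 ≤ t0)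
    (hv : IntervalIntegrable v volume t1 t0)
    (hb : ∀ t ∈ Icc t1 t0, ∫ x in t..t0, v x ≤ η * (t0 - t)) :
    ∫ t in t1..t0, v t * Psi a (t0 - t) ≤ 2 * η := by
  obtain ⟨K, hK⟩ := (contDiffOn_Psi (t1 := t1) (t0 := t0) ha).exists_lipschitzOnWith one_ne_zero
    (convex_Icc _ _) isCompact_Icc
  rw [← uIcc_of_le ht] at hK
  have hc : ContinuousOn (fun t => Psi a (t0 - t)) (uIcc t1 t0) := hK.continuousOn
  have hci : IntervalIntegrable (fun _ : ℝ => η) volume t1 t0 := intervalIntegrable_const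
  -- Since `Psi` increases as `t` approaches `t0`, the bound on the means of `v` over the intervals
  -- `[t, t0]` passes to the weighted mean.
  have h1 := integral_mul_nonpos_of_monotoneOn (w := fun t => v t - η) ht (hv.sub hci)
    hK.absolutelyContinuousOnInterval (fun x hx y hy hxy =>
      Psi_anti ha (sub_nonneg.2 hy.2) (by linarith)) (Psi_nonneg ha (sub_nonneg.2 ht))
    fun t h => by
      rw [intervalIntegral.integral_sub _ intervalIntegrable_const,
        intervalIntegral.integral_const, smul_eq_mul]
      · linarith [hb t h]
      · refine hv.mono_set ?_
        rw [uIcc_of_le ht, uIcc_of_le h.2]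
        exact Icc_subset_Icc_left h.1
  simp only [mul_sub] at h1
  rw [intervalIntegral.integral_sub (hv.continuousOn_mul hc) (hci.continuousOn_mul hc),
    intervalIntegral.integral_mul_const] at h1
  have h2 := mul_le_mul_of_nonneg_right (integral_Psi_le ha ht) hη
  simp only [mul_comm (v _)]
  linarith

/-- The Lebesgue differentiation theorem along the intervals `[s, t0]`; taking `r < t0` keeps them
inside `(0, T)`, where the indicator has no effect. -/
theorem ae_left_lebesgue_point {u : ℝ → ℝ} {T : ℝ} (hu : IntegrableOn u (Ioo 0 T)) :
    ∀ᵐ t0 ∂(volume.restrict (Ioo 0 T)), ∀ η > 0, ∃ r, 0 < r ∧ r < t0 ∧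
      ∀ s ∈ Icc (t0 - r) t0, ∫ x in s..t0, |u x - u t0| ≤ η * (t0 - s) := by
  rw [ae_restrict_iff' measurableSet_Ioo]
  have hf : Integrable ((Ioo 0 T).indicator u) := hu.integrable_indicator measurableSet_Ioo
  filter_upwards [(IsUnifLocDoublingMeasure.vitaliFamily volume 1).ae_tendsto_average_norm_sub
    hf.locallyIntegrable] with t0 h1 h2 η hη
  have h3 := (h1.comp (Real.tendsto_Icc_vitaliFamily_left t0)).eventually (gt_mem_nhds hη)
  obtain ⟨l, hl, h4⟩ := mem_nhdsLT_iff_exists_Ioo_subset.1 h3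
  have hl' : l < t0 := hl
  have h20 : 0 < t0 := h2.1
  refine ⟨min ((t0 - l) / 2) (t0 / 2), by have := sub_pos.2 hl'; positivity,
    (min_le_right _ _).trans_lt (by linarith), fun s hs => ?_⟩
  have hm1 := min_le_left ((t0 - l) / 2) (t0 / 2)
  have hm2 := min_le_right ((t0 - l) / 2) (t0 / 2)
  rcases eq_or_lt_of_le hs.2 with rfl | hst
  · simp
  have h5 := h4 ⟨by linarith [hs.1], hst⟩
  simp only [mem_ofPred_eq, Function.comp] at h5
  rw [setAverage_eq, smul_eq_mul, Real.volume_real_Icc_of_le hst.le,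
    inv_mul_lt_iff₀ (sub_pos.2 hst)] at h5
  rw [intervalIntegral.integral_of_le hst.le, ← integral_Icc_eq_integral_Ioc, mul_comm η]
  refine le_trans (le_of_eq (setIntegral_congr_fun measurableSet_Icc fun y hy => ?_)) h5.le
  have hy' : y ∈ Ioo 0 T := ⟨by linarith [hs.1, hy.1], hy.2.trans_lt h2.2⟩
  simp only [indicator_of_mem hy', indicator_of_mem h2, Real.norm_eq_abs]

/-- The convolution of two integrable functions, here `A` and `r^{-3/4}` cut off to `(0, T)`, exists
almost everywhere. No more than `L¹` in time is known for the solution. -/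
theorem ae_intervalIntegrable_mul_rpow {A : ℝ → ℝ} {T : ℝ} (hA : IntegrableOn A (Ioo 0 T)) :
    ∀ᵐ t0 ∂(volume.restrict (Ioo 0 T)),
      IntervalIntegrable (fun t => A t * (t0 - t) ^ (-(3 / 4) : ℝ)) volume 0 t0 := by
  rw [ae_restrict_iff' measurableSet_Ioo]
  have hf : Integrable ((Ioo 0 T).indicator A) := hA.integrable_indicator measurableSet_Ioo
  have hp : Integrable ((Ioo 0 T).indicator fun r : ℝ => r ^ (-(3 / 4) : ℝ)) := by
    refine IntegrableOn.integrable_indicator ?_ measurableSet_Ioo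
    rcases le_or_gt 0 T with hT | hT
    · rw [← intervalIntegrable_iff_integrableOn_Ioo_of_le hT]
      exact intervalIntegral.intervalIntegrable_rpow' (by norm_num)
    · simp [Ioo_eq_empty_of_le hT.le]
  filter_upwards [hf.ae_convolution_exists (ContinuousLinearMap.mul ℝ ℝ) hp] with t0 h1 h2
  rw [intervalIntegrable_iff_integrableOn_Ioo_of_le h2.1.le]
  refine (h1.integrable.integrableOn (s := Ioo 0 t0)).congr_fun (fun t ht => ?_) measurableSet_Ioo
  have m1 : t ∈ Ioo 0 T := ⟨ht.1, ht.2.trans h2.2⟩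
  have m2 : t0 - t ∈ Ioo 0 T := ⟨sub_pos.2 ht.2, by linarith [ht.1, h2.2]⟩
  simp [indicator_of_mem m1, indicator_of_mem m2]

/-! ### Slopes of the solution near the origin at a fixed time -/

theorem IsLift.exists_abs_le (h : Admissible ρ k γ) {φ : H1 ρ k} {g g' : ℝ → ℝ}
    (hl : IsLift φ g g') (hp : IsPrim g g') : ∃ B, ∀ y, |g y| ≤ B := by
  refine ⟨Real.sqrt (2 * ((∫ y, g y ^ 2) + ∫ y, g' y ^ 2)), fun y => ?_⟩
  rw [← Real.sqrt_sq_eq_abs]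
  exact Real.sqrt_le_sqrt (hp.sq_le (hl.memLp_fst h) (hl.memLp_snd h) y)

/-- The increments of the solution near `0`, corrected by a multiple of `E`. -/
theorem IsSolution.slope_bound (h : Admissible ρ k γ) {T : ℝ} {u : ℝ → ℝ} {W0 : H1 ρ k}
    {W : ℝ → H1 ρ k} (hW : IsSolution γ T u W0 W) {M : ℝ} (hM : ∀ᵐ x : ℝ, |pot ρ k γ x| ≤ M)
    {H : ℝ → ℝ} (hH : ∀ᵐ t ∂(volume.restrict (Ioo 0 T)), ‖fn (W t)‖ ≤ H t)
    {t0 t1 : ℝ} (u0 : ℝ) (ht1 : 0 ≤ t1) (ht10 : t1 < t0) (htT : t0 ≤ T)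
    {aE : L2rho ρ} (haE : IsTransf ρ k aE E)
    {g0 g0' : ℝ → ℝ} (hl0 : IsLift (W t0) g0 g0') (hp0 : IsPrim g0 g0') :
    ∃ C, 0 ≤ C ∧ ∀ a b, 0 < a → a ≤ b → b ≤ 2 * a → b ≤ 1 → IntervalIntegrable
      (weight M (|u0 * mul4 ρ k 0| * ‖aE‖) (mul4 ρ k 0) u0 t0 a H u) volume t1 t0 →
      |(g0 b + u0 * mul4 ρ k 0 * E b) - (g0 a + u0 * mul4 ρ k 0 * E a)| ≤
        C * b * (b - a) + (b - a) * ∫ t in t1..t0,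
          weight M (|u0 * mul4 ρ k 0| * ‖aE‖) (mul4 ρ k 0) u0 t0 a H u t := by
  obtain ⟨g1, g1', hl1, hp1⟩ := exists_isLift h (W t1)
  have he := isLift_even h (hW.even t1 ⟨ht1, ht10.le.trans htT⟩) hl1 hp1.continuous
  set c := u0 * mul4 ρ k 0 with hc
  have hτ : 0 < t0 - t1 := sub_pos.2 ht10
  obtain ⟨C, hC0, hC⟩ := exists_even_bound (θ := fun y => g1 y + c * E y)
    ((hl1.memLp_fst h).add (memLp_E.const_mul c)) (fun y => by rw [he, E_neg]) hτ
  refine ⟨C, hC0, fun a b ha hab hb2 hb1 hK => ?_⟩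
  obtain ⟨B, hB⟩ := hl0.exists_abs_le h hp0
  have hcont : Continuous fun y => g0 y + c * E y :=
    hp0.continuous.add (continuous_const.mul continuous_E)
  have hbd : ∀ y, |g0 y + c * E y| ≤ B + |c| := fun y => by
    refine (abs_add_le _ _).trans (add_le_add (hB y) ?_)
    rw [abs_mul, abs_of_pos (E_pos y)]
    exact mul_le_of_le_one_right (abs_nonneg c) (le_of_abs_le (E_le_one y))
  have hlim := ((tendsto_integral_mul_G hcont hbd b).sub
    (tendsto_integral_mul_G hcont hbd a)).abs
  refine le_of_tendsto hlim ?_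
  -- For `ε < 1` the kernel time `t0 - t1 + ε` stays in the interval `[τ, τ + 1]`, `τ = t0 - t1`, of
  -- the smoothing bound, so `C` is uniform in `ε`.
  filter_upwards [Ioo_mem_nhdsGT (zero_lt_one' ℝ)] with ε hε
  refine (hW.difference_bound h hM hH ht1 ht10 htT hε.1 haE ha hab hb2 hK hl0 hl1).trans ?_
  gcongr
  exact hC _ ⟨by linarith [hε.1], by linarith [hε.2]⟩ a b ha.le hab hb1

/-- The order of choices: `t1` close to `t0` makes the two time integrals small uniformly in `a`;
only then is `δ` chosen, as the smoothing constant `C` depends on `t0 - t1`. -/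
theorem IsSolution.slope_small (h : Admissible ρ k γ) {T : ℝ} {u : ℝ → ℝ} {W0 : H1 ρ k}
    {W : ℝ → H1 ρ k} (hW : IsSolution γ T u W0 W) {M : ℝ} (hM : ∀ᵐ x : ℝ, |pot ρ k γ x| ≤ M)
    {H : ℝ → ℝ} (hH : ∀ᵐ t ∂(volume.restrict (Ioo 0 T)), ‖fn (W t)‖ ≤ H t)
    (hu : IntegrableOn u (Ioo 0 T))
    {t0 : ℝ} (ht0 : t0 ∈ Ioo 0 T)
    (hL : ∀ η > 0, ∃ r, 0 < r ∧ r < t0 ∧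
      ∀ s ∈ Icc (t0 - r) t0, ∫ x in s..t0, |u x - u t0| ≤ η * (t0 - s))
    (hI : ∀ A : ℝ, IntervalIntegrable
      (fun t => (M * H t + A) * (t0 - t) ^ (-(3 / 4) : ℝ)) volume 0 t0)
    {g0 g0' : ℝ → ℝ} (hl0 : IsLift (W t0) g0 g0') (hp0 : IsPrim g0 g0') {η : ℝ} (hη : 0 < η) :
    ∃ δ > 0, ∀ a b, 0 < a → a ≤ b → b ≤ 2 * a → b ≤ δ →
      |(g0 b + u t0 * mul4 ρ k 0 * E b) - (g0 a + u t0 * mul4 ρ k 0 * E a)| ≤ η * (b - a) := by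
  obtain ⟨aE, haE⟩ := IsTransf.exists_of_memLp h memLp_E
  set m := mul4 ρ k 0 with hm
  have hm0 : 0 < m := h.mul4_pos 0
  set e := |u t0 * m| * ‖aE‖ with he
  -- The constant is chosen so that `64 m · 2 · η/(384 m) = η/3`, with `64 m` from `weight` and `2`
  -- from the mass of `Psi`.
  obtain ⟨r, hr0, hrt, hr⟩ := hL (η / (384 * m)) (by positivity)
  have hIe := hI e
  have hcont : ContinuousOn (fun x => ∫ t in x..t0, (M * H t + e) * (t0 - t) ^ (-(3 / 4) : ℝ))
      (uIcc 0 t0) := by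
    refine intervalIntegral.continuousOn_primitive_interval_left ?_
    rw [uIcc_of_le ht0.1.le, integrableOn_Icc_iff_integrableOn_Ioc,
      ← intervalIntegrable_iff_integrableOn_Ioc_of_le ht0.1.le]
    exact hIe
  have hev : ∀ᶠ x in 𝓝[<] t0, ∫ t in x..t0, (M * H t + e) * (t0 - t) ^ (-(3 / 4) : ℝ) < η / 3 := by
    have h1 := hcont t0 right_mem_uIcc
    rw [ContinuousWithinAt, intervalIntegral.integral_same, uIcc_of_le ht0.1.le] at h1
    have h2 : 𝓝[<] t0 ≤ 𝓝[Icc 0 t0] t0 := by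
      refine nhdsWithin_le_iff.2 ?_
      exact mem_of_superset (Ioo_mem_nhdsLT ht0.1) Ioo_subset_Icc_self
    exact (h1.mono_left h2).eventually (gt_mem_nhds (by positivity))
  obtain ⟨t1, h1, h1r⟩ := (hev.and (Ioo_mem_nhdsLT (sub_lt_self t0 hr0))).exists
  have ht1 : 0 ≤ t1 := by linarith [h1r.1]
  have ht10 : t1 < t0 := h1r.2
  have hsub : ∀ {f : ℝ → ℝ}, IntegrableOn f (Ioo 0 T) → IntervalIntegrable f volume t1 t0 :=
    fun hf => by
      rw [intervalIntegrable_iff_integrableOn_Ioo_of_le ht10.le]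
      exact hf.mono_set (Ioo_subset_Ioo ht1 ht0.2.le)
  have hvi : IntervalIntegrable (fun t => |u t - u t0|) volume t1 t0 :=
    ((hsub hu).sub intervalIntegrable_const).norm
  have hi1 : IntervalIntegrable (fun t => (M * H t + e) * (t0 - t) ^ (-(3 / 4) : ℝ))
      volume t1 t0 := by
    refine hIe.mono_set ?_
    rw [uIcc_of_le ht10.le, uIcc_of_le ht0.1.le]
    exact Icc_subset_Icc_left ht1
  obtain ⟨C, hC0, hC⟩ := hW.slope_bound h hM hH (u t0) ht1 ht10 ht0.2.le haE hl0 hp0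
  refine ⟨min 1 (η / (3 * (C + 1))), by positivity, fun a b ha hab hb2 hb => ?_⟩
  have hb1 := hb.trans (min_le_left _ _)
  have hb' := hb.trans (min_le_right _ _)
  have hi2 : IntervalIntegrable (fun t => 64 * m * (|u t - u t0| * Psi a (t0 - t)))
      volume t1 t0 := by
    refine (hvi.mul_continuousOn ?_).const_mul _
    rw [uIcc_of_le ht10.le]
    exact (contDiffOn_Psi ha).continuousOn
  have h2 := hC a b ha hab hb2 hb1 (hi1.add hi2)
  have h3 := integral_mul_Psi_le ha (by positivity) ht10.le hvi
    fun t ht => hr t ⟨by linarith [ht.1, h1r.1], ht.2⟩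
  have h4 : ∫ t in t1..t0, weight M e m (u t0) t0 a H u t =
      (∫ t in t1..t0, (M * H t + e) * (t0 - t) ^ (-(3 / 4) : ℝ)) +
        64 * m * ∫ t in t1..t0, |u t - u t0| * Psi a (t0 - t) := by
    rw [← intervalIntegral.integral_const_mul, ← intervalIntegral.integral_add hi1 hi2]
    rfl
  have h5 : 64 * m * (∫ t in t1..t0, |u t - u t0| * Psi a (t0 - t)) ≤ η / 3 := by
    refine (mul_le_mul_of_nonneg_left h3 (by positivity)).trans (le_of_eq ?_)
    field_simp
    norm_num
  have h6 : C * b ≤ η / 3 := by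
    rw [le_div_iff₀ (by positivity)] at hb'
    have : 0 < b := ha.trans_le hab
    nlinarith
  have hba := sub_nonneg.2 hab
  refine h2.trans ?_
  rw [h4]
  calc _ ≤ η / 3 * (b - a) + (b - a) * (η / 3 + η / 3) := by gcongr
    _ = _ := by ring

/-- The slope of the lifted solution at `0⁺`. -/
theorem hasValueAtZeroPlus_of_slope {g g' : ℝ → ℝ} (hp : IsPrim g g') {c : ℝ}
    (hs : ∀ η > 0, ∃ δ > 0, ∀ a b, 0 < a → a ≤ b → b ≤ 2 * a → b ≤ δ →
      |(g b + c * E b) - (g a + c * E a)| ≤ η * (b - a)) : HasValueAtZeroPlus g' c := by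
  have key : ∀ η > 0, ∃ δ > 0, ∀ᵐ y : ℝ, y ∈ Ioo 0 δ → |g' y - c * Real.exp (-y)| ≤ η := by
    intro η hη
    obtain ⟨δ, hδ, h1⟩ := hs η hη
    refine ⟨δ, hδ, ?_⟩
    filter_upwards [hp.ae_hasDerivAt] with y h2 hy
    have h3 : HasDerivAt E (-Real.exp (-y)) y := by
      have h4 : HasDerivAt (fun y => Real.exp (-y)) (-Real.exp (-y)) y := by
        simpa using (hasDerivAt_id y).neg.exp
      refine h4.congr_of_eventuallyEq ?_
      filter_upwards [lt_mem_nhds hy.1] with x hx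
      rw [E, abs_of_pos hx]
    have h5 : HasDerivAt (fun y => g y + c * E y) (g' y - c * Real.exp (-y)) y :=
      (h2.add (h3.const_mul c)).congr_deriv (by ring)
    have h6 := ((hasDerivAt_iff_tendsto_slope.1 h5).mono_left
      (nhdsWithin_mono y (s := Ioi y) fun x hx => (mem_Ioi.1 hx).ne')).abs
    refine le_of_tendsto h6 ?_
    have hy0 : 0 < y := hy.1
    filter_upwards [Ioo_mem_nhdsGT (lt_min hy.2 (by linarith : y < 2 * y))] with b hb
    have hyb : 0 < b - y := sub_pos.2 hb.1
    rw [slope_def_field, abs_div, abs_of_pos hyb, div_le_iff₀ hyb]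
    exact h1 y b hy0 hb.1.le (hb.2.le.trans (min_le_right _ _)) (hb.2.le.trans (min_le_left _ _))
  have hexp : Tendsto (fun y => c * Real.exp (-y)) (𝓝[>] 0 ⊓ ae volume) (𝓝 c) := by
    have : Continuous fun y => c * Real.exp (-y) := by fun_prop
    have h1 := (this.tendsto 0).mono_left (nhdsWithin_le_nhds (s := Ioi 0))
    rw [neg_zero, Real.exp_zero, mul_one] at h1
    exact h1.mono_left inf_le_left
  have hzero : Tendsto (fun y => g' y - c * Real.exp (-y)) (𝓝[>] 0 ⊓ ae volume) (𝓝 0) := by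
    rw [Metric.tendsto_nhds]
    intro ε hε
    obtain ⟨δ, hδ, h1⟩ := key (ε / 2) (by positivity)
    have h2 : ∀ᶠ y : ℝ in 𝓝[>] 0 ⊓ ae volume, y ∈ Ioo 0 δ :=
      inf_le_left (a := 𝓝[>] (0 : ℝ)) (Ioo_mem_nhdsGT hδ)
    have h3 : ∀ᶠ y : ℝ in 𝓝[>] 0 ⊓ ae volume, y ∈ Ioo 0 δ → |g' y - c * Real.exp (-y)| ≤ ε / 2 :=
      inf_le_right (a := 𝓝[>] (0 : ℝ)) h1
    filter_upwards [h2, h3] with y h4 h5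
    rw [Real.dist_eq, sub_zero]
    linarith [h5 h4]
  have h1 := hzero.add hexp
  rw [zero_add] at h1
  exact h1.congr fun y => by ring

/-! ### Return to the original variable -/

theorem IsTransf.hasValueAtZeroPlus (h : Admissible ρ k γ) {f ψ : ℝ → ℝ} (hf : IsTransf ρ k f ψ)
    {c : ℝ} (hψ : HasValueAtZeroPlus ψ (c * mul4 ρ k 0)) : HasValueAtZeroPlus f c := by
  have hm := h.mul4_pos 0
  have h1 : Tendsto (sig ρ k) (𝓝[>] 0 ⊓ ae volume) (𝓝[>] 0 ⊓ ae volume) := by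
    refine tendsto_inf.2 ⟨tendsto_inf_left ?_, tendsto_inf_right h.quasiMeasurePreserving_sig.tendsto_ae⟩
    refine tendsto_nhdsWithin_iff.2 ⟨?_, ?_⟩
    · have := h.continuous_sig.tendsto 0
      rw [sig_zero] at this
      exact this.mono_left nhdsWithin_le_nhds
    · filter_upwards [self_mem_nhdsWithin] with x hx
      rw [mem_Ioi, ← sig_zero (ρ := ρ) (k := k)]
      exact h.strictMono_sig hx
  have h2 : Tendsto (mul4 ρ k) (𝓝[>] 0 ⊓ ae volume) (𝓝 (mul4 ρ k 0)) :=
    ((h.continuous_mul4.tendsto 0).mono_left nhdsWithin_le_nhds).mono_left inf_le_left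
  have h3 := (hψ.comp h1).div h2 hm.ne'
  rw [mul_div_cancel_right₀ _ hm.ne'] at h3
  refine h3.congr' ?_
  have h4 := inf_le_right (a := 𝓝[>] (0 : ℝ)) hf.symm
  exact h4

theorem IsWeakDerivOn.mono {Ω Ω' : Set ℝ} {f f' : ℝ → ℝ} (hf : IsWeakDerivOn Ω f f')
    (hΩ : Ω' ⊆ Ω) : IsWeakDerivOn Ω' f f' :=
  ⟨hf.loc.mono_set hΩ, hf.loc_deriv.mono_set hΩ,
    fun ψ h1 h2 h3 => hf.by_parts ψ h1 h2 (h3.trans hΩ)⟩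

theorem IsWeakDerivOn.congr_left {Ω : Set ℝ} {f g f' : ℝ → ℝ} (hf : IsWeakDerivOn Ω f f')
    (hfg : f =ᵐ[volume] g) : IsWeakDerivOn Ω g f' := by
  refine ⟨hf.loc.congr (ae_restrict_of_ae hfg), hf.loc_deriv, fun ψ h1 h2 h3 => ?_⟩
  rw [← hf.by_parts ψ h1 h2 h3]
  refine integral_congr_ae ?_
  filter_upwards [hfg] with x hx
  rw [hx]

/-- The Neumann condition for an element of `ℍ¹` whose derivative has a value at `0⁺`. -/
theorem exists_neumann (h : Admissible ρ k γ) {φ : H1 ρ k} {c : ℝ}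
    (hc : HasValueAtZeroPlus (opD φ) c) : ∃ wx : ℝ → ℝ, IsWeakDerivOn (Ioi 0) (fn φ) wx ∧
      HasValueAtZeroPlus (fun x => Real.sqrt (k x / ρ x) * wx x) c := by
  obtain ⟨F, f', hF, hp, hD⟩ := H1.exists_rep h φ
  refine ⟨f', (hp.isWeakDerivOn.mono (subset_univ _)).congr_left hF.symm, ?_⟩
  -- `Q1` vanishes at `0` and `F` is continuous, so `𝔻φ` and `√(k/ρ) φ'` have the same value at
  -- `0⁺`.
  have h1 : Tendsto (fun x => Q1 ρ k x * F x) (𝓝[>] 0 ⊓ ae volume) (𝓝 0) := by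
    have h2 := (h.continuous_Q1.mul hp.continuous).tendsto 0
    rw [Pi.mul_apply, h.Q1_zero, zero_mul] at h2
    exact (h2.mono_left nhdsWithin_le_nhds).mono_left inf_le_left
  have h2 := Tendsto.sub hc h1
  rw [sub_zero] at h2
  refine h2.congr' (inf_le_right (a := 𝓝[>] (0 : ℝ)) ?_)
  filter_upwards [hD] with x hx
  rw [hx]
  ring

end HalfAxisHeat

theorem mainTheorem6 (ρ k γ : ℝ → ℝ) (hcoef : HalfAxisHeat.Admissible ρ k γ)
    (T : ℝ) (hT : 0 < T)
    (u : ℝ → ℝ) (hu : MemLp u ∞ (volume.restrict (Ioo 0 T)))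
    (W0 : HalfAxisHeat.H1 ρ k) (hW0 : HalfAxisHeat.IsEven W0)
    (W : ℝ → HalfAxisHeat.H1 ρ k) (hW : HalfAxisHeat.IsSolution γ T u W0 W) :
    ∀ᵐ t ∂(volume.restrict (Ioo 0 T)),
      HalfAxisHeat.HasValueAtZeroPlus (HalfAxisHeat.opD (W t)) (u t) ∧
      ∃ wx : ℝ → ℝ, HalfAxisHeat.IsWeakDerivOn (Ioi 0) (HalfAxisHeat.fn (W t)) wx ∧
        HalfAxisHeat.HasValueAtZeroPlus (fun x => Real.sqrt (k x / ρ x) * wx x) (u t) := by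
  obtain ⟨M, -, hM⟩ := hcoef.exists_pot_bound
  obtain ⟨H, hHi, hH⟩ := hW.exists_bound hcoef hT hu
  have hui : IntegrableOn u (Ioo 0 T) := hu.integrable le_top
  have hone : IntegrableOn (fun _ : ℝ => (1 : ℝ)) (Ioo 0 T) := integrableOn_const (by simp)
  filter_upwards [HalfAxisHeat.ae_left_lebesgue_point hui,
    HalfAxisHeat.ae_intervalIntegrable_mul_rpow hHi,
    HalfAxisHeat.ae_intervalIntegrable_mul_rpow hone,
    ae_restrict_mem measurableSet_Ioo] with t h1 h2 h3 ht
  -- Every `A` is needed because the constant in the weight contains `u t`; splitting it off keeps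
  -- the exceptional null set independent of `A`.
  have hI : ∀ A : ℝ, IntervalIntegrable
      (fun s => (M * H s + A) * (t - s) ^ (-(3 / 4) : ℝ)) volume 0 t := fun A => by
    have h4 := (h2.const_mul M).add (h3.const_mul A)
    refine h4.congr fun s _ => ?_
    ring
  obtain ⟨g, g', hl, hp⟩ := HalfAxisHeat.exists_isLift hcoef (W t)
  have hval : HalfAxisHeat.HasValueAtZeroPlus (HalfAxisHeat.opD (W t)) (u t) :=
    hl.snd.hasValueAtZeroPlus hcoef (HalfAxisHeat.hasValueAtZeroPlus_of_slope hp fun η hη =>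
      hW.slope_small hcoef hM hH hui ht h1 hI hl hp hη)
  exact ⟨hval, HalfAxisHeat.exists_neumann hcoef hval⟩
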